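/- Let $\Bbbk$ be a field, and let $R=\bigoplus_{n\in\mathbb Z}R^n$ be an augmented commutative differential graded algebra over $\Bbbk$ (differential of degree $+1$, $ab=(-1)^{\deg a\deg b}ba$, augmentation $R\to\Bbbk$ a morphism of differential graded algebras) such that $R=R^{\ge 0}$, $H^0(R)=\Bbbk$ and $H^{>N}(R)=0$ for some $N$. For an augmented commutative differential graded algebra $A$ over $\Bbbk$ let $\operatorname{Hom}(A)=\operatorname{Hom}_{\Bbbk}(A,\Bbbk)$ be the graded dual, a differential graded $A$-module, and put $$\mathcal T(A)=\operatorname{Tor}^A(\Bbbk,\operatorname{Hom}(A))=H(P\otimes_A\operatorname{Hom}(A)),\qquad \mathcal G(A)=\operatorname{Ext}_A(\Bbbk,A)=H(\operatorname{Hom}_A(P,A)),$$ where $P\xrightarrow{\simeq}\Bbbk$ is any semifree resolution of the $A$-module $\Bbbk$; $\dim$ is the total dimension of a graded vector space. $A$ is called Gorenstein if $\dim\mathcal G(A)=1$. A graded algebra $H$ is a Poincaré duality algebra if for some $n\ge 0$ one has $H=\{H^i\}_{0\le i\le n}$, $H^n=\Bbbk\,\alpha$ with $\alpha\ne 0$,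 and the pairing $\beta\gamma=\langle\beta,\gamma\rangle\alpha$ ($\beta\in H^i$, $\gamma\in H^{n-i}$) defines isomorphisms $H^i\cong\operatorname{Hom}(H^{n-i},\Bbbk)$ for $0\le i\le n$. Regard $H(R)$ as an augmented commutative differential graded algebra with zero differential and the induced augmentation. Then the following conditions are equivalent: (i) $\dim\mathcal T(R)=1$; (ii) $\dim\mathcal T(H(R))=1$; (iii) $H(R)$ is a Poincaré duality algebra. In this case $R$ is Gorenstein. -/

import Mathlib

open DirectSum TensorProduct

universe u v w w'

namespace DGA

/-! ### Graded vector spaces -/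

section Graded

variable {k : Type u} [Field k] {M : Type v} [AddCommGroup M] [Module k M]

/-- A family of subspaces that spans, and has projections onto its members, is a grading. -/
theorem isInternal_of_ker (gr : ℤ → Submodule k M) (K : ℤ → Submodule k M)
    (hK : ∀ i j, j ≠ i → gr j ≤ K i) (hd : ∀ i x, x ∈ gr i → x ∈ K i → x = 0)
    (hsup : ⨆ i, gr i = ⊤) : DirectSum.IsInternal gr := by
  rw [DirectSum.isInternal_submodule_iff_iSupIndep_and_iSup_eq_top]
  refine ⟨fun i => ?_, hsup⟩
  rw [Submodule.disjoint_def]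
  intro x hx hx'
  exact hd i x hx ((iSup₂_le fun j hj => hK i j hj : ⨆ j, ⨆ (_ : j ≠ i), gr j ≤ K i) hx')

variable (gr : ℤ → Submodule k M) [DirectSum.Decomposition gr]

/-- The degree involution `x ↦ (-1)^{deg x} x` of a graded vector space. -/
noncomputable def invol : M →ₗ[k] M :=
  (DirectSum.toModule k ℤ M fun i => (-1 : k) ^ i • (gr i).subtype) ∘ₗ
    (DirectSum.decomposeLinearEquiv gr).toLinearMap

theorem invol_of_mem {i : ℤ} {x : M} (hx : x ∈ gr i) : invol gr x = (-1 : k) ^ i • x := by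
  have h : DirectSum.decomposeLinearEquiv gr x = DirectSum.lof k ℤ (fun i => gr i) i ⟨x, hx⟩ :=
    DirectSum.decompose_of_mem gr hx
  rw [invol, LinearMap.comp_apply, LinearEquiv.coe_coe, h, DirectSum.toModule_lof]
  rfl

/-- Linear maps that agree on homogeneous elements are equal. -/
theorem eq_of_homogeneous {M' : Type*} [AddCommGroup M'] [Module k M'] {f g : M →ₗ[k] M'}
    (h : ∀ i, ∀ x ∈ gr i, f x = g x) : f = g := by
  ext x
  induction x using DirectSum.Decomposition.inductionOn gr with
  | zero => simp
  | homogeneous x => exact h _ _ x.2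
  | add x y hx hy => simp [hx, hy]

/-- The projection onto the component of degree `i`. -/
noncomputable def pr (i : ℤ) : M →ₗ[k] M :=
  (gr i).subtype ∘ₗ DirectSum.component k ℤ (fun i => gr i) i ∘ₗ
    (DirectSum.decomposeLinearEquiv gr).toLinearMap

theorem pr_apply (i : ℤ) (x : M) : pr gr i x = (DirectSum.decompose gr x i : M) := rfl

theorem pr_mem (i : ℤ) (x : M) : pr gr i x ∈ gr i := by
  rw [pr_apply]; exact (DirectSum.decompose gr x i).2

theorem pr_same {i : ℤ} {x : M} (hx : x ∈ gr i) : pr gr i x = x := by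
  rw [pr_apply, DirectSum.decompose_of_mem_same gr hx]

theorem pr_ne {i j : ℤ} {x : M} (hx : x ∈ gr j) (h : j ≠ i) : pr gr i x = 0 := by
  rw [pr_apply, DirectSum.decompose_of_mem_ne gr hx h]

theorem sum_pr (x : M) : ∃ s : Finset ℤ, ∑ i ∈ s, pr gr i x = x := by
  classical
  exact ⟨_, DirectSum.sum_support_decompose gr x⟩

theorem sgn_succ (i : ℤ) : (-1 : k) ^ (i + 1) = -(-1 : k) ^ i := by
  rw [zpow_add₀ (by simp)]; simp

theorem sgn_mul_self (i : ℤ) : (-1 : k) ^ i * (-1 : k) ^ i = 1 := by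
  rw [← mul_zpow]; simp

end Graded

/-! ### Augmented commutative differential graded algebras -/

/-- An augmented commutative differential graded algebra over the field `k`: a `ℤ`-graded
(associative, unital) algebra with `a b = (-1)^{deg a deg b} b a`, a differential of degree `1`
that is a derivation, and an augmentation, i.e. a morphism of differential graded algebras to
`k` (concentrated in degree `0`). -/
structure AugCDGA (k : Type u) [Field k] where
  carrier : Type v
  [ring : Ring carrier]
  [algebra : Algebra k carrier]
  gr : ℤ → Submodule k carrier
  [graded : GradedAlgebra gr]
  graded_comm : ∀ {m n : ℤ} {a b : carrier}, a ∈ gr m → b ∈ gr n →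
    a * b = (-1 : k) ^ (m * n) • (b * a)
  d : carrier →ₗ[k] carrier
  d_mem : ∀ {n : ℤ} {a : carrier}, a ∈ gr n → d a ∈ gr (n + 1)
  d_d : ∀ a, d (d a) = 0
  leibniz : ∀ {m : ℤ} {a : carrier}, a ∈ gr m → ∀ b,
    d (a * b) = d a * b + (-1 : k) ^ m • (a * d b)
  aug : carrier →ₐ[k] k
  aug_of_mem : ∀ {n : ℤ} {a : carrier}, a ∈ gr n → n ≠ 0 → aug a = 0
  aug_d : ∀ a, aug (d a) = 0

attribute [instance] AugCDGA.ring AugCDGA.algebra AugCDGA.graded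

variable {k : Type u} [Field k]

namespace AugCDGA

variable (R : AugCDGA.{u, v} k)

theorem mul_mem {m n : ℤ} {a b : R.carrier} (ha : a ∈ R.gr m) (hb : b ∈ R.gr n) :
    a * b ∈ R.gr (m + n) := SetLike.mul_mem_graded ha hb

/-- The degree involution of `R`. -/
noncomputable abbrev inv : R.carrier →ₗ[k] R.carrier := invol R.gr

theorem leibniz' (a b : R.carrier) : R.d (a * b) = R.d a * b + R.inv a * R.d b := by
  have : R.d ∘ₗ (LinearMap.mul k R.carrier).flip b =
      (LinearMap.mul k R.carrier).flip b ∘ₗ R.d +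
        (LinearMap.mul k R.carrier).flip (R.d b) ∘ₗ R.inv := by
    refine eq_of_homogeneous R.gr fun i x hx => ?_
    simp [R.leibniz hx, invol_of_mem R.gr hx]
  exact LinearMap.congr_fun this a

theorem inv_mul (a b : R.carrier) : R.inv (a * b) = R.inv a * R.inv b := by
  have : (LinearMap.mul k R.carrier).compr₂ R.inv =
      (LinearMap.mul k R.carrier).compl₁₂ R.inv R.inv := by
    refine eq_of_homogeneous R.gr fun i x hx => ?_
    refine eq_of_homogeneous R.gr fun j y hy => ?_
    simp [invol_of_mem R.gr hx, invol_of_mem R.gr hy, invol_of_mem R.gr (R.mul_mem hx hy),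
      zpow_add₀, smul_smul, mul_comm]
  exact LinearMap.congr_fun (LinearMap.congr_fun this a) b

theorem inv_one : R.inv 1 = 1 := by
  have := invol_of_mem R.gr (SetLike.GradedOne.one_mem (A := R.gr))
  simpa using this

theorem d_inv (a : R.carrier) : R.d (R.inv a) = - R.inv (R.d a) := by
  have : R.d ∘ₗ R.inv = - (R.inv ∘ₗ R.d) := by
    refine eq_of_homogeneous R.gr fun i x hx => ?_
    simp [invol_of_mem R.gr hx, invol_of_mem R.gr (R.d_mem hx), sgn_succ]
  exact LinearMap.congr_fun this a

theorem inv_inv (a : R.carrier) : R.inv (R.inv a) = a := by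
  have : R.inv ∘ₗ R.inv = LinearMap.id := by
    refine eq_of_homogeneous R.gr fun i x hx => ?_
    simp [invol_of_mem R.gr hx, smul_smul, sgn_mul_self]
  exact LinearMap.congr_fun this a

theorem d_one : R.d 1 = 0 := by
  have h := R.leibniz' 1 1
  rw [R.inv_one] at h
  simpa using h

theorem pr_d (i : ℤ) (a : R.carrier) : pr R.gr (i + 1) (R.d a) = R.d (pr R.gr i a) := by
  have : pr R.gr (i + 1) ∘ₗ R.d = R.d ∘ₗ pr R.gr i := by
    refine eq_of_homogeneous R.gr fun j x hx => ?_
    by_cases h : j = i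
    · subst h
      simp [pr_same R.gr hx, pr_same R.gr (R.d_mem hx)]
    · simp [pr_ne R.gr hx h, pr_ne R.gr (R.d_mem hx) (show j + 1 ≠ i + 1 by omega)]
  exact LinearMap.congr_fun this a

/-! ### The cohomology algebra -/

/-- The subalgebra of cocycles. -/
def cocycles : Subalgebra k R.carrier where
  carrier := {a | R.d a = 0}
  mul_mem' {a b} ha hb := by
    simp only [Set.mem_ofPred_eq] at *
    rw [R.leibniz', ha, hb]; simp
  add_mem' {a b} ha hb := by
    simp only [Set.mem_ofPred_eq] at *
    rw [map_add, ha, hb, add_zero]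
  algebraMap_mem' c := by
    simp [Algebra.algebraMap_eq_smul_one, R.d_one]

theorem mem_cocycles {a : R.carrier} : a ∈ R.cocycles ↔ R.d a = 0 := Iff.rfl

/-- The ideal of coboundaries in the algebra of cocycles. -/
def coboundaries : Ideal R.cocycles where
  carrier := {z | ∃ b, R.d b = z}
  add_mem' := by
    rintro x y ⟨a, ha⟩ ⟨b, hb⟩
    exact ⟨a + b, by simp [ha, hb]⟩
  zero_mem' := ⟨0, by simp⟩
  smul_mem' := by
    rintro z x ⟨b, hb⟩
    refine ⟨R.inv z * b, ?_⟩
    have hz : R.d z = 0 := z.2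
    rw [R.leibniz', R.d_inv, hz, R.inv_inv, hb]
    simp

theorem mem_coboundaries {z : R.cocycles} : z ∈ R.coboundaries ↔ ∃ b, R.d b = z := Iff.rfl

instance : R.coboundaries.IsTwoSided where
  mul_mem_of_left := by
    rintro x z ⟨b, hb⟩
    refine ⟨b * z, ?_⟩
    have hz : R.d z = 0 := z.2
    rw [R.leibniz', hz, hb]
    simp

/-- The cohomology algebra `H(R)`: cocycles modulo coboundaries. -/
abbrev H : Type v := R.cocycles ⧸ R.coboundaries

/-- The projection from cocycles to cohomology. -/
abbrev toH : R.cocycles →ₐ[k] R.H := Ideal.Quotient.mkₐ k R.coboundaries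

/-- The component `Hⁿ(R)`: the classes of cocycles of degree `n`. -/
def grH (n : ℤ) : Submodule k R.H :=
  ((R.gr n).comap R.cocycles.val.toLinearMap).map R.toH.toLinearMap

variable {R} in
theorem mem_grH {n : ℤ} {x : R.H} : x ∈ R.grH n ↔ ∃ z : R.cocycles, z.1 ∈ R.gr n ∧ R.toH z = x :=
  Iff.rfl

theorem toH_eq_zero {z : R.cocycles} : R.toH z = 0 ↔ ∃ b, R.d b = z :=
  Ideal.Quotient.eq_zero_iff_mem

theorem pr_mem_cocycles (i : ℤ) (z : R.cocycles) : pr R.gr i z ∈ R.cocycles := by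
  rw [mem_cocycles, ← R.pr_d, R.mem_cocycles.1 z.2, map_zero]

theorem isInternal_grH : DirectSum.IsInternal R.grH := by
  refine isInternal_of_ker R.grH
    (fun i => (((LinearMap.range R.d).comap (pr R.gr i)).comap
      R.cocycles.val.toLinearMap).map R.toH.toLinearMap) ?_ ?_ ?_
  · rintro i j hij _ ⟨z, hz, rfl⟩
    exact ⟨z, ⟨0, by simpa using (pr_ne R.gr hz hij).symm⟩, rfl⟩
  · rintro i _ ⟨z, hz, rfl⟩ ⟨z', ⟨b, hb⟩, hz'⟩
    have h0 : R.toH (z' - z) = 0 := by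
      rw [map_sub, sub_eq_zero]; exact hz'
    obtain ⟨c, hc⟩ := R.toH_eq_zero.1 h0
    refine R.toH_eq_zero.2 ⟨b - pr R.gr (i - 1) c, ?_⟩
    have hz1 : pr R.gr i z = z := pr_same R.gr hz
    have h1 := R.pr_d (i - 1) c
    rw [sub_add_cancel, hc] at h1
    have hb' : R.d b = pr R.gr i z' := hb
    rw [map_sub, ← h1, hb']
    simp [hz1]
  · rw [eq_top_iff]
    rintro x -
    obtain ⟨z, rfl⟩ := Ideal.Quotient.mkₐ_surjective k R.coboundaries x
    obtain ⟨s, hs⟩ := sum_pr R.gr (z : R.carrier)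
    have : z = ∑ i ∈ s, (⟨pr R.gr i z, R.pr_mem_cocycles i z⟩ : R.cocycles) := by
      apply Subtype.ext
      simp [hs]
    rw [this, map_sum]
    refine Submodule.sum_mem _ fun i _ => Submodule.mem_iSup_of_mem i ?_
    exact ⟨_, pr_mem R.gr i _, rfl⟩

instance : SetLike.GradedMonoid R.grH where
  one_mem := ⟨1, SetLike.GradedOne.one_mem (A := R.gr), map_one R.toH⟩
  mul_mem := by
    rintro i j _ _ ⟨z, hz, rfl⟩ ⟨y, hy, rfl⟩
    exact ⟨z * y, R.mul_mem hz hy, map_mul R.toH z y⟩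

noncomputable instance : GradedAlgebra R.grH :=
  { toGradedMonoid := inferInstance
    toDecomposition := R.isInternal_grH.chooseDecomposition }

/-- The cohomology algebra `H(R)` of `R`, as an augmented commutative differential graded algebra
with zero differential and with the induced augmentation. -/
noncomputable def cohomology : AugCDGA.{u, v} k where
  carrier := R.H
  gr := R.grH
  graded_comm := by
    rintro m n _ _ ⟨z, hz, rfl⟩ ⟨y, hy, rfl⟩
    have : z * y = (-1 : k) ^ (m * n) • (y * z) := Subtype.ext (R.graded_comm hz hy)
    change R.toH z * R.toH y = (-1 : k) ^ (m * n) • (R.toH y * R.toH z)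
    rw [← map_mul, this, map_smul, map_mul]
  d := 0
  d_mem _ := Submodule.zero_mem _
  d_d _ := rfl
  leibniz _ _ := by simp
  aug := Ideal.Quotient.liftₐ R.coboundaries (R.aug.comp R.cocycles.val) (by
    rintro z ⟨b, hb⟩
    change R.aug z = 0
    rw [← hb, R.aug_d])
  aug_of_mem := by
    rintro n _ ⟨z, hz, rfl⟩ hn
    exact R.aug_of_mem hz hn
  aug_d a := by simp

/-- `R = R^{≥ 0}`. -/
def IsNonneg : Prop := ∀ i < 0, R.gr i = ⊥

/-- `H⁰(R) = k`: every class of degree `0` is a unique scalar multiple of the unit. -/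
def HZeroIsBase : Prop :=
  ∀ x ∈ R.cohomology.gr 0, ∃! c : k, algebraMap k R.cohomology.carrier c = x

/-- `H^{> N}(R) = 0`. -/
def HVanishesAbove (N : ℤ) : Prop := ∀ i > N, R.cohomology.gr i = ⊥

/-- The underlying graded algebra `H = R` is a Poincaré duality algebra: for some `n ≥ 0` it is
concentrated in degrees `0, …, n`, one has `Hⁿ = k α` with `α ≠ 0`, and the pairing
`β γ = ⟨β, γ⟩ α`, for `β ∈ Hⁱ` and `γ ∈ Hⁿ⁻ⁱ`, gives isomorphisms `Hⁱ → Hom(Hⁿ⁻ⁱ, k)`,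
`0 ≤ i ≤ n`. (`ω` reads off the coefficient of `α`; only its values on `Hⁿ` matter.) -/
def IsPoincareDuality : Prop :=
  ∃ n : ℤ, 0 ≤ n ∧ (∀ i, i < 0 ∨ n < i → R.gr i = ⊥) ∧
    ∃ (α : R.carrier) (ω : R.carrier →ₗ[k] k), R.gr n = Submodule.span k {α} ∧ ω α = 1 ∧
      ∀ i, 0 ≤ i → i ≤ n →
        Function.Bijective (((LinearMap.mul k R.carrier).compr₂ ω).domRestrict₁₂
          (R.gr i) (R.gr (n - i)))

end AugCDGA

/-! ### Differential graded modules -/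

/-- A (left, `ℤ`-graded) differential graded module over `R`. -/
structure DGModule (R : AugCDGA.{u, v} k) where
  carrier : Type w
  [addCommGroup : AddCommGroup carrier]
  [moduleBase : Module k carrier]
  [module : Module R.carrier carrier]
  [isScalarTower : IsScalarTower k R.carrier carrier]
  gr : ℤ → Submodule k carrier
  [decomposition : DirectSum.Decomposition gr]
  smul_mem : ∀ {m n : ℤ} {a : R.carrier} {x : carrier}, a ∈ R.gr m → x ∈ gr n →
    a • x ∈ gr (m + n)
  d : carrier →ₗ[k] carrier
  d_mem : ∀ {n : ℤ} {x : carrier}, x ∈ gr n → d x ∈ gr (n + 1)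
  d_d : ∀ x, d (d x) = 0
  leibniz : ∀ {m : ℤ} {a : R.carrier}, a ∈ R.gr m → ∀ x,
    d (a • x) = R.d a • x + (-1 : k) ^ m • (a • d x)

attribute [instance] DGModule.addCommGroup DGModule.moduleBase DGModule.module
  DGModule.isScalarTower DGModule.decomposition

/-- The (total) homology `ker d / im d` of a vector space with an endomorphism `d`, `d² = 0`. For
a graded space and a homogeneous `d` this is the direct sum of its homogeneous components. -/
abbrev Homology {X : Type w} [AddCommGroup X] [Module k X] (d : X →ₗ[k] X) : Type w :=
  LinearMap.ker d ⧸ (LinearMap.range d).comap (LinearMap.ker d).subtype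

variable {R : AugCDGA.{u, v} k}

/-- A morphism of differential graded modules: linear, of degree zero, commuting with `d`. -/
structure DGModule.Hom (M : DGModule.{u, v, w} R) (N : DGModule.{u, v, w'} R) where
  toFun : M.carrier →ₗ[R.carrier] N.carrier
  map_mem : ∀ {n : ℤ} {x : M.carrier}, x ∈ M.gr n → toFun x ∈ N.gr n
  map_d : ∀ x, toFun (M.d x) = N.d (toFun x)

/-- A quasi-isomorphism: the induced map in homology is injective and surjective. -/
def DGModule.Hom.IsQuasiIso {M : DGModule.{u, v, w} R} {N : DGModule.{u, v, w'} R}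
    (f : M.Hom N) : Prop :=
  (∀ x, M.d x = 0 → (∃ y, N.d y = f.toFun x) → ∃ z, M.d z = x) ∧
    ∀ y, N.d y = 0 → ∃ x, M.d x = 0 ∧ ∃ z, N.d z = y - f.toFun x

/-- `P` is semifree: as a module over the underlying graded algebra of `R` it has a basis of
homogeneous elements that is the union of sets `B₀, B₁, …` such that `d` maps `Bₙ` into the
submodule generated by `B₀, …, Bₙ₋₁`. (Equivalently, `P` is the union of differential submodules
`0 = F₀ ⊆ F₁ ⊆ …` with `Fₙ₊₁/Fₙ ≅ (R ⊗ Sₙ, d ⊗ id)`, `Sₙ` being spanned by `Bₙ`.) -/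
def DGModule.IsSemifree (P : DGModule.{u, v, w} R) : Prop :=
  ∃ (ι : Type w) (b : Module.Basis ι R.carrier P.carrier) (deg : ι → ℤ) (level : ι → ℕ),
    (∀ i, b i ∈ P.gr (deg i)) ∧
      ∀ i, P.d (b i) ∈ Submodule.span R.carrier (b '' {j | level j < level i})

/-- A semifree resolution of `M`: a quasi-isomorphism to `M` from a semifree module. -/
structure SemifreeResolution (M : DGModule.{u, v, w'} R) where
  P : DGModule.{u, v, w} R
  semifree : P.IsSemifree
  map : P.Hom M
  quasiIso : map.IsQuasiIso

/-! ### The modules `k`, `R` and `Hom(R) = Hom(R, k)` -/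

/-- `R` as a module over itself. -/
noncomputable def regular (R : AugCDGA.{u, v} k) : DGModule.{u, v, v} R where
  carrier := R.carrier
  gr := R.gr
  smul_mem ha hx := R.mul_mem ha hx
  d := R.d
  d_mem := R.d_mem
  d_d := R.d_d
  leibniz ha x := R.leibniz ha x

/-- The grading of `k` that is concentrated in degree `0`. -/
def grBase (k : Type u) [Field k] (i : ℤ) : Submodule k k := if i = 0 then ⊤ else ⊥

theorem isInternal_grBase : DirectSum.IsInternal (grBase k) := by
  refine isInternal_of_ker _ (fun i => if i = 0 then ⊥ else ⊤) ?_ ?_ ?_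
  · intro i j h
    by_cases hi : i = 0
    · subst hi; simp [grBase, h]
    · simp [hi]
  · intro i x hx hx'
    by_cases hi : i = 0
    · subst hi; simpa using hx'
    · simpa [grBase, hi] using hx
  · rw [eq_top_iff]
    exact le_trans (by simp [grBase]) (le_iSup (grBase k) 0)

/-- The base field `k`, in degree `0`, as an `R`-module through the augmentation. -/
noncomputable def base (R : AugCDGA.{u, v} k) : DGModule.{u, v, u} R :=
  letI : Module R.carrier k := Module.compHom k R.aug.toRingHom
  haveI : IsScalarTower k R.carrier k := ⟨fun c a x => by
    change R.aug (c • a) * x = c * (R.aug a * x)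
    rw [map_smul, smul_eq_mul, mul_assoc]⟩
  letI := (isInternal_grBase (k := k)).chooseDecomposition
  { carrier := k
    gr := grBase k
    smul_mem := fun {m n a x} ha hx => by
      change R.aug a * x ∈ _
      by_cases hm : m = 0
      · subst hm
        rw [zero_add]
        exact (grBase k n).smul_mem (R.aug a) hx
      · rw [R.aug_of_mem ha hm, zero_mul]
        exact Submodule.zero_mem _
    d := 0
    d_mem := fun _ => Submodule.zero_mem _
    d_d := fun _ => rfl
    leibniz := fun {m a} _ x => by
      change (0 : k) = R.aug (R.d a) * x + (-1 : k) ^ m • (R.aug a * 0)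
      simp [R.aug_d] }

theorem base_smul (a : R.carrier) (c : k) :
    (show (base R).carrier from a • (show (base R).carrier from c)) = R.aug a * c := rfl

namespace Dual

variable (R : AugCDGA.{u, v} k)

/-- The functionals of degree `n`: those that vanish on `Rᵐ` for `m ≠ -n`. -/
def deg (n : ℤ) : Submodule k (R.carrier →ₗ[k] k) where
  carrier := {f | ∀ m, m ≠ -n → ∀ x ∈ R.gr m, f x = 0}
  add_mem' hf hg m hm x hx := by simp [hf m hm x hx, hg m hm x hx]
  zero_mem' := by simp
  smul_mem' c f hf m hm x hx := by simp [hf m hm x hx]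

variable {R} in
theorem mem_deg {n : ℤ} {f : R.carrier →ₗ[k] k} :
    f ∈ deg R n ↔ ∀ m, m ≠ -n → ∀ x ∈ R.gr m, f x = 0 := Iff.rfl

/-- The graded dual: sums of homogeneous functionals. -/
def total : Submodule k (R.carrier →ₗ[k] k) := ⨆ n, deg R n

variable {R}

theorem deg_le_total (n : ℤ) : deg R n ≤ total R := le_iSup (deg R) n

/-- A functional map that shifts degrees preserves the graded dual. -/
theorem map_total {φ : (R.carrier →ₗ[k] k) →ₗ[k] (R.carrier →ₗ[k] k)}
    (h : ∀ n, ∀ f ∈ deg R n, φ f ∈ total R) {f : R.carrier →ₗ[k] k} (hf : f ∈ total R) :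
    φ f ∈ total R := by
  have : total R ≤ (total R).comap φ := iSup_le fun n f hf => h n f hf
  exact this hf

/-- The action of `a ∈ R` on functionals: `(a • f) x = (-1)^{deg a} f (x a)`; for homogeneous `f`
this is `(-1)^{deg a deg f} f (a x)`, see `act_apply_of_mem`. -/
noncomputable def act (a : R.carrier) : (R.carrier →ₗ[k] k) →ₗ[k] (R.carrier →ₗ[k] k) :=
  LinearMap.lcomp k k ((LinearMap.mul k R.carrier).flip (R.inv a))

theorem act_apply (a : R.carrier) (f : R.carrier →ₗ[k] k) (x : R.carrier) :
    act a f x = f (x * R.inv a) := rfl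

theorem act_mem_deg {m n : ℤ} {a : R.carrier} (ha : a ∈ R.gr m) {f : R.carrier →ₗ[k] k}
    (hf : f ∈ deg R n) : act a f ∈ deg R (m + n) := by
  intro j hj x hx
  rw [act_apply, invol_of_mem R.gr ha, mul_smul_comm, map_smul,
    hf _ (show j + m ≠ -n by omega) _ (R.mul_mem hx ha), smul_zero]

theorem act_mem (a : R.carrier) {f : R.carrier →ₗ[k] k} (hf : f ∈ total R) :
    act a f ∈ total R := by
  refine map_total (fun n f hf => ?_) hf
  induction a using DirectSum.Decomposition.inductionOn R.gr with
  | zero =>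
    have : act (0 : R.carrier) f = 0 := by ext x; simp [act_apply]
    rw [this]; exact Submodule.zero_mem _
  | homogeneous a => exact deg_le_total _ (act_mem_deg a.2 hf)
  | add a b ha hb =>
    have : act (a + b) f = act a f + act b f := by ext x; simp [act_apply, mul_add]
    rw [this]; exact Submodule.add_mem _ ha hb

/-- The differential on functionals, `(df) x = (-1)^{deg x} f (d x)`; for homogeneous `f` this is
the usual `df = -(-1)^{deg f} f ∘ d`, see `diff_of_mem`. -/
noncomputable def diff : (R.carrier →ₗ[k] k) →ₗ[k] (R.carrier →ₗ[k] k) :=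
  LinearMap.lcomp k k (R.d ∘ₗ R.inv)

theorem diff_apply (f : R.carrier →ₗ[k] k) (x : R.carrier) :
    diff f x = f (R.d (R.inv x)) := rfl

theorem diff_mem_deg {n : ℤ} {f : R.carrier →ₗ[k] k} (hf : f ∈ deg R n) :
    diff f ∈ deg R (n + 1) := by
  intro j hj x hx
  rw [diff_apply, invol_of_mem R.gr hx, map_smul, map_smul,
    hf _ (show j + 1 ≠ -n by omega) _ (R.d_mem hx), smul_zero]

theorem diff_mem {f : R.carrier →ₗ[k] k} (hf : f ∈ total R) : diff f ∈ total R :=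
  map_total (fun _ _ hf => deg_le_total _ (diff_mem_deg hf)) hf

theorem diff_of_mem {n : ℤ} {f : R.carrier →ₗ[k] k} (hf : f ∈ deg R n) :
    diff f = -((-1 : k) ^ n • f ∘ₗ R.d) := by
  refine eq_of_homogeneous R.gr fun i x hx => ?_
  rw [diff_apply, invol_of_mem R.gr hx]
  by_cases h : i + 1 = -n
  · have : (-1 : k) ^ n = -(-1 : k) ^ i := by
      rw [show n = -(i + 1) by omega, zpow_neg, sgn_succ, inv_neg, ← inv_zpow]
      norm_num
    simp [this]
  · simp [hf _ h _ (R.d_mem hx)]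

theorem act_apply_of_mem {m n : ℤ} {a : R.carrier} (ha : a ∈ R.gr m)
    {f : R.carrier →ₗ[k] k} (hf : f ∈ deg R n) (x : R.carrier) :
    act a f x = (-1 : k) ^ (m * n) * f (a * x) := by
  have : act a f = (-1 : k) ^ (m * n) • f ∘ₗ LinearMap.mul k R.carrier a := by
    refine eq_of_homogeneous R.gr fun i x hx => ?_
    rw [act_apply, invol_of_mem R.gr ha, LinearMap.smul_apply, LinearMap.comp_apply,
      LinearMap.mul_apply', R.graded_comm ha hx]
    by_cases h : i + m = -n
    · have hs : (-1 : k) ^ (m * n) * (-1 : k) ^ (m * i) = (-1 : k) ^ m := by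
        rw [← zpow_add₀ (by simp), show m * n + m * i = -(m * m) by
          rw [show n = -(i + m) by omega]; ring]
        rcases Int.even_or_odd m with h | h
        · rw [h.neg_one_zpow, (h.mul_right m).neg.neg_one_zpow]
        · rw [h.neg_one_zpow, (h.mul h).neg.neg_one_zpow]
      simp [← mul_assoc, hs]
    · simp [hf _ h _ (R.mul_mem hx ha)]
  rw [this]; rfl

theorem leibniz {m : ℤ} {a : R.carrier} (ha : a ∈ R.gr m) (f : R.carrier →ₗ[k] k) :
    diff (act a f) = act (R.d a) f + (-1 : k) ^ m • act a (diff f) := by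
  refine eq_of_homogeneous R.gr fun i x hx => ?_
  simp only [LinearMap.add_apply, LinearMap.smul_apply, act_apply, diff_apply]
  rw [R.inv_mul, R.inv_inv, invol_of_mem R.gr (R.d_mem ha), invol_of_mem R.gr ha,
    invol_of_mem R.gr hx, sgn_succ]
  simp only [map_smul, neg_smul, mul_neg, map_neg, smul_mul_assoc, mul_smul_comm, smul_eq_mul]
  rw [R.leibniz hx a]
  simp only [map_add, map_smul, smul_eq_mul, mul_add]
  have h1 := sgn_mul_self (k := k) i
  linear_combination (-(-1 : k) ^ m * f (x * R.d a)) * h1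

variable (R)

/-- The graded dual `Hom(R, k)`, the direct sum of its components, as a type. -/
def Total : Type (max u v) := total R

noncomputable instance : AddCommGroup (Total R) := inferInstanceAs (AddCommGroup (total R))

noncomputable instance : Module k (Total R) := inferInstanceAs (Module k (total R))

variable {R} in
/-- The functional underlying an element of the graded dual. -/
noncomputable def Total.val : Total R →ₗ[k] (R.carrier →ₗ[k] k) := (total R).subtype

variable {R} in
theorem Total.val_mem (f : Total R) : f.val ∈ total R := Subtype.property f

variable {R} in
theorem Total.val_injective : Function.Injective (Total.val (R := R)) := (total R).injective_subtype

variable {R} in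
theorem Total.hext {f g : Total R} (h : ∀ x, f.val x = g.val x) : f = g :=
  Total.val_injective (LinearMap.ext h)

/-- The grading of the graded dual. -/
noncomputable def gr (n : ℤ) : Submodule k (Total R) := (deg R n).comap Total.val

theorem mem_gr {n : ℤ} {f : Total R} : f ∈ gr R n ↔ f.val ∈ deg R n := Iff.rfl

theorem iSup_gr : ⨆ n, gr R n = ⊤ := by
  rw [eq_top_iff]
  rintro f -
  have h : ∀ g ∈ total R, ∃ f ∈ ⨆ n, gr R n, Total.val f = g := by
    intro g hg
    rw [total] at hg
    induction hg using Submodule.iSup_induction' with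
    | mem i x hx => exact ⟨⟨x, deg_le_total i hx⟩, Submodule.mem_iSup_of_mem i hx, rfl⟩
    | zero => exact ⟨0, Submodule.zero_mem _, map_zero _⟩
    | add x y _ _ hx hy =>
      obtain ⟨a, ha, rfl⟩ := hx
      obtain ⟨b, hb, rfl⟩ := hy
      exact ⟨a + b, Submodule.add_mem _ ha hb, map_add _ _ _⟩
  obtain ⟨f', hf', h'⟩ := h f.val f.val_mem
  rwa [← Total.val_injective h']

theorem isInternal_gr : DirectSum.IsInternal (gr R) := by
  refine isInternal_of_ker (gr R)
    (fun i => (LinearMap.ker (LinearMap.lcomp k k (pr R.gr (-i)))).comap Total.val) ?_ ?_ (iSup_gr R)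
  · intro i j hij f hf
    exact LinearMap.ext fun x => hf (-i) (by omega) _ (pr_mem R.gr _ _)
  · intro i f hf hf0
    apply Total.val_injective
    refine eq_of_homogeneous R.gr fun j x hx => ?_
    rw [map_zero, LinearMap.zero_apply]
    by_cases h : j = -i
    · subst h
      have h0 := LinearMap.congr_fun (LinearMap.mem_ker.1 hf0) x
      rw [LinearMap.lcomp_apply, pr_same R.gr hx] at h0
      exact h0
    · exact hf j h x hx

noncomputable instance : DirectSum.Decomposition (gr R) := (isInternal_gr R).chooseDecomposition

noncomputable instance : SMul R.carrier (Total R) where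
  smul a f := ⟨act a f.val, act_mem a f.val_mem⟩

variable {R} in
theorem val_smul (a : R.carrier) (f : Total R) : (a • f).val = act a f.val := rfl

noncomputable instance : Module R.carrier (Total R) where
  one_smul f := Total.hext fun x => by
    rw [val_smul, act_apply, R.inv_one, mul_one]
  mul_smul a b f := Total.hext fun x => by
    simp only [val_smul, act_apply, R.inv_mul, mul_assoc]
  smul_zero a := Total.hext fun x => by
    simp [val_smul]
  smul_add a f g := Total.hext fun x => by
    simp [val_smul, act_apply]
  add_smul a b f := Total.hext fun x => by
    simp [val_smul, act_apply, mul_add]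
  zero_smul f := Total.hext fun x => by
    simp [val_smul, act_apply]

instance : IsScalarTower k R.carrier (Total R) := ⟨fun c a f => Total.hext fun x => by
  simp [val_smul, act_apply]⟩

variable {R} in
/-- The differential of the graded dual. -/
noncomputable def totalDiff : Total R →ₗ[k] Total R where
  toFun f := ⟨diff f.val, diff_mem f.val_mem⟩
  map_add' f g := Total.hext fun x => by
    change diff (f + g).val x = (diff f.val + diff g.val) x
    rw [map_add, map_add]
  map_smul' c f := Total.hext fun x => by
    change diff (c • f).val x = (c • diff f.val) x
    rw [map_smul, map_smul]

variable {R} in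
theorem val_totalDiff (f : Total R) : (totalDiff f).val = diff f.val := rfl

end Dual

/-- The `R`-module `Hom(R) = Hom(R, k)` (graded dual). -/
noncomputable def dual (R : AugCDGA.{u, v} k) : DGModule.{u, v, max u v} R where
  carrier := Dual.Total R
  gr := Dual.gr R
  smul_mem ha hf := Dual.act_mem_deg ha hf
  d := Dual.totalDiff
  d_mem hf := Dual.diff_mem_deg hf
  d_d f := Dual.Total.hext fun x => by
    rw [Dual.val_totalDiff, Dual.val_totalDiff, Dual.diff_apply, Dual.diff_apply, R.d_inv,
      R.d_d]
    simp
  leibniz ha f := Dual.Total.hext fun x => by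
    rw [Dual.val_totalDiff, Dual.val_smul, Dual.leibniz ha, map_add Dual.Total.val,
      map_smul Dual.Total.val, Dual.val_smul, Dual.val_smul, Dual.val_totalDiff]

/-! ### Tensor products, Tor and Ext -/

section Tensor

variable (M : DGModule.{u, v, w} R) (N : DGModule.{u, v, w'} R)

/-- The relations `x.a ⊗ y = x ⊗ a y`, where `x.a = (-1)^{deg a deg x} a x`. -/
def tensorRel : Submodule k (M.carrier ⊗[k] N.carrier) :=
  Submodule.span k {t | ∃ (m n : ℤ) (a : R.carrier) (x : M.carrier) (y : N.carrier),
    a ∈ R.gr m ∧ x ∈ M.gr n ∧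
      t = ((-1 : k) ^ (m * n) • (a • x)) ⊗ₜ[k] y - x ⊗ₜ[k] (a • y)}

/-- The differential `d (x ⊗ y) = dx ⊗ y + (-1)^{deg x} x ⊗ dy` on `M ⊗ N` (over `k`). -/
noncomputable def tensorDiffBase : M.carrier ⊗[k] N.carrier →ₗ[k] M.carrier ⊗[k] N.carrier :=
  TensorProduct.map M.d LinearMap.id + TensorProduct.map (invol M.gr) N.d

theorem tensorDiffBase_tmul {n : ℤ} {x : M.carrier} (hx : x ∈ M.gr n) (y : N.carrier) :
    tensorDiffBase M N (x ⊗ₜ y) = M.d x ⊗ₜ y + (-1 : k) ^ n • x ⊗ₜ N.d y := by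
  simp [tensorDiffBase, invol_of_mem M.gr hx, TensorProduct.smul_tmul']

theorem tensorRel_le : tensorRel M N ≤ (tensorRel M N).comap (tensorDiffBase M N) := by
  rw [tensorRel, Submodule.span_le]
  rintro _ ⟨m, n, a, x, y, ha, hx, rfl⟩
  have hgen : ∀ {m n : ℤ} {a : R.carrier} {x : M.carrier} (y : N.carrier), a ∈ R.gr m →
      x ∈ M.gr n →
      ((-1 : k) ^ (m * n) • (a • x)) ⊗ₜ[k] y - x ⊗ₜ[k] (a • y) ∈ tensorRel M N :=
    fun {m n a x} y ha hx => Submodule.subset_span ⟨m, n, a, x, y, ha, hx, rfl⟩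
  have h1 := hgen y (R.d_mem ha) hx
  have h2 := hgen y ha (M.d_mem hx)
  have h3 := hgen (N.d y) ha hx
  have key : tensorDiffBase M N
      (((-1 : k) ^ (m * n) • (a • x)) ⊗ₜ[k] y - x ⊗ₜ[k] (a • y)) =
      (-1 : k) ^ n • (((-1 : k) ^ ((m + 1) * n) • (R.d a • x)) ⊗ₜ[k] y - x ⊗ₜ[k] (R.d a • y)) +
      (((-1 : k) ^ (m * (n + 1)) • (a • M.d x)) ⊗ₜ[k] y - M.d x ⊗ₜ[k] (a • y)) +
      (-1 : k) ^ (m + n) • (((-1 : k) ^ (m * n) • (a • x)) ⊗ₜ[k] N.d y -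
        x ⊗ₜ[k] (a • N.d y)) := by
    rw [map_sub, tensorDiffBase_tmul M N hx, ← TensorProduct.smul_tmul', map_smul,
      tensorDiffBase_tmul M N (M.smul_mem ha hx), M.leibniz ha, N.leibniz ha]
    have e1 : (-1 : k) ^ ((m + 1) * n) = (-1 : k) ^ (m * n) * (-1 : k) ^ n := by
      rw [add_mul, one_mul, zpow_add₀ (by simp)]
    have e2 : (-1 : k) ^ (m * (n + 1)) = (-1 : k) ^ (m * n) * (-1 : k) ^ m := by
      rw [mul_add, mul_one, zpow_add₀ (by simp)]
    have e3 : (-1 : k) ^ (m + n) = (-1 : k) ^ m * (-1 : k) ^ n := zpow_add₀ (by simp) _ _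
    rw [e1, e2, e3]
    generalize R.d a • x = x1
    generalize a • M.d x = x2
    generalize a • x = x3
    generalize R.d a • y = y1
    generalize a • N.d y = y2
    generalize a • y = y3
    simp only [TensorProduct.add_tmul, TensorProduct.tmul_add, ← TensorProduct.smul_tmul',
      TensorProduct.tmul_smul]
    have hn := sgn_mul_self (k := k) n
    generalize (-1 : k) ^ n = s at *
    generalize (-1 : k) ^ m = r
    generalize (-1 : k) ^ (m * n) = q
    simp only [smul_sub, smul_add, smul_smul]
    rw [show s * (q * s) = q by linear_combination q * hn]
    module
  change tensorDiffBase M N _ ∈ tensorRel M N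
  rw [key]
  exact Submodule.add_mem _ (Submodule.add_mem _ (Submodule.smul_mem _ _ h1) h2)
    (Submodule.smul_mem _ _ h3)

/-- The tensor product `M ⊗_R N` over `R`. -/
abbrev TensorOver : Type (max w w') := (M.carrier ⊗[k] N.carrier) ⧸ tensorRel M N

/-- The differential of `M ⊗_R N`. -/
noncomputable def tensorDiff : TensorOver M N →ₗ[k] TensorOver M N :=
  (tensorRel M N).mapQ (tensorRel M N) (tensorDiffBase M N) (tensorRel_le M N)

end Tensor

section HomComplex

variable (M : DGModule.{u, v, w} R) (N : DGModule.{u, v, w'} R)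

/-- `Hom_R(M, N)` in degree `n`: the maps `f` of degree `n` with `f (a x) = (-1)^{n deg a} a f x`. -/
def homDeg (n : ℤ) : Submodule k (M.carrier →ₗ[k] N.carrier) where
  carrier := {f | (∀ i, ∀ x ∈ M.gr i, f x ∈ N.gr (i + n)) ∧
    ∀ m, ∀ a ∈ R.gr m, ∀ x, f (a • x) = (-1 : k) ^ (m * n) • (a • f x)}
  add_mem' hf hg := ⟨fun i x hx => Submodule.add_mem _ (hf.1 i x hx) (hg.1 i x hx),
    fun m a ha x => by simp [hf.2 m a ha x, hg.2 m a ha x]⟩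
  zero_mem' := ⟨fun _ _ _ => Submodule.zero_mem _, fun _ _ _ _ => by simp⟩
  smul_mem' c f hf := ⟨fun i x hx => Submodule.smul_mem _ _ (hf.1 i x hx), fun m a ha x => by
    have h : a • c • f x = c • a • f x := by
      rw [← one_smul R.carrier (f x), ← smul_assoc c, smul_smul, mul_smul_comm, smul_assoc,
        mul_smul]
    rw [LinearMap.smul_apply, LinearMap.smul_apply, hf.2 m a ha x, h, smul_comm]⟩

/-- The differential `df = d ∘ f - (-1)^n f ∘ d` on maps `f` of degree `n`. -/
def homDiff (n : ℤ) : (M.carrier →ₗ[k] N.carrier) →ₗ[k] (M.carrier →ₗ[k] N.carrier) :=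
  LinearMap.llcomp k _ _ _ N.d - (-1 : k) ^ n • LinearMap.lcomp k _ M.d

theorem homDiff_apply (n : ℤ) (f : M.carrier →ₗ[k] N.carrier) (x : M.carrier) :
    homDiff M N n f x = N.d (f x) - (-1 : k) ^ n • f (M.d x) := rfl

/-- `H^n(Hom_R(M, N))`: cocycles of degree `n` modulo coboundaries. -/
abbrev HomCohomology (n : ℤ) : Type (max w w') :=
  (homDeg M N n ⊓ LinearMap.ker (homDiff M N n) : Submodule k (M.carrier →ₗ[k] N.carrier)) ⧸
    ((homDeg M N (n - 1)).map (homDiff M N (n - 1))).comap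
      (homDeg M N n ⊓ LinearMap.ker (homDiff M N n)).subtype

end HomComplex

namespace AugCDGA

variable (R : AugCDGA.{u, v} k)

/-- `dim 𝒯(R) = n`, where `𝒯(R) = Tor^R(k, Hom(R)) = H(P ⊗_R Hom(R))` for any semifree resolution
`P → k`: such resolutions exist, and all of them give a total dimension `n`. -/
def DimTEq (n : ℕ) : Prop :=
  Nonempty (SemifreeResolution.{u, v, v, u} (base R)) ∧
    ∀ P : SemifreeResolution.{u, v, v, u} (base R),
      Module.rank k (Homology (tensorDiff P.P (dual R))) = n

/-- `R` is Gorenstein: `dim 𝒢(R) = 1`, where `𝒢(R) = Ext_R(k, R) = H(Hom_R(P, R))` for any semifree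
resolution `P → k`: such resolutions exist, and all of them give total dimension `1`. -/
def IsGorenstein : Prop :=
  Nonempty (SemifreeResolution.{u, v, v, u} (base R)) ∧
    ∀ P : SemifreeResolution.{u, v, v, u} (base R),
      Module.rank k (⨁ n : ℤ, HomCohomology P.P (regular R) n) = 1

end AugCDGA

end DGA

/-!
Write `C = Hom(R)`. A cocycle `ω` of degree `-n` in `C`, that is, a functional on `Rⁿ` vanishing on
coboundaries, defines a map `R → C`, `a ↦ a ω`, whose mapping cone is the module `C ⊕ R σ` with
`dσ = ω` (`adjoinCell`). Call `ω` dualizing if the cone is acyclic. Every condition of the theorem is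
compared with the existence of a dualizing cocycle (`HasDualizingCocycle`).

*Tor.* Let `P` be a semifree resolution of `k` and `p` a cocycle of `P` that lifts `1`. Since `P ⊗_R R`
has the cohomology of `k`, the complex `P ⊗_R (C ⊕ R σ)` is acyclic if and only if the cohomology of
`P ⊗_R C` is one-dimensional and spanned by `p ⊗ ω` (`tensor_adjoinCell_acyclic_iff`). If the cone is
acyclic, so is its tensor product with `P`; hence a dualizing cocycle makes `Tor` one-dimensional.
Conversely, let `Tor` be one-dimensional, let `n` be the top degree of `H(R)`, and let `ω` be a
nonzero class of degree `-n` in `H(C)`. The key is a detection lemma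
(`exists_d_eq_of_basis_tmul`): if the generators of `P` have degrees `≥ 0` and `p` is one of them,
then a class `x` of the lowest degree in which `H(M)` does not vanish stays nonzero as `p ⊗ x`, since
a functional on `H(M)` that does not kill `x` extends, generator by generator, to one on
`H(P ⊗_R M)`. For `M = C` it shows that `p ⊗ ω` spans `Tor`, so that `P` tensored with the cone is
acyclic; for `M` the cone, whose cohomology is bounded below, it then shows that the cone is acyclic.

*The resolution.* A semifree resolution with generators of degree `≥ 0` is found by Zorn's lemma among
the sets of formal generators (`Gen`, `Resolution.Good`): a maximal set that spans a complex with
degree `0` cocycles `k` has no cohomology in positive degrees, because another generator could be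
added to kill it. The condition on degree `0` survives this because `H⁰(R) = k` and only classes that
are not yet zero are killed (`Resolution.good_insert`).

*Poincaré duality.* A cocycle `ω` is dualizing if and only if `(z, y) ↦ ω (z y)` induces a perfect
pairing between `Hⁱ(R)` and `Hⁿ⁻ⁱ(R)` for all `i` (`HasPerfectPairing`). This depends on `H(R)` only,
and for an algebra with zero differential it is Poincaré duality. The equivalence of the three
conditions follows by applying this to `R` and to `H(R)`.

*Ext.* If the cone is acyclic, so is `Hom_R(P, C ⊕ R σ)` (`hom_acyclic`), so that `Ext_R(k, R)` is a
shift of the cohomology of `Hom_R(P, C) = Hom(P, k)`, which is one-dimensional.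
-/

universe w''

namespace DGA

section

/-! ### Graded linear algebra -/

section GradedLinearAlgebra

variable {k : Type u} [Field k]

/-- A functional that vanishes on the kernel of a linear map factors through it. -/
theorem exists_functional_comp_eq {V W : Type*} [AddCommGroup V] [Module k V] [AddCommGroup W]
    [Module k W] (d : V →ₗ[k] W) (ψ : V →ₗ[k] k) (h : ∀ x, d x = 0 → ψ x = 0) :
    ∃ f : W →ₗ[k] k, ∀ x, f (d x) = ψ x := by
  have : ψ ∈ LinearMap.range d.dualMap := by
    rw [LinearMap.range_dualMap_eq_dualAnnihilator_ker, Submodule.mem_dualAnnihilator]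
    exact fun x hx => h x hx
  obtain ⟨f, hf⟩ := this
  exact ⟨f, fun x => LinearMap.congr_fun hf x⟩

variable {M : Type v} [AddCommGroup M] [Module k M] (gr : ℤ → Submodule k M)
  [DirectSum.Decomposition gr]

/-- The projections to the components commute with a map of degree `e`. -/
theorem pr_map {M' : Type*} [AddCommGroup M'] [Module k M'] (gr' : ℤ → Submodule k M')
    [DirectSum.Decomposition gr'] {e : ℤ} {f : M →ₗ[k] M'}
    (hf : ∀ i, ∀ x ∈ gr i, f x ∈ gr' (i + e)) (i : ℤ) (x : M) :
    pr gr' (i + e) (f x) = f (pr gr i x) := by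
  have : pr gr' (i + e) ∘ₗ f = f ∘ₗ pr gr i := by
    refine eq_of_homogeneous gr fun j x hx => ?_
    by_cases h : j = i
    · subst h
      simp [pr_same gr hx, pr_same gr' (hf _ _ hx)]
    · simp [pr_ne gr hx h, pr_ne gr' (hf _ _ hx) (show j + e ≠ i + e by omega)]
  exact LinearMap.congr_fun this x

/-- To prove a linear statement `x ∈ S` it suffices to treat the components of `x`. -/
theorem mem_of_pr_mem {S : Submodule k M} {x : M} (h : ∀ i, pr gr i x ∈ S) : x ∈ S := by
  obtain ⟨s, hs⟩ := sum_pr gr x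
  rw [← hs]
  exact Submodule.sum_mem _ fun i _ => h i

theorem invol_mem {i : ℤ} {x : M} (hx : x ∈ gr i) : invol gr x ∈ gr i := by
  rw [invol_of_mem gr hx]; exact Submodule.smul_mem _ _ hx

theorem invol_of_mem_zero {x : M} (hx : x ∈ gr 0) : invol gr x = x := by
  simp [invol_of_mem gr hx]

theorem invol_map_of_degree_one {d : M →ₗ[k] M} (hd : ∀ i, ∀ x ∈ gr i, d x ∈ gr (i + 1)) (x : M) :
    invol gr (d x) = - d (invol gr x) := by
  have : invol gr ∘ₗ d = - (d ∘ₗ invol gr) := by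
    refine eq_of_homogeneous gr fun i x hx => ?_
    simp [invol_of_mem gr hx, invol_of_mem gr (hd i x hx), sgn_succ]
  exact LinearMap.congr_fun this x

theorem sgn_sq_smul (i : ℤ) (x : M) : (-1 : k) ^ i • (-1 : k) ^ i • x = x := by
  rw [smul_smul, sgn_mul_self, one_smul]

end GradedLinearAlgebra

variable {k : Type u} [Field k]

namespace AugCDGA

variable (R : AugCDGA.{u, v} k)

open Classical in
/-- The sign twist `a ↦ (-1)^{e deg a} a`, the `e`-th power of the degree involution. -/
noncomputable def twist (e : ℤ) : R.carrier →ₗ[k] R.carrier := if Even e then LinearMap.id else R.inv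

theorem twist_even {e : ℤ} (h : Even e) : R.twist e = LinearMap.id := if_pos h

theorem twist_odd {e : ℤ} (h : Odd e) : R.twist e = R.inv := if_neg (Int.not_even_iff_odd.2 h)

theorem twist_of_mem (e : ℤ) {m : ℤ} {a : R.carrier} (ha : a ∈ R.gr m) :
    R.twist e a = (-1 : k) ^ (m * e) • a := by
  rcases Int.even_or_odd e with h | h
  · rw [twist_even R h, (h.mul_left m).neg_one_zpow]; simp
  · rw [twist_odd R h, invol_of_mem R.gr ha, mul_comm, zpow_mul, h.neg_one_zpow]

theorem twist_mul (e : ℤ) (a b : R.carrier) : R.twist e (a * b) = R.twist e a * R.twist e b := by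
  rcases Int.even_or_odd e with h | h
  · simp [twist_even R h]
  · simp [twist_odd R h, R.inv_mul]

theorem twist_one (e : ℤ) : R.twist e 1 = 1 := by
  rcases Int.even_or_odd e with h | h
  · simp [twist_even R h]
  · simp [twist_odd R h, R.inv_one]

theorem twist_twist (e : ℤ) (a : R.carrier) : R.twist e (R.twist e a) = a := by
  rcases Int.even_or_odd e with h | h
  · simp [twist_even R h]
  · simp [twist_odd R h, R.inv_inv]

theorem twist_succ (e : ℤ) (a : R.carrier) : R.twist (e + 1) a = R.inv (R.twist e a) := by
  rcases Int.even_or_odd e with h | h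
  · simp [twist_even R h, twist_odd R h.add_one]
  · simp [twist_odd R h, twist_even R h.add_one, R.inv_inv]

theorem twist_mem (e : ℤ) {m : ℤ} {a : R.carrier} (ha : a ∈ R.gr m) : R.twist e a ∈ R.gr m := by
  rw [R.twist_of_mem e ha]; exact Submodule.smul_mem _ _ ha

theorem d_twist (e : ℤ) (a : R.carrier) : R.d (R.twist e a) = (-1 : k) ^ e • R.twist e (R.d a) := by
  rcases Int.even_or_odd e with h | h
  · simp [twist_even R h, h.neg_one_zpow]
  · simp [twist_odd R h, R.d_inv, h.neg_one_zpow]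

theorem one_mem : (1 : R.carrier) ∈ R.gr 0 := SetLike.GradedOne.one_mem (A := R.gr)

theorem algebraMap_mem (c : k) : algebraMap k R.carrier c ∈ R.gr 0 := by
  rw [Algebra.algebraMap_eq_smul_one]
  exact Submodule.smul_mem _ _ R.one_mem

theorem eq_zero_of_mem_neg (hpos : R.IsNonneg) {i : ℤ} (hi : i < 0) {a : R.carrier}
    (ha : a ∈ R.gr i) : a = 0 := by
  rw [hpos i hi] at ha
  exact (Submodule.mem_bot k).1 ha

end AugCDGA

namespace DGModule

variable {R : AugCDGA.{u, v} k} (M : DGModule.{u, v, w} R)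

theorem smul_comm_base (c : k) (a : R.carrier) (x : M.carrier) : a • c • x = c • a • x := by
  rw [← one_smul R.carrier x, ← smul_assoc c, smul_smul, mul_smul_comm, smul_assoc, mul_smul]

theorem smul_pr {m : ℤ} {a : R.carrier} (ha : a ∈ R.gr m) (i : ℤ) (x : M.carrier) :
    pr M.gr (i + m) (a • x) = a • pr M.gr i x :=
  pr_map M.gr M.gr (f := (Module.toModuleEnd k (S := R.carrier) M.carrier a))
    (fun i x hx => by
      rw [add_comm]; exact M.smul_mem ha hx) i x

theorem pr_d (i : ℤ) (x : M.carrier) : pr M.gr (i + 1) (M.d x) = M.d (pr M.gr i x) :=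
  pr_map M.gr M.gr (fun _ _ hx => M.d_mem hx) i x

theorem leibniz' (a : R.carrier) (x : M.carrier) :
    M.d (a • x) = R.d a • x + R.inv a • M.d x := by
  have : M.d ∘ₗ (LinearMap.toSpanSingleton R.carrier M.carrier x).restrictScalars k =
      (LinearMap.toSpanSingleton R.carrier M.carrier x).restrictScalars k ∘ₗ R.d +
      (LinearMap.toSpanSingleton R.carrier M.carrier (M.d x)).restrictScalars k ∘ₗ R.inv := by
    refine eq_of_homogeneous R.gr fun i a ha => ?_
    simp [M.leibniz ha, invol_of_mem R.gr ha]
  exact LinearMap.congr_fun this a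

theorem d_invol (x : M.carrier) : M.d (invol M.gr x) = - invol M.gr (M.d x) := by
  rw [invol_map_of_degree_one M.gr (fun _ _ hx => M.d_mem hx), neg_neg]

/-- Every cocycle is a coboundary. -/
def Acyclic : Prop := ∀ x, M.d x = 0 → ∃ y, M.d y = x

theorem acyclic_of_homogeneous (h : ∀ i, ∀ x ∈ M.gr i, M.d x = 0 → ∃ y, M.d y = x) :
    M.Acyclic := by
  intro x hx
  refine mem_of_pr_mem M.gr (S := LinearMap.range M.d) fun i => ?_
  exact h i _ (pr_mem _ _ _) (by rw [← M.pr_d, hx, map_zero])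

/-- A homogeneous coboundary is the boundary of a homogeneous element. -/
theorem exists_homogeneous_of_d_eq {i : ℤ} {x : M.carrier} (hx : x ∈ M.gr i)
    (h : ∃ y, M.d y = x) : ∃ y ∈ M.gr (i - 1), M.d y = x := by
  obtain ⟨y, rfl⟩ := h
  refine ⟨pr M.gr (i - 1) y, pr_mem _ _ _, ?_⟩
  rw [← M.pr_d, sub_add_cancel, pr_same M.gr hx]

end DGModule

end

section

variable {k : Type u} [Field k] {R : AugCDGA.{u, v} k}

/-! ### Tensor products over `R` -/

section Tensor

variable {P : DGModule.{u, v, w} R} {M : DGModule.{u, v, w'} R}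

variable (P M) in
/-- The class of `x ⊗ y` in `P ⊗_R M`. -/
noncomputable def tmk : P.carrier →ₗ[k] M.carrier →ₗ[k] TensorOver P M :=
  (TensorProduct.mk k P.carrier M.carrier).compr₂ (tensorRel P M).mkQ

theorem tensor_ext {V : Type*} [AddCommGroup V] [Module k V] {f g : TensorOver P M →ₗ[k] V}
    (h : ∀ x y, f (tmk P M x y) = g (tmk P M x y)) : f = g :=
  Submodule.linearMap_qext _ (TensorProduct.ext' h)

theorem tmk_smul {m n : ℤ} {a : R.carrier} {x : P.carrier} (ha : a ∈ R.gr m) (hx : x ∈ P.gr n)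
    (y : M.carrier) : tmk P M x (a • y) = (-1 : k) ^ (m * n) • tmk P M (a • x) y := by
  symm
  rw [← LinearMap.smul_apply, ← map_smul]
  exact (Submodule.Quotient.eq _).2 (Submodule.subset_span ⟨m, n, a, x, y, ha, hx, rfl⟩)

theorem tensorDiff_tmk (x : P.carrier) (y : M.carrier) :
    tensorDiff P M (tmk P M x y) = tmk P M (P.d x) y + tmk P M (invol P.gr x) (M.d y) := rfl

theorem tensorDiff_tmk_of_mem {n : ℤ} {x : P.carrier} (hx : x ∈ P.gr n) (y : M.carrier) :
    tensorDiff P M (tmk P M x y) = tmk P M (P.d x) y + (-1 : k) ^ n • tmk P M x (M.d y) := by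
  rw [tensorDiff_tmk, invol_of_mem P.gr hx, map_smul, LinearMap.smul_apply]

/-- Elements of `P ⊗_R M` are sums of classes `x ⊗ y`. -/
theorem tensor_mem_of_tmk_mem {S : Submodule k (TensorOver P M)} (h : ∀ x y, tmk P M x y ∈ S)
    (t : TensorOver P M) : t ∈ S := by
  have : S.mkQ = 0 := tensor_ext fun x y => by simpa using h x y
  have h' := LinearMap.congr_fun this t
  simpa using h'

theorem tensorDiff_tensorDiff (t : TensorOver P M) : tensorDiff P M (tensorDiff P M t) = 0 := by
  have : tensorDiff P M ∘ₗ tensorDiff P M = 0 := tensor_ext fun x y => by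
    simp [tensorDiff_tmk, P.d_d, M.d_d, invol_map_of_degree_one P.gr (fun _ _ hx => P.d_mem hx)]
  exact LinearMap.congr_fun this t

end Tensor

section Functoriality

variable (P : DGModule.{u, v, w} R) {M : DGModule.{u, v, w'} R} {N : DGModule.{u, v, w''} R}

/-- The map `P ⊗_R f` induced by an `R`-linear map `f`. -/
noncomputable def tmap (f : M.carrier →ₗ[R.carrier] N.carrier) :
    TensorOver P M →ₗ[k] TensorOver P N :=
  (tensorRel P M).mapQ (tensorRel P N) (TensorProduct.map LinearMap.id (f.restrictScalars k)) (by
    rw [tensorRel, Submodule.span_le]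
    rintro _ ⟨m, n, a, x, y, ha, hx, rfl⟩
    refine Submodule.subset_span ⟨m, n, a, x, f y, ha, hx, ?_⟩
    simp)

theorem tmap_tmk (f : M.carrier →ₗ[R.carrier] N.carrier) (x : P.carrier) (y : M.carrier) :
    tmap P f (tmk P M x y) = tmk P N x (f y) := rfl

theorem tensorDiff_tmap (f : M.carrier →ₗ[R.carrier] N.carrier) (hf : ∀ y, f (M.d y) = N.d (f y))
    (t : TensorOver P M) : tensorDiff P N (tmap P f t) = tmap P f (tensorDiff P M t) := by
  have : tensorDiff P N ∘ₗ tmap P f = tmap P f ∘ₗ tensorDiff P M := tensor_ext fun x y => by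
    simp [tmap_tmk, tensorDiff_tmk, hf]
  exact LinearMap.congr_fun this t

end Functoriality

/-! ### Coordinates with respect to a homogeneous basis -/

section Coordinates

variable {P : DGModule.{u, v, w} R} {ι : Type*} (b : Module.Basis ι R.carrier P.carrier)
  {deg : ι → ℤ}

/-- A linear statement about a free module need only be checked on homogeneous multiples of basis
elements. -/
theorem mem_of_smul_basis_mem {S : Submodule k P.carrier}
    (h : ∀ i m, ∀ a ∈ R.gr m, a • b i ∈ S) (x : P.carrier) : x ∈ S := by
  have h' : ∀ i (a : R.carrier), a • b i ∈ S := by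
    intro i a
    refine mem_of_pr_mem R.gr (S := S.comap
      ((LinearMap.toSpanSingleton R.carrier P.carrier (b i)).restrictScalars k)) fun m => ?_
    exact h i m _ (pr_mem _ _ _)
  rw [← b.linearCombination_repr x, Finsupp.linearCombination_apply, Finsupp.sum]
  exact Submodule.sum_mem _ fun i _ => h' i _

/-- Coordinates with respect to `b`, as `k`-linear maps. -/
noncomputable def coord (i : ι) : P.carrier →ₗ[k] R.carrier := (b.coord i).restrictScalars k

theorem coord_apply (i : ι) (x : P.carrier) : coord b i x = b.repr x i := rfl

theorem repr_pr (hb : ∀ i, b i ∈ P.gr (deg i)) (n : ℤ) (x : P.carrier) (i : ι) :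
    b.repr (pr P.gr n x) i = pr R.gr (n - deg i) (b.repr x i) := by
  have : coord b i ∘ₗ pr P.gr n = pr R.gr (n - deg i) ∘ₗ coord b i := by
    rw [← sub_eq_zero, ← LinearMap.ker_eq_top, eq_top_iff]
    rintro x -
    refine mem_of_smul_basis_mem b (fun j m a ha => ?_) x
    rw [LinearMap.mem_ker, LinearMap.sub_apply, sub_eq_zero]
    simp only [LinearMap.comp_apply, coord_apply]
    have hm := P.smul_mem ha (hb j)
    by_cases hj : m + deg j = n
    · subst hj
      rw [pr_same P.gr hm]
      by_cases hij : j = i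
      · subst hij; simp [pr_same R.gr ha]
      · simp [hij]
    · rw [pr_ne P.gr hm hj]
      by_cases hij : j = i
      · subst hij; simp [pr_ne R.gr ha (show m ≠ n - deg j by omega)]
      · simp [hij]
  exact LinearMap.congr_fun this x

theorem repr_mem (hb : ∀ i, b i ∈ P.gr (deg i)) {n : ℤ} {x : P.carrier} (hx : x ∈ P.gr n) (i : ι) :
    b.repr x i ∈ R.gr (n - deg i) := by
  rw [← pr_same P.gr hx, repr_pr b hb]
  exact pr_mem _ _ _

variable (M : DGModule.{u, v, w'} R)

variable (deg) in
/-- The map `P ⊗ M → M^{(ι)}` that sends `r bᵢ ⊗ y` to `(-1)^{deg r deg bᵢ} r y` in place `i`. -/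
noncomputable def tensorCoordBase : P.carrier →ₗ[k] M.carrier →ₗ[k] (ι →₀ M.carrier) :=
  (Finsupp.lsum k fun i => LinearMap.mk₂ k
    (fun (r : R.carrier) (y : M.carrier) => Finsupp.single i (R.twist (deg i) r • y))
    (fun r s y => by rw [map_add, add_smul, Finsupp.single_add])
    (fun c r y => by rw [map_smul, smul_assoc, Finsupp.smul_single])
    (fun r y z => by rw [smul_add, Finsupp.single_add])
    (fun c r y => by rw [M.smul_comm_base, Finsupp.smul_single])) ∘ₗ
  (b.repr.toLinearMap.restrictScalars k)

theorem tensorCoordBase_apply (x : P.carrier) (y : M.carrier) (i : ι) :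
    tensorCoordBase b deg M x y i = R.twist (deg i) (b.repr x i) • y := by
  classical
  simp only [tensorCoordBase, LinearMap.comp_apply, LinearMap.coe_restrictScalars,
    LinearEquiv.coe_coe]
  induction b.repr x using Finsupp.induction_linear with
  | zero => simp
  | add f g hf hg => simp only [map_add, LinearMap.add_apply, Finsupp.add_apply, hf, hg, add_smul]
  | single j r =>
    by_cases h : j = i
    · subst h; simp
    · simp [h]

/-- The coordinates of an element of `P ⊗_R M` with respect to a homogeneous basis of `P`. -/
noncomputable def tensorCoord (hb : ∀ i, b i ∈ P.gr (deg i)) :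
    TensorOver P M →ₗ[k] (ι →₀ M.carrier) :=
  (tensorRel P M).liftQ (TensorProduct.lift (tensorCoordBase b deg M)) (by
    -- the twist by `deg bᵢ` accounts for the sign in the relations of `P ⊗_R M`
    rw [tensorRel, Submodule.span_le]
    rintro _ ⟨m, n, a, x, y, ha, hx, rfl⟩
    rw [SetLike.mem_coe, LinearMap.mem_ker, map_sub, sub_eq_zero, TensorProduct.lift.tmul,
      TensorProduct.lift.tmul]
    ext i
    rw [map_smul, LinearMap.smul_apply, Finsupp.smul_apply, tensorCoordBase_apply,
      tensorCoordBase_apply, map_smul, Finsupp.smul_apply, smul_eq_mul, R.twist_mul,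
      R.twist_of_mem _ ha, R.twist_of_mem _ (repr_mem b hb hx i), ← mul_smul, smul_mul_smul_comm,
      smul_mul_assoc, R.graded_comm ha (repr_mem b hb hx i), smul_smul, smul_assoc, smul_assoc,
      smul_smul]
    congr 1
    have h1 : (-1 : k) ^ (m * (n - deg i)) = (-1 : k) ^ (m * n) * (-1 : k) ^ (m * deg i) := by
      rw [mul_sub, sub_eq_add_neg, zpow_add₀ (by simp), zpow_neg, ← inv_zpow]
      norm_num
    have e1 := sgn_mul_self (k := k) (m * n)
    have e2 := sgn_mul_self (k := k) (m * deg i)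
    rw [h1]
    linear_combination (-1 : k) ^ ((n - deg i) * deg i) *
      ((-1 : k) ^ (m * deg i) * (-1 : k) ^ (m * deg i) * e1 + e2))

theorem tensorCoord_tmk (hb : ∀ i, b i ∈ P.gr (deg i)) (x : P.carrier) (y : M.carrier) (i : ι) :
    tensorCoord b M hb (tmk P M x y) i = R.twist (deg i) (b.repr x i) • y :=
  tensorCoordBase_apply b M x y i

/-- The element `∑ bᵢ ⊗ uᵢ` of `P ⊗_R M`. -/
noncomputable def ofCoord : (ι →₀ M.carrier) →ₗ[k] TensorOver P M :=
  Finsupp.lsum k fun i => tmk P M (b i)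

theorem ofCoord_single (i : ι) (y : M.carrier) :
    ofCoord b M (Finsupp.single i y) = tmk P M (b i) y := by
  simp [ofCoord]

theorem tensorCoord_basis (hb : ∀ i, b i ∈ P.gr (deg i)) (i : ι) (y : M.carrier) :
    tensorCoord b M hb (tmk P M (b i) y) = Finsupp.single i y := by
  classical
  ext j
  rw [tensorCoord_tmk, b.repr_self]
  by_cases h : i = j
  · subst h; simp [R.twist_one]
  · simp [h]

theorem ofCoord_tensorCoord (hb : ∀ i, b i ∈ P.gr (deg i)) (t : TensorOver P M) :
    ofCoord b M (tensorCoord b M hb t) = t := by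
  have : ofCoord b M ∘ₗ tensorCoord b M hb = LinearMap.id := by
    refine tensor_ext fun x y => ?_
    have key : (ofCoord b M ∘ₗ tensorCoord b M hb ∘ₗ (tmk P M).flip y) - (tmk P M).flip y = 0 := by
      rw [← LinearMap.ker_eq_top, eq_top_iff]
      rintro x -
      refine mem_of_smul_basis_mem b (fun j m a ha => ?_) x
      rw [LinearMap.mem_ker, LinearMap.sub_apply, sub_eq_zero]
      simp only [LinearMap.comp_apply, LinearMap.flip_apply]
      have h1 : tmk P M (a • b j) y = (-1 : k) ^ (m * deg j) • tmk P M (b j) (a • y) := by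
        rw [tmk_smul ha (hb j), sgn_sq_smul]
      rw [h1, map_smul, tensorCoord_basis, map_smul, ofCoord_single]
    exact sub_eq_zero.1 (LinearMap.congr_fun key x)
  exact LinearMap.congr_fun this t

end Coordinates

end

section

variable {k : Type u} [Field k] {R : AugCDGA.{u, v} k}

/-! ### Semifree modules -/

/-- Recursive choice along a rank function: a condition on the value at `i` that involves only the
values at places of smaller rank can be met at all places if it can be met at each single one. -/
theorem exists_forall_of_rank {ι β : Type*} (level : ι → ℕ) (Q : ι → (ι → β) → Prop)
    (hloc : ∀ i f g, (∀ j, level j < level i ∨ j = i → f j = g j) → Q i f → Q i g)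
    (hstep : ∀ i f, (∀ j, level j < level i → Q j f) →
      ∃ g, Q i g ∧ ∀ j, level j < level i → g j = f j)
    [Nonempty β] : ∃ f, ∀ i, Q i f := by
  classical
  -- a choice that is correct below level `n` can be corrected at level `n`
  have key : ∀ n, ∀ f : ι → β, (∀ i, level i < n → Q i f) →
      ∃ g, (∀ i, level i < n + 1 → Q i g) ∧ ∀ i, level i < n → g i = f i := by
    intro n f hf
    have h : ∀ i, ∃ g, level i = n → Q i g ∧ ∀ j, level j < n → g j = f j := by
      intro i
      by_cases hi : level i = n
      · obtain ⟨g, hg, hg'⟩ := hstep i f (fun j hj => hf j (hi ▸ hj))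
        exact ⟨g, fun _ => ⟨hg, fun j hj => hg' j (hi ▸ hj)⟩⟩
      · exact ⟨f, fun h => absurd h hi⟩
    choose G hG using h
    refine ⟨fun i => if level i = n then G i i else f i, fun i hi => ?_, fun i hi => ?_⟩
    · rcases Nat.lt_succ_iff_lt_or_eq.1 hi with h | h
      · refine hloc i f _ (fun j hj => ?_) (hf i h)
        have : level j < n := by
          rcases hj with hj | hj
          · omega
          · subst hj; exact h
        rw [if_neg this.ne]
      · refine hloc i (G i) _ (fun j hj => ?_) (hG i h).1
        rcases hj with hj | hj
        · rw [if_neg (by omega), (hG i h).2 j (by omega)]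
        · subst hj; rw [if_pos h]
    · exact if_neg hi.ne
  choose G hG using key
  let F : ∀ n : ℕ, {f : ι → β // ∀ i, level i < n → Q i f} := fun n =>
    Nat.rec ⟨fun _ => Classical.arbitrary β, fun i hi => absurd hi (Nat.not_lt_zero _)⟩
      (fun n f => ⟨G n f.1 f.2, (hG n f.1 f.2).1⟩) n
  have hF : ∀ n m, ∀ i, level i < n → (F (n + m)).1 i = (F n).1 i := by
    intro n m i hi
    induction m with
    | zero => rfl
    | succ m ih => exact ((hG (n + m) (F (n + m)).1 (F (n + m)).2).2 i (by omega)).trans ih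
  refine ⟨fun i => (F (level i + 1)).1 i, fun i => ?_⟩
  refine hloc i _ _ (fun j hj => ?_) ((F (level i + 1)).2 i (Nat.lt_succ_self _))
  have h : level j ≤ level i := by
    rcases hj with hj | hj
    · exact hj.le
    · rw [hj]
  obtain ⟨m, hm⟩ := Nat.exists_eq_add_of_le h
  have e : level i + 1 = level j + 1 + m := by omega
  change (F (level i + 1)).1 j = (F (level j + 1)).1 j
  rw [e]
  exact hF (level j + 1) m j (Nat.lt_succ_self _)

section Semifree

variable {P : DGModule.{u, v, w} R} {ι : Type*} (b : Module.Basis ι R.carrier P.carrier)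
  {deg : ι → ℤ} {level : ι → ℕ}

theorem level_lt_of_repr_ne_zero
    (hd : ∀ i, P.d (b i) ∈ Submodule.span R.carrier (b '' {j | level j < level i})) {i j : ι}
    (h : b.repr (P.d (b i)) j ≠ 0) : level j < level i :=
  b.mem_span_image.1 (hd i) (Finsupp.mem_support_iff.2 h)

variable (M : DGModule.{u, v, w'} R)

/-- The differential of `P ⊗_R M` acts on the coordinates of top level as that of `M`, up to sign. -/
theorem tensorCoord_tensorDiff_top (hb : ∀ i, b i ∈ P.gr (deg i))
    (hd : ∀ i, P.d (b i) ∈ Submodule.span R.carrier (b '' {j | level j < level i}))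
    (u : ι →₀ M.carrier) (i : ι) (hu : ∀ j, u j ≠ 0 → level j ≤ level i) :
    tensorCoord b M hb (tensorDiff P M (ofCoord b M u)) i = (-1 : k) ^ deg i • M.d (u i) := by
  classical
  have h0 : ∀ j, level j ≤ level i → ∀ y, tensorCoord b M hb (tensorDiff P M
      (ofCoord b M (Finsupp.single j y))) i = (-1 : k) ^ deg j • Finsupp.single j (M.d y) i := by
    intro j hj y
    rw [ofCoord_single, tensorDiff_tmk_of_mem (hb j), map_add, Finsupp.add_apply, tensorCoord_tmk,
      map_smul, tensorCoord_basis, Finsupp.smul_apply]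
    have : b.repr (P.d (b j)) i = 0 := by
      by_contra h
      exact absurd (level_lt_of_repr_ne_zero b hd h) (by omega)
    simp [this]
  conv_lhs => rw [← u.sum_single]
  rw [Finsupp.sum, map_sum, map_sum, map_sum, Finsupp.finsetSum_apply, Finset.sum_eq_single i]
  · rw [h0 i le_rfl, Finsupp.single_eq_same]
  · intro j hj hji
    rw [h0 j (hu j (Finsupp.mem_support_iff.1 hj))]
    simp [hji]
  · intro hi
    rw [Finsupp.notMem_support_iff.1 hi]
    simp

/-- Tensoring with a semifree module preserves acyclicity: the coordinates of top level of a cocycle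
are cocycles of `M`, and subtracting a coboundary removes them. -/
theorem tensor_acyclic (hP : P.IsSemifree) (hM : M.Acyclic) (t : TensorOver P M)
    (ht : tensorDiff P M t = 0) : ∃ s, tensorDiff P M s = t := by
  classical
  obtain ⟨ι, b, deg, level, hb, hd⟩ := hP
  have key : ∀ (n : ℕ) (u : ι →₀ M.carrier), (∀ i, u i ≠ 0 → level i < n) →
      tensorDiff P M (ofCoord b M u) = 0 → ∃ s, tensorDiff P M s = ofCoord b M u := by
    intro n
    induction n with
    | zero =>
      intro u hu _
      have : u = 0 := Finsupp.ext fun i => by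
        by_contra h
        exact absurd (hu i h) (Nat.not_lt_zero _)
      exact ⟨0, by simp [this]⟩
    | succ n ih =>
      intro u hu hdu
      have hy : ∀ i, ∃ y, (level i = n → M.d y = u i) ∧ (u i = 0 → y = 0) := by
        intro i
        by_cases hi : level i = n
        · have h1 := tensorCoord_tensorDiff_top b M hb hd u i
            (fun j hj => by have := hu j hj; omega)
          rw [hdu, map_zero, Finsupp.zero_apply] at h1
          have h2 : M.d (u i) = 0 := by
            rw [← sgn_sq_smul (k := k) (deg i) (M.d (u i)), ← h1, smul_zero]
          by_cases h0 : u i = 0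
          · exact ⟨0, fun _ => by simp [h0], fun _ => rfl⟩
          · obtain ⟨y, hy⟩ := hM _ h2
            exact ⟨y, fun _ => hy, fun h => absurd h h0⟩
        · exact ⟨0, fun h => absurd h hi, fun _ => rfl⟩
      choose y hy hy0 using hy
      -- the part of a primitive of `u` that lies over the basis elements of top level
      let v : ι →₀ M.carrier := Finsupp.onFinset u.support
        (fun i => if level i = n then (-1 : k) ^ deg i • y i else 0) (by
          intro i hi
          rw [Finsupp.mem_support_iff]
          rintro h
          exact hi (by simp [hy0 i h]))
      have hv : ∀ i, v i = if level i = n then (-1 : k) ^ deg i • y i else 0 := fun i => rfl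
      have hvl : ∀ i, v i ≠ 0 → level i = n := by
        intro i hi
        by_contra h
        exact hi (by rw [hv, if_neg h])
      let u' := u - tensorCoord b M hb (tensorDiff P M (ofCoord b M v))
      have hu' : ofCoord b M u' = ofCoord b M u - tensorDiff P M (ofCoord b M v) := by
        rw [map_sub, ofCoord_tensorCoord]
      obtain ⟨s, hs⟩ := ih u' (by
        intro i hi
        by_contra hlt
        refine hi ?_
        have h1 := tensorCoord_tensorDiff_top b M hb hd v i
          (fun j hj => by have := hvl j hj; omega)
        rw [Finsupp.sub_apply, h1, hv]
        by_cases h : level i = n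
        · rw [if_pos h, map_smul, hy i h, sgn_sq_smul, sub_self]
        · rw [if_neg h, map_zero, smul_zero, sub_zero]
          by_contra h0
          have := hu i h0
          omega) (by rw [hu', map_sub, hdu, tensorDiff_tensorDiff, sub_zero])
      exact ⟨s + ofCoord b M v, by rw [map_add, hs, hu', sub_add_cancel]⟩
  obtain ⟨n, hn⟩ : ∃ n, ∀ i, tensorCoord b M hb t i ≠ 0 → level i < n :=
    ⟨(tensorCoord b M hb t).support.sup level + 1, fun i hi =>
      Nat.lt_succ_of_le (Finset.le_sup (f := level) (Finsupp.mem_support_iff.2 hi))⟩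
  have := key n _ hn (by rwa [ofCoord_tensorCoord])
  rwa [ofCoord_tensorCoord] at this

/-- Detection: let `P` be semifree on generators of degree `≥ 0`, one of which, `b i₀`, is a
cocycle of degree `0`. If `M` has no cohomology below degree `m`, then a cocycle `x` of degree `m`
is a coboundary as soon as `b i₀ ⊗ x` is one. -/
theorem exists_d_eq_of_basis_tmul (hb : ∀ i, b i ∈ P.gr (deg i))
    (hd : ∀ i, P.d (b i) ∈ Submodule.span R.carrier (b '' {j | level j < level i}))
    (hdeg : ∀ i, 0 ≤ deg i) {i₀ : ι} (hi₀ : P.d (b i₀) = 0) (hdeg₀ : deg i₀ = 0) {m : ℤ}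
    (hM : ∀ j < m, ∀ y ∈ M.gr j, M.d y = 0 → ∃ z, M.d z = y) {x : M.carrier} (hx : x ∈ M.gr m)
    {t : TensorOver P M} (ht : tensorDiff P M t = tmk P M (b i₀) x) : ∃ y, M.d y = x := by
  classical
  by_contra hne
  -- a functional of degree `m` on `M` that kills the coboundaries and does not kill `x`
  obtain ⟨ξ, hξd, hξx, hξm⟩ : ∃ ξ : M.carrier →ₗ[k] k, (∀ y, ξ (M.d y) = 0) ∧ ξ x ≠ 0 ∧
      ∀ j, j ≠ m → ∀ y ∈ M.gr j, ξ y = 0 := by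
    obtain ⟨f, hfx, hf⟩ := Submodule.exists_le_ker_of_notMem (p := LinearMap.range M.d) hne
    refine ⟨f ∘ₗ pr M.gr m, fun y => ?_, ?_, fun j hj y hy => ?_⟩
    · have := M.pr_d (m - 1) y
      rw [sub_add_cancel] at this
      rw [LinearMap.comp_apply, this]
      exact hf ⟨_, rfl⟩
    · rwa [LinearMap.comp_apply, pr_same M.gr hx]
    · rw [LinearMap.comp_apply, pr_ne M.gr hy hj, map_zero]
  -- the functional `∑ bᵢ ⊗ yᵢ ↦ ∑ θᵢ(yᵢ)`
  let Θ : (ι → (M.carrier →ₗ[k] k)) → TensorOver P M →ₗ[k] k := fun θ =>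
    Finsupp.lsum k θ ∘ₗ tensorCoord b M hb
  have hΘ : ∀ θ i y, Θ θ (tmk P M (b i) y) = θ i y := fun θ i y => by
    simp [Θ, tensorCoord_basis]
  -- `Θ θ` on `c ⊗ y` involves `θ` only at the places where `c` has a coordinate
  have hcongr : ∀ θ θ' (c : P.carrier) y, (∀ j, b.repr c j ≠ 0 → θ j = θ' j) →
      Θ θ (tmk P M c y) = Θ θ' (tmk P M c y) := by
    intro θ θ' c y h
    simp only [Θ, LinearMap.comp_apply, Finsupp.lsum_apply, Finsupp.sum]
    refine Finset.sum_congr rfl fun j hj => ?_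
    rw [h j]
    intro h0
    rw [Finsupp.mem_support_iff, tensorCoord_tmk, h0] at hj
    simp at hj
  -- `θ i` has degree `m - deg i`, `Θ θ` vanishes on the coboundaries `d (bᵢ ⊗ y)`, and `θ i₀ = ξ`
  let Q : ι → (ι → (M.carrier →ₗ[k] k)) → Prop := fun i θ =>
    (∀ j, j ≠ m - deg i → ∀ y ∈ M.gr j, θ i y = 0) ∧
    (∀ y, Θ θ (tensorDiff P M (tmk P M (b i) y)) = 0) ∧ (i = i₀ → θ i = ξ)
  have hΘd : ∀ θ i y, Θ θ (tensorDiff P M (tmk P M (b i) y)) =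
      Θ θ (tmk P M (P.d (b i)) y) + (-1 : k) ^ deg i • θ i (M.d y) := fun θ i y => by
    rw [tensorDiff_tmk_of_mem (hb i), map_add, map_smul, hΘ]
  obtain ⟨θ, hθ⟩ : ∃ θ, ∀ i, Q i θ := by
    refine exists_forall_of_rank level Q ?_ ?_
    · rintro i f g hfg ⟨h1, h2, h3⟩
      have hi : f i = g i := hfg i (Or.inr rfl)
      refine ⟨hi ▸ h1, fun y => ?_, hi ▸ h3⟩
      rw [hΘd, ← hi, ← hcongr f g _ _ fun j hj => hfg j (Or.inl (level_lt_of_repr_ne_zero b hd hj)),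
        ← hΘd, h2]
    · intro i f hf
      have hupd : ∀ g y, Θ (Function.update f i g) (tmk P M (P.d (b i)) y) =
          Θ f (tmk P M (P.d (b i)) y) := fun g y => hcongr _ _ _ _ fun j hj => by
        have := level_lt_of_repr_ne_zero b hd hj
        rw [Function.update_of_ne]
        rintro rfl
        omega
      suffices h : ∃ g : M.carrier →ₗ[k] k, (∀ j, j ≠ m - deg i → ∀ y ∈ M.gr j, g y = 0) ∧
          (∀ y, Θ f (tmk P M (P.d (b i)) y) + (-1 : k) ^ deg i • g (M.d y) = 0) ∧
          (i = i₀ → g = ξ) by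
        obtain ⟨g, h1, h2, h3⟩ := h
        refine ⟨Function.update f i g, ⟨?_, ?_, ?_⟩, fun j hj => ?_⟩
        · simpa using h1
        · intro y
          rw [hΘd, hupd, Function.update_self, h2]
        · simpa using h3
        · rw [Function.update_of_ne]
          rintro rfl
          omega
      by_cases hi : i = i₀
      · subst hi
        exact ⟨ξ, by rwa [hdeg₀, sub_zero], fun y => by simp [hi₀, hξd], fun _ => rfl⟩
      -- the obstruction functional `ψ` has degree `m - deg i - 1 < m` and kills coboundaries
      let ψ : M.carrier →ₗ[k] k := Θ f ∘ₗ tmk P M (P.d (b i))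
      have hψd : ∀ y, ψ (M.d y) = 0 := by
        intro y
        have hz : Θ f (tensorDiff P M (tmk P M (P.d (b i)) y)) = 0 := by
          have : ∀ c, (∀ j, b.repr c j ≠ 0 → level j < level i) →
              Θ f (tensorDiff P M (tmk P M c y)) = 0 := by
            intro c hc
            rw [← ofCoord_tensorCoord b M hb (tmk P M c y), ofCoord, Finsupp.lsum_apply,
              Finsupp.sum, map_sum, map_sum]
            refine Finset.sum_eq_zero fun j hj => (hf j (hc j fun h0 => ?_)).2.1 _
            rw [Finsupp.mem_support_iff, tensorCoord_tmk, h0] at hj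
            simp at hj
          exact this _ fun j hj => level_lt_of_repr_ne_zero b hd hj
        rw [tensorDiff_tmk_of_mem (P.d_mem (hb i)), P.d_d, map_zero, LinearMap.zero_apply, zero_add,
          map_smul, smul_eq_zero] at hz
        exact hz.resolve_left (zpow_ne_zero _ (by simp))
      have hψdeg : ∀ j, j ≠ m - deg i - 1 → ∀ y ∈ M.gr j, ψ y = 0 := by
        intro j hj y hy
        simp only [ψ, Θ, LinearMap.comp_apply, Finsupp.lsum_apply, Finsupp.sum]
        refine Finset.sum_eq_zero fun l hl => ?_
        have hl' : b.repr (P.d (b i)) l ≠ 0 := by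
          intro h0
          rw [Finsupp.mem_support_iff, tensorCoord_tmk, h0] at hl
          simp at hl
        rw [tensorCoord_tmk]
        refine (hf l (level_lt_of_repr_ne_zero b hd hl')).1 (deg i + 1 - deg l + j) (by omega) _ ?_
        exact M.smul_mem (R.twist_mem _ (repr_mem b hb (P.d_mem (hb i)) l)) hy
      have hψpr : ∀ y, ψ (pr M.gr (m - deg i - 1) y) = ψ y := by
        intro y
        have : ψ ∘ₗ pr M.gr (m - deg i - 1) = ψ := eq_of_homogeneous M.gr fun j y hy => by
          rw [LinearMap.comp_apply]
          by_cases h : j = m - deg i - 1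
          · subst h; rw [pr_same M.gr hy]
          · rw [pr_ne M.gr hy h, map_zero, hψdeg j h y hy]
        exact LinearMap.congr_fun this y
      obtain ⟨g, hg⟩ := exists_functional_comp_eq M.d (-((-1 : k) ^ deg i • ψ)) (by
        intro y hy
        have : ψ y = 0 := by
          rw [← hψpr]
          obtain ⟨z, hz⟩ := hM (m - deg i - 1) (by have := hdeg i; omega) _ (pr_mem _ _ y)
            (by rw [← M.pr_d, hy, map_zero])
          rw [← hz, hψd]
        simp [this])
      refine ⟨g ∘ₗ pr M.gr (m - deg i), fun j hj y hy => ?_, fun y => ?_, fun h => absurd h hi⟩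
      · rw [LinearMap.comp_apply, pr_ne M.gr hy hj, map_zero]
      · have := M.pr_d (m - deg i - 1) y
        rw [sub_add_cancel] at this
        change Θ f (tmk P M (P.d (b i)) y) + (-1 : k) ^ deg i • g (pr M.gr (m - deg i) (M.d y)) = 0
        rw [this, hg, LinearMap.neg_apply, LinearMap.smul_apply, hψpr,
          smul_neg, sgn_sq_smul]
        exact add_neg_cancel _
  have hz : ∀ s, Θ θ (tensorDiff P M s) = 0 := by
    intro s
    rw [← ofCoord_tensorCoord b M hb s, ofCoord, Finsupp.lsum_apply, Finsupp.sum, map_sum, map_sum]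
    exact Finset.sum_eq_zero fun j _ => (hθ j).2.1 _
  refine hξx ?_
  rw [← (hθ i₀).2.2 rfl, ← hΘ, ← ht, hz]

end Semifree

end

section

variable {k : Type u} [Field k] {R : AugCDGA.{u, v} k}

/-! ### Adjoining a cell -/

namespace Cell

variable (C : DGModule.{u, v, w} R) (e : ℤ)

/-- The grading of `C ⊕ R σ`, `deg σ = e - 1`. -/
def gr (i : ℤ) : Submodule k (C.carrier × R.carrier) := (C.gr i).prod (R.gr (i + 1 - e))

variable {C e} in
theorem mem_gr {i : ℤ} {x : C.carrier × R.carrier} :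
    x ∈ gr C e i ↔ x.1 ∈ C.gr i ∧ x.2 ∈ R.gr (i + 1 - e) := Submodule.mem_prod

theorem isInternal_gr : DirectSum.IsInternal (gr C e) := by
  refine isInternal_of_ker (gr C e)
    (fun i => (LinearMap.ker (pr C.gr i)).prod (LinearMap.ker (pr R.gr (i + 1 - e)))) ?_ ?_ ?_
  · rintro i j hij x hx
    obtain ⟨h1, h2⟩ := mem_gr.1 hx
    exact Submodule.mem_prod.2 ⟨pr_ne C.gr h1 hij, pr_ne R.gr h2 (by omega)⟩
  · rintro i x hx hx'
    obtain ⟨h1, h2⟩ := mem_gr.1 hx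
    obtain ⟨h1', h2'⟩ := Submodule.mem_prod.1 hx'
    rw [LinearMap.mem_ker, pr_same C.gr h1] at h1'
    rw [LinearMap.mem_ker, pr_same R.gr h2] at h2'
    exact Prod.ext h1' h2'
  · rw [eq_top_iff]
    rintro x -
    have h1 : ∀ c, LinearMap.inl k C.carrier R.carrier c ∈ ⨆ i, gr C e i := fun c =>
      mem_of_pr_mem C.gr (S := (⨆ i, gr C e i).comap (LinearMap.inl k C.carrier R.carrier))
        fun i => Submodule.mem_iSup_of_mem i (mem_gr.2 ⟨pr_mem _ _ _, Submodule.zero_mem _⟩)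
    have h2 : ∀ r, LinearMap.inr k C.carrier R.carrier r ∈ ⨆ i, gr C e i := fun r =>
      mem_of_pr_mem R.gr (S := (⨆ i, gr C e i).comap (LinearMap.inr k C.carrier R.carrier))
        fun i => Submodule.mem_iSup_of_mem (i + e - 1) (mem_gr.2 ⟨Submodule.zero_mem _, by
          have := pr_mem R.gr i r
          rwa [show i + e - 1 + 1 - e = i by ring]⟩)
    have := Submodule.add_mem _ (h1 x.1) (h2 x.2)
    simpa using this

noncomputable instance : DirectSum.Decomposition (gr C e) :=
  (isInternal_gr C e).chooseDecomposition

variable {C} in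
/-- The differential of `C ⊕ R σ`, `dσ = ω`. -/
noncomputable def diff (ω : C.carrier) : C.carrier × R.carrier →ₗ[k] C.carrier × R.carrier :=
  LinearMap.prod
    (C.d ∘ₗ LinearMap.fst k _ _ +
      (LinearMap.toSpanSingleton R.carrier C.carrier ω).restrictScalars k ∘ₗ R.inv ∘ₗ
        LinearMap.snd k _ _)
    (R.d ∘ₗ LinearMap.snd k _ _)

end Cell

/-- The module `C ⊕ R σ` that is obtained from `C` by adjoining a generator `σ` with `dσ = ω`, for
a cocycle `ω` of degree `e`. It is the mapping cone of `R → C`, `a ↦ a ω`; the sign in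
`d (r σ) = (dr) σ + (-1)^{deg r} r ω` makes the action of `R` componentwise. -/
noncomputable def adjoinCell (C : DGModule.{u, v, w} R) {e : ℤ} {ω : C.carrier} (hω : ω ∈ C.gr e)
    (hd : C.d ω = 0) : DGModule.{u, v, max w v} R where
  carrier := C.carrier × R.carrier
  gr := Cell.gr C e
  smul_mem := by
    intro m n a x ha hx
    obtain ⟨h1, h2⟩ := Cell.mem_gr.1 hx
    refine Cell.mem_gr.2 ⟨C.smul_mem ha h1, ?_⟩
    have := R.mul_mem ha h2
    rwa [show m + (n + 1 - e) = m + n + 1 - e by ring] at this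
  d := Cell.diff ω
  d_mem := by
    intro n x hx
    obtain ⟨h1, h2⟩ := Cell.mem_gr.1 hx
    refine Cell.mem_gr.2 ⟨Submodule.add_mem _ (C.d_mem h1) ?_, ?_⟩
    · have := C.smul_mem (invol_mem R.gr h2) hω
      rwa [show n + 1 - e + e = n + 1 by ring] at this
    · have := R.d_mem h2
      rwa [show n + 1 - e + 1 = n + 1 + 1 - e by ring] at this
  d_d := by
    rintro ⟨c, r⟩
    refine Prod.ext ?_ (R.d_d r)
    change C.d (C.d c + R.inv r • ω) + R.inv (R.d r) • ω = 0
    rw [map_add, C.d_d, C.leibniz', hd, R.d_inv]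
    simp
  leibniz := by
    rintro m a ha ⟨c, r⟩
    refine Prod.ext ?_ (R.leibniz ha r)
    change C.d (a • c) + R.inv (a * r) • ω =
      R.d a • c + (-1 : k) ^ m • (a • (C.d c + R.inv r • ω))
    rw [C.leibniz ha, R.inv_mul, invol_of_mem R.gr ha]
    simp only [smul_add, smul_mul_assoc, smul_assoc, mul_smul, add_assoc]

section AdjoinCell

variable (C : DGModule.{u, v, w} R) {e : ℤ} {ω : C.carrier} (hω : ω ∈ C.gr e) (hd : C.d ω = 0)

/-- The inclusion `C → C ⊕ R σ`. -/
def cellInl : C.carrier →ₗ[R.carrier] (adjoinCell C hω hd).carrier :=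
  LinearMap.inl R.carrier C.carrier R.carrier

/-- The projection `C ⊕ R σ → C` (not a map of complexes). -/
def cellFst : (adjoinCell C hω hd).carrier →ₗ[R.carrier] C.carrier :=
  LinearMap.fst R.carrier C.carrier R.carrier

/-- The projection `C ⊕ R σ → R`. -/
def cellSnd : (adjoinCell C hω hd).carrier →ₗ[R.carrier] (regular R).carrier :=
  LinearMap.snd R.carrier C.carrier R.carrier

/-- The adjoined generator. -/
def cellGen : (adjoinCell C hω hd).carrier := ((0, 1) : C.carrier × R.carrier)

theorem d_cellInl (c : C.carrier) :
    cellInl C hω hd (C.d c) = (adjoinCell C hω hd).d (cellInl C hω hd c) := by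
  refine Prod.ext ?_ ?_
  · change C.d c = C.d c + R.inv 0 • ω
    simp
  · change 0 = R.d 0
    simp

theorem d_cellGen : (adjoinCell C hω hd).d (cellGen C hω hd) = cellInl C hω hd ω := by
  refine Prod.ext ?_ R.d_one
  change C.d 0 + R.inv 1 • ω = ω
  rw [R.inv_one]
  simp

end AdjoinCell

/-! ### `P ⊗_R (C ⊕ R σ)` -/

section TensorCell

variable {P : DGModule.{u, v, w'} R}

/-- An element `x ⊗ a y` can be rewritten as `x' ⊗ y`. -/
theorem exists_tmk_smul {M : DGModule.{u, v, w} R} (x : P.carrier) (a : R.carrier) (y : M.carrier) :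
    ∃ x', tmk P M x (a • y) = tmk P M x' y := by
  refine mem_of_pr_mem R.gr (S := (LinearMap.range ((tmk P M).flip y)).comap (tmk P M x ∘ₗ
    (LinearMap.toSpanSingleton R.carrier M.carrier y).restrictScalars k)) (x := a) (fun i => ?_)
    |>.imp fun x' h => h.symm
  refine mem_of_pr_mem P.gr (S := (LinearMap.range ((tmk P M).flip y)).comap
    ((tmk P M).flip (pr R.gr i a • y))) (x := x) fun j => ?_
  refine ⟨(-1 : k) ^ (i * j) • pr R.gr i a • pr P.gr j x, ?_⟩
  simp only [LinearMap.flip_apply]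
  rw [tmk_smul (pr_mem R.gr i a) (pr_mem P.gr j x), map_smul, LinearMap.smul_apply]

/-- If `P` is free, `P → P ⊗_R R` is injective. -/
theorem eq_zero_of_tmk_one_eq_zero (hP : P.IsSemifree) {x : P.carrier}
    (h : tmk P (regular R) x (1 : R.carrier) = 0) : x = 0 := by
  obtain ⟨ι, b, deg, level, hb, -⟩ := hP
  apply b.repr.injective
  rw [map_zero]
  ext i
  have h1 := tensorCoord_tmk b (regular R) hb x (1 : R.carrier) i
  rw [h, map_zero] at h1
  have h2 : R.twist (deg i) (b.repr x i) * 1 = 0 := h1.symm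
  rw [← R.twist_twist (deg i) (b.repr x i), ← mul_one (R.twist (deg i) (b.repr x i)), h2, map_zero]
  rfl

variable (C : DGModule.{u, v, w} R) {e : ℤ} {ω : C.carrier} (hω : ω ∈ C.gr e) (hd : C.d ω = 0)

/-- Every element of `P ⊗_R (C ⊕ R σ)` is `t + x ⊗ σ` with `t ∈ P ⊗_R C`. -/
theorem exists_eq_add_tmk_cellGen (u : TensorOver P (adjoinCell C hω hd)) :
    ∃ t x, u = tmap P (cellInl C hω hd) t + tmk P (adjoinCell C hω hd) x (cellGen C hω hd) := by
  have : u ∈ LinearMap.range (tmap P (cellInl C hω hd)) ⊔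
      LinearMap.range ((tmk P (adjoinCell C hω hd)).flip (cellGen C hω hd)) := by
    refine tensor_mem_of_tmk_mem (fun x y => ?_) u
    have hy : y = cellInl C hω hd y.1 + (y.2 : R.carrier) • cellGen C hω hd := by
      refine Prod.ext ?_ ?_
      · change y.1 = y.1 + y.2 • (0 : C.carrier)
        simp
      · change y.2 = 0 + y.2 * 1
        simp
    rw [hy, map_add]
    obtain ⟨x', hx'⟩ := exists_tmk_smul x (y.2 : R.carrier) (cellGen C hω hd)
    refine Submodule.add_mem_sup ⟨tmk P C x y.1, tmap_tmk _ _ _ _⟩ ?_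
    rw [hx']
    exact ⟨x', rfl⟩
  obtain ⟨_, ⟨t, rfl⟩, _, ⟨x, rfl⟩, h⟩ := Submodule.mem_sup.1 this
  exact ⟨t, x, h.symm⟩

/-- The representation in `exists_eq_add_tmk_cellGen` is unique. -/
theorem eq_zero_of_add_tmk_cellGen (hP : P.IsSemifree) {t : TensorOver P C} {x : P.carrier}
    (h : tmap P (cellInl C hω hd) t + tmk P (adjoinCell C hω hd) x (cellGen C hω hd) = 0) :
    t = 0 ∧ x = 0 := by
  have hx : x = 0 := by
    refine eq_zero_of_tmk_one_eq_zero hP ?_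
    have h1 : ∀ t, tmap P (cellSnd C hω hd) (tmap P (cellInl C hω hd) t) = 0 := fun t => by
      have : tmap P (cellSnd C hω hd) ∘ₗ tmap P (cellInl C hω hd) = 0 := tensor_ext fun x y =>
        map_zero (tmk P (regular R) x)
      exact LinearMap.congr_fun this t
    have h2 := congrArg (tmap P (cellSnd C hω hd)) h
    rw [map_add, h1, map_zero, zero_add] at h2
    exact h2
  refine ⟨?_, hx⟩
  have h1 : ∀ t, tmap P (cellFst C hω hd) (tmap P (cellInl C hω hd) t) = t := fun t => by
    have : tmap P (cellFst C hω hd) ∘ₗ tmap P (cellInl C hω hd) = LinearMap.id :=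
      tensor_ext fun x y => rfl
    exact LinearMap.congr_fun this t
  rw [hx, map_zero, LinearMap.zero_apply, add_zero] at h
  rw [← h1 t, h, map_zero]

theorem tensorDiff_add_tmk_cellGen (t : TensorOver P C) (x : P.carrier) :
    tensorDiff P (adjoinCell C hω hd)
      (tmap P (cellInl C hω hd) t + tmk P (adjoinCell C hω hd) x (cellGen C hω hd)) =
    tmap P (cellInl C hω hd) (tensorDiff P C t + tmk P C (invol P.gr x) ω) +
      tmk P (adjoinCell C hω hd) (P.d x) (cellGen C hω hd) := by
  rw [map_add, tensorDiff_tmap P _ (d_cellInl C hω hd), tensorDiff_tmk, d_cellGen, map_add,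
    tmap_tmk]
  abel

/-- Let `P` be a semifree module whose cohomology is spanned by the class of `p ∈ P⁰`, `[p] ≠ 0`.
Then `P ⊗_R (C ⊕ R σ)` is acyclic if and only if the cohomology of `P ⊗_R C` is spanned by the
class of `p ⊗ ω`, and this class is not zero. -/
theorem tensor_adjoinCell_acyclic_iff (hP : P.IsSemifree) {p : P.carrier} (hp : p ∈ P.gr 0)
    (hdp : P.d p = 0) (hspan : ∀ x, P.d x = 0 → ∃ (c : k) (y : P.carrier), x = c • p + P.d y)
    (hne : ∀ y, P.d y ≠ p) :
    (∀ u, tensorDiff P (adjoinCell C hω hd) u = 0 →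
        ∃ s, tensorDiff P (adjoinCell C hω hd) s = u) ↔
      (∀ s, tensorDiff P C s ≠ tmk P C p ω) ∧ ∀ t, tensorDiff P C t = 0 →
        ∃ (c : k) (s : TensorOver P C), t = c • tmk P C p ω + tensorDiff P C s := by
  set K := adjoinCell C hω hd with hK
  set i := tmap P (cellInl C hω hd) with hi
  set σ := cellGen C hω hd with hσ
  have hdK : ∀ t x, tensorDiff P K (i t + tmk P K x σ) =
      i (tensorDiff P C t + tmk P C (invol P.gr x) ω) + tmk P K (P.d x) σ :=
    tensorDiff_add_tmk_cellGen C hω hd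
  have huniq : ∀ t x t' x', i t + tmk P K x σ = i t' + tmk P K x' σ → t = t' ∧ x = x' := by
    intro t x t' x' h
    have := eq_zero_of_add_tmk_cellGen C hω hd hP (t := t - t') (x := x - x') (by
      rw [map_sub, map_sub, LinearMap.sub_apply, sub_add_sub_comm]
      exact sub_eq_zero.2 h)
    exact ⟨sub_eq_zero.1 this.1, sub_eq_zero.1 this.2⟩
  have hdinv : ∀ y,
      tmk P C (invol P.gr (P.d y)) ω = - tensorDiff P C (tmk P C (invol P.gr y) ω) := by
    intro y
    rw [tensorDiff_tmk, hd, map_zero, add_zero, P.d_invol, map_neg, LinearMap.neg_apply, neg_neg]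
  have hpinv : invol P.gr p = p := invol_of_mem_zero P.gr hp
  constructor
  · intro h
    refine ⟨fun s hs => ?_, fun t ht => ?_⟩
    · obtain ⟨u, hu⟩ := h (i (-s) + tmk P K p σ) (by
        rw [hdK, hdp, map_neg, hs, hpinv]
        simp)
      obtain ⟨t, x, rfl⟩ := exists_eq_add_tmk_cellGen C hω hd u
      exact hne x (huniq _ _ _ _ ((hdK t x).symm.trans hu)).2
    · obtain ⟨u, hu⟩ := h (i t + tmk P K 0 σ) (by rw [hdK, ht]; simp)
      obtain ⟨t', x, rfl⟩ := exists_eq_add_tmk_cellGen C hω hd u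
      obtain ⟨h1, h2⟩ := huniq _ _ _ _ ((hdK t' x).symm.trans hu)
      obtain ⟨c, y, rfl⟩ := hspan x h2
      refine ⟨c, t' - tmk P C (invol P.gr y) ω, ?_⟩
      rw [← h1, map_add, map_smul, hpinv, map_add, LinearMap.add_apply, hdinv, map_smul, map_sub,
        LinearMap.smul_apply]
      abel
  · rintro ⟨h0, h1⟩ u hu
    obtain ⟨t, x, rfl⟩ := exists_eq_add_tmk_cellGen C hω hd u
    obtain ⟨h2, h3⟩ := huniq _ _ 0 0 ((hdK t x).symm.trans (hu.trans (by simp)))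
    obtain ⟨c, y, rfl⟩ := hspan x h3
    rw [map_add, map_smul, hpinv, map_add, LinearMap.add_apply, hdinv, map_smul,
      LinearMap.smul_apply] at h2
    have hc : c = 0 := by
      by_contra hc
      refine h0 (-c⁻¹ • (t - tmk P C (invol P.gr y) ω)) ?_
      have h4 : tensorDiff P C (t - tmk P C (invol P.gr y) ω) = -(c • tmk P C p ω) := by
        rw [eq_neg_iff_add_eq_zero, ← h2, map_sub]
        abel
      rw [map_smul, h4, neg_smul_neg, smul_smul, inv_mul_cancel₀ hc, one_smul]
    subst hc
    obtain ⟨c', s, hs⟩ := h1 (t - tmk P C (invol P.gr y) ω) (by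
      rw [map_sub, ← h2]; simp [sub_eq_add_neg])
    refine ⟨i s + tmk P K (c' • p + y) σ, ?_⟩
    rw [hdK, sub_eq_iff_eq_add.1 hs]
    simp [hdp, hpinv]
    abel

end TensorCell

end

section

variable {k : Type u} [Field k]

/-! ### A semifree resolution of the base field with generators of degree `≥ 0` -/

/-- Formal generators: `one`, and for each formal linear combination `∑ cᵢ gᵢ` of generators with
coefficients in `A` a generator `kill n c g` that is to have this combination as its differential.
The integer is the degree of the new generator. -/
inductive Gen (A : Type v) : Type v
  | one : Gen A
  | kill (deg : ℤ) (n : ℕ) (c : Fin n → A) (g : Fin n → Gen A) : Gen A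

namespace Gen

variable {A : Type v}

/-- The degree of a generator. -/
def deg : Gen A → ℤ
  | one => 0
  | kill d _ _ _ => d

/-- The depth of a generator, which exceeds the depths of those in its differential. -/
def level : Gen A → ℕ
  | one => 0
  | kill _ _ _ g => Finset.univ.sup (fun i => (g i).level) + 1

/-- The differential of a generator, in the free module on all generators. -/
noncomputable def boundary [Semiring A] : Gen A → (Gen A →₀ A)
  | one => 0
  | kill _ _ c g => ∑ i, Finsupp.single (g i) (c i)

theorem level_lt_of_boundary_ne_zero [Semiring A] {g h : Gen A} (hh : boundary g h ≠ 0) :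
    level h < level g := by
  classical
  cases g with
  | one => simp [boundary] at hh
  | kill d n c g =>
    rw [boundary, Finsupp.finsetSum_apply] at hh
    obtain ⟨i, -, hi⟩ := Finset.exists_ne_zero_of_sum_ne_zero hh
    have : g i = h := by
      by_contra h0
      exact hi (by simp [h0])
    subst this
    rw [level]
    exact Nat.lt_succ_of_le (Finset.le_sup (f := fun i => (g i).level) (Finset.mem_univ i))

/-- Every formal combination is the differential of a generator of any prescribed degree. -/
theorem exists_boundary_eq [Semiring A] (d : ℤ) (z : Gen A →₀ A) :
    ∃ g : Gen A, g.deg = d ∧ boundary g = z := by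
  classical
  let e := z.support.equivFin
  refine ⟨kill d _ (fun i => z (e.symm i)) (fun i => (e.symm i : Gen A)), rfl, ?_⟩
  rw [boundary, Equiv.sum_comp e.symm (fun i : z.support => Finsupp.single (i : Gen A) (z i)),
    Finset.sum_coe_sort z.support (fun i => Finsupp.single i (z i))]
  exact z.sum_single

end Gen

namespace Resolution

variable (R : AugCDGA.{u, v} k)

/-- The free module on all formal generators. -/
abbrev Free := Gen R.carrier →₀ R.carrier

/-- The differential on the free module on all formal generators. It has square zero only on
suitable submodules. -/
noncomputable def diff : Free R →ₗ[k] Free R :=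
  Finsupp.lsum k fun g => (Finsupp.lsingle g : R.carrier →ₗ[k] Free R) ∘ₗ R.d +
    (LinearMap.toSpanSingleton R.carrier (Free R) g.boundary).restrictScalars k ∘ₗ R.inv

theorem diff_single (g : Gen R.carrier) (a : R.carrier) :
    diff R (Finsupp.single g a) = Finsupp.single g (R.d a) + R.inv a • g.boundary := by
  simp [diff]

theorem diff_single_one (g : Gen R.carrier) :
    diff R (Finsupp.single g 1) = g.boundary := by
  rw [diff_single, R.d_one, R.inv_one, one_smul, Finsupp.single_zero, zero_add]

theorem diff_smul (a : R.carrier) (x : Free R) :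
    diff R (a • x) = R.d a • x + R.inv a • diff R x := by
  induction x using Finsupp.induction_linear with
  | zero => simp
  | add x y hx hy => simp only [smul_add, map_add, hx, hy]; abel
  | single g b =>
    rw [Finsupp.smul_single, diff_single, diff_single, smul_eq_mul, R.leibniz', R.inv_mul, smul_add,
      mul_smul, Finsupp.smul_single, Finsupp.smul_single, Finsupp.single_add, smul_eq_mul,
      smul_eq_mul, add_assoc]

/-- The elements of degree `n` of the free module on all formal generators. -/
def grFree (n : ℤ) : Submodule k (Free R) where
  carrier := {x | ∀ g, x g ∈ R.gr (n - g.deg)}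
  add_mem' hx hy g := Submodule.add_mem _ (hx g) (hy g)
  zero_mem' _ := Submodule.zero_mem _
  smul_mem' c _ hx g := Submodule.smul_mem _ c (hx g)

variable {R}

theorem smul_mem_grFree {m n : ℤ} {a : R.carrier} {x : Free R} (ha : a ∈ R.gr m)
    (hx : x ∈ grFree R n) : a • x ∈ grFree R (m + n) := fun g => by
  have := R.mul_mem ha (hx g)
  rwa [← add_sub_assoc] at this

theorem single_mem_grFree {m : ℤ} {a : R.carrier} (ha : a ∈ R.gr m) (g : Gen R.carrier) :
    Finsupp.single g a ∈ grFree R (m + g.deg) := by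
  classical
  intro h
  by_cases hg : g = h
  · subst hg; simpa using ha
  · simp [hg]

theorem smul_supported_mem {S : Set (Gen R.carrier)} (c : k) {x : Free R}
    (hx : x ∈ Finsupp.supported R.carrier R.carrier S) :
    c • x ∈ Finsupp.supported R.carrier R.carrier S := by
  rw [← one_smul R.carrier x, ← smul_assoc]
  exact Submodule.smul_mem _ _ hx

variable (R) in
/-- The sets of generators that span an honest complex, with generators of degree `≥ 0`, whose
cocycles of degree `0` are the multiples of the generator `one`. -/
structure Good (S : Set (Gen R.carrier)) : Prop where
  one_mem : Gen.one ∈ S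
  deg_nonneg : ∀ g ∈ S, 0 ≤ g.deg
  boundary_supported : ∀ g ∈ S, g.boundary ∈ Finsupp.supported R.carrier R.carrier S
  boundary_mem : ∀ g ∈ S, g.boundary ∈ grFree R (g.deg + 1)
  diff_boundary : ∀ g ∈ S, diff R g.boundary = 0
  cocycle_zero : ∀ x ∈ Finsupp.supported R.carrier R.carrier S, x ∈ grFree R 0 → diff R x = 0 →
    ∃ c : k, x = Finsupp.single Gen.one (algebraMap k R.carrier c)

section Good

variable {S : Set (Gen R.carrier)}

/-- An induction principle for the submodule spanned by a set of generators. -/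
theorem supported_induction {T : Submodule k (Free R)}
    (h : ∀ g ∈ S, ∀ m, ∀ a ∈ R.gr m, Finsupp.single g a ∈ T) {x : Free R}
    (hx : x ∈ Finsupp.supported R.carrier R.carrier S) : x ∈ T := by
  rw [← x.sum_single]
  refine Submodule.sum_mem _ fun g hg => ?_
  refine mem_of_pr_mem R.gr (S := T.comap (Finsupp.lsingle g : R.carrier →ₗ[k] Free R)) fun m => ?_
  exact h g (hx hg) m _ (pr_mem _ _ _)

theorem Good.diff_supported (hS : Good R S) {x : Free R}
    (hx : x ∈ Finsupp.supported R.carrier R.carrier S) :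
    diff R x ∈ Finsupp.supported R.carrier R.carrier S := by
  refine supported_induction (T := ((Finsupp.supported R.carrier R.carrier S).restrictScalars
    k).comap (diff R)) (fun g hg m a _ => ?_) hx
  change diff R (Finsupp.single g a) ∈ Finsupp.supported R.carrier R.carrier S
  rw [diff_single]
  exact Submodule.add_mem _ (Finsupp.single_mem_supported _ _ hg)
    (Submodule.smul_mem _ _ (hS.boundary_supported g hg))

theorem Good.diff_diff (hS : Good R S) {x : Free R}
    (hx : x ∈ Finsupp.supported R.carrier R.carrier S) : diff R (diff R x) = 0 := by
  refine supported_induction (T := LinearMap.ker (diff R ∘ₗ diff R)) (fun g hg m a _ => ?_) hx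
  change diff R (diff R (Finsupp.single g a)) = 0
  rw [diff_single, map_add, diff_single, diff_smul, hS.diff_boundary g hg, R.d_d, R.d_inv]
  simp

theorem Good.diff_mem (hS : Good R S) {n : ℤ} {x : Free R}
    (hx : x ∈ Finsupp.supported R.carrier R.carrier S) (hxn : x ∈ grFree R n) :
    diff R x ∈ grFree R (n + 1) := by
  rw [← x.sum_single, Finsupp.sum, map_sum]
  refine Submodule.sum_mem _ fun g hg => ?_
  rw [diff_single]
  refine Submodule.add_mem _ ?_ ?_
  · have := single_mem_grFree (R.d_mem (hxn g)) g
    rwa [show n - g.deg + 1 + g.deg = n + 1 by ring] at this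
  · have := smul_mem_grFree (invol_mem R.gr (hxn g)) (hS.boundary_mem g (hx hg))
    rwa [show n - g.deg + (g.deg + 1) = n + 1 by ring] at this

end Good

theorem boundary_one : (Gen.one : Gen R.carrier).boundary = 0 := rfl

theorem good_singleton (h0 : ∀ x ∈ R.gr 0, R.d x = 0 → ∃ c : k, x = algebraMap k R.carrier c) :
    Good R {Gen.one} where
  one_mem := rfl
  deg_nonneg := by rintro g rfl; exact le_rfl
  boundary_supported := by rintro g rfl; exact Submodule.zero_mem _
  boundary_mem := by rintro g rfl; exact Submodule.zero_mem _
  diff_boundary := by rintro g rfl; rw [boundary_one, map_zero]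
  cocycle_zero := by
    intro x hx hx0 hdx
    obtain ⟨a, rfl⟩ : ∃ a, x = Finsupp.single Gen.one a := by
      refine ⟨x Gen.one, Finsupp.ext fun g => ?_⟩
      by_cases hg : g = Gen.one
      · subst hg; simp
      · rw [Finsupp.single_eq_of_ne hg]
        exact Finsupp.notMem_support_iff.1 fun h => hg (hx h)
    rw [diff_single, boundary_one, smul_zero, add_zero, Finsupp.single_eq_zero] at hdx
    have := hx0 Gen.one
    rw [Finsupp.single_eq_same] at this
    obtain ⟨c, rfl⟩ := h0 a this hdx
    exact ⟨c, rfl⟩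

theorem good_sUnion {c : Set (Set (Gen R.carrier))} (hc : ∀ S ∈ c, Good R S)
    (hch : IsChain (· ⊆ ·) c) (hne : c.Nonempty) : Good R (⋃₀ c) := by
  have hmono : ∀ {S}, S ∈ c → Finsupp.supported R.carrier R.carrier S ≤
      Finsupp.supported R.carrier R.carrier (⋃₀ c) := fun hS =>
    Finsupp.supported_mono (Set.subset_sUnion_of_mem hS)
  refine ⟨?_, ?_, ?_, ?_, ?_, fun x hx hx0 hdx => ?_⟩
  · obtain ⟨S, hS⟩ := hne
    exact ⟨S, hS, (hc S hS).one_mem⟩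
  · rintro g ⟨S, hS, hg⟩; exact (hc S hS).deg_nonneg g hg
  · rintro g ⟨S, hS, hg⟩; exact hmono hS ((hc S hS).boundary_supported g hg)
  · rintro g ⟨S, hS, hg⟩; exact (hc S hS).boundary_mem g hg
  · rintro g ⟨S, hS, hg⟩; exact (hc S hS).diff_boundary g hg
  · have hx' : (x.support : Set (Gen R.carrier)) ⊆ ⋃ S ∈ c, S := by
      rw [← Set.sUnion_eq_biUnion]; exact hx
    obtain ⟨S, hS, hxS⟩ :=
      hch.directedOn.exists_mem_subset_of_finset_subset_biUnion (f := id) hne hx'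
    exact (hc S hS).cocycle_zero x hxS hx0 hdx

/-- Adjoining a generator `g` that kills a class which is not yet zero keeps a set good. -/
theorem good_insert {S : Set (Gen R.carrier)} (hS : Good R S) (hpos : R.IsNonneg)
    (h0 : ∀ x ∈ R.gr 0, R.d x = 0 → ∃ c : k, x = algebraMap k R.carrier c) {g : Gen R.carrier}
    (hg : 0 ≤ g.deg) (hgS : g.boundary ∈ Finsupp.supported R.carrier R.carrier S)
    (hgm : g.boundary ∈ grFree R (g.deg + 1)) (hgd : diff R g.boundary = 0)
    (hne : ∀ y ∈ Finsupp.supported R.carrier R.carrier S, diff R y ≠ g.boundary) :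
    Good R (insert g S) := by
  have hmono : Finsupp.supported R.carrier R.carrier S ≤
      Finsupp.supported R.carrier R.carrier (insert g S) :=
    Finsupp.supported_mono (Set.subset_insert g S)
  have hgn : g ∉ S := fun h => hne _ (Finsupp.single_mem_supported _ (1 : R.carrier) h)
    (diff_single_one R g)
  have h0S : ∀ x ∈ Finsupp.supported R.carrier R.carrier S, x g = 0 := fun x hx =>
    Finsupp.notMem_support_iff.1 fun h => hgn (hx h)
  refine ⟨Or.inr hS.one_mem, ?_, ?_, ?_, ?_, fun x hx hx0 hdx => ?_⟩
  · rintro h (rfl | hh)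
    · exact hg
    · exact hS.deg_nonneg h hh
  · rintro h (rfl | hh)
    · exact hmono hgS
    · exact hmono (hS.boundary_supported h hh)
  · rintro h (rfl | hh)
    · exact hgm
    · exact hS.boundary_mem h hh
  · rintro h (rfl | hh)
    · exact hgd
    · exact hS.diff_boundary h hh
  · -- the coefficient of `g` in a cocycle of degree `0` is a scalar, and hence vanishes
    have hx' : x - Finsupp.single g (x g) ∈ Finsupp.supported R.carrier R.carrier S := by
      intro h hh
      have hh' := Finsupp.mem_support_iff.1 hh
      have hhg : h ≠ g := by
        rintro rfl
        simp at hh'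
      have : h ∈ insert g S := hx (Finsupp.mem_support_iff.2 fun h1 => hh' (by simp [h1, hhg]))
      exact this.resolve_left hhg
    have hdx' : diff R (x - Finsupp.single g (x g)) + (Finsupp.single g (R.d (x g)) +
        R.inv (x g) • g.boundary) = 0 := by
      rw [← diff_single, ← map_add, sub_add_cancel, hdx]
    have hdg : R.d (x g) = 0 := by
      have := DFunLike.congr_fun hdx' g
      rw [Finsupp.add_apply, Finsupp.add_apply, h0S _ (hS.diff_supported hx'),
        Finsupp.smul_apply, h0S _ hgS] at this
      simpa using this
    have hxg : x g = 0 := by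
      rcases hg.lt_or_eq with hlt | heq
      · exact R.eq_zero_of_mem_neg hpos (by omega) (hx0 g)
      · have hm := hx0 g
        rw [← heq, sub_zero] at hm
        obtain ⟨c, hc⟩ := h0 _ hm hdg
        by_contra hne0
        have hc0 : c ≠ 0 := by
          rintro rfl
          exact hne0 (by rw [hc, map_zero])
        refine hne (-c⁻¹ • (x - Finsupp.single g (x g))) (smul_supported_mem _ hx') ?_
        rw [hdg, Finsupp.single_zero, zero_add, invol_of_mem_zero R.gr hm, hc,
          algebraMap_smul, ← hc] at hdx'
        rw [map_smul, eq_neg_of_add_eq_zero_left hdx', neg_smul_neg, smul_smul,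
          inv_mul_cancel₀ hc0, one_smul]
    refine hS.cocycle_zero x ?_ hx0 hdx
    rwa [hxg, Finsupp.single_zero, sub_zero] at hx'

/-- There is a good set of generators whose span has no cohomology in degrees other than `0`: a
maximal one, since a cocycle that is not a coboundary would be the boundary of a new generator. -/
theorem exists_good (hpos : R.IsNonneg)
    (h0 : ∀ x ∈ R.gr 0, R.d x = 0 → ∃ c : k, x = algebraMap k R.carrier c) :
    ∃ S, Good R S ∧ ∀ n ≠ 0, ∀ x ∈ Finsupp.supported R.carrier R.carrier S, x ∈ grFree R n →
      diff R x = 0 → ∃ y ∈ Finsupp.supported R.carrier R.carrier S, diff R y = x := by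
  obtain ⟨S, -, hS⟩ := zorn_subset_nonempty {S | Good R S}
    (fun c hc hch hne => ⟨⋃₀ c, good_sUnion hc hch hne, fun s hs => Set.subset_sUnion_of_mem hs⟩)
    _ (good_singleton h0)
  have hgood : Good R S := hS.prop
  refine ⟨S, hgood, fun n hn x hx hxn hdx => ?_⟩
  rcases hn.lt_or_gt with h | h
  · refine ⟨0, Submodule.zero_mem _, ?_⟩
    rw [map_zero]
    refine Finsupp.ext fun g => ?_
    by_cases hg : g ∈ S
    · exact (R.eq_zero_of_mem_neg hpos (by have := hgood.deg_nonneg g hg; omega) (hxn g)).symm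
    · exact (Finsupp.notMem_support_iff.1 fun h => hg (hx h)).symm
  · by_contra hne
    push Not at hne
    obtain ⟨g, hg, rfl⟩ := Gen.exists_boundary_eq (n - 1) x
    have := good_insert hgood hpos h0 (g := g) (by omega) hx
      (by rwa [hg, sub_add_cancel]) hdx hne
    have hgS : g ∈ S := hS.le_of_ge this (Set.subset_insert g S) (Set.mem_insert g S)
    exact hne _ (Finsupp.single_mem_supported _ (1 : R.carrier) hgS) (diff_single_one R g)

end Resolution

end

section

variable {k : Type u} [Field k]

/-! ### The resolution spanned by a good set of generators -/

/-- A morphism to the base field sees only the component of degree `0`. -/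
theorem DGModule.Hom.map_pr_zero {R : AugCDGA.{u, v} k} {M : DGModule.{u, v, w} R}
    (f : M.Hom (base R)) (x : M.carrier) : f.toFun (pr M.gr 0 x) = f.toFun x := by
  have : (f.toFun.restrictScalars k) ∘ₗ pr M.gr 0 = f.toFun.restrictScalars k := by
    refine eq_of_homogeneous M.gr fun i z hz => ?_
    by_cases hi : i = 0
    · subst hi; rw [LinearMap.comp_apply, pr_same _ hz]
    · rw [LinearMap.comp_apply, pr_ne _ hz hi, map_zero]
      have : f.toFun z ∈ grBase k i := f.map_mem hz
      rw [grBase, if_neg hi] at this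
      exact this.symm
  exact LinearMap.congr_fun this x

namespace Resolution

variable {R : AugCDGA.{u, v} k} {S : Set (Gen R.carrier)}

variable (S) in
/-- The module spanned by a set of generators. -/
def Span : Type v := Finsupp.supported R.carrier R.carrier S

noncomputable instance : AddCommGroup (Span S) :=
  inferInstanceAs (AddCommGroup (Finsupp.supported R.carrier R.carrier S))

noncomputable instance : Module R.carrier (Span S) :=
  inferInstanceAs (Module R.carrier (Finsupp.supported R.carrier R.carrier S))

noncomputable instance : Module k (Span S) :=
  inferInstanceAs (Module k ((Finsupp.supported R.carrier R.carrier S).restrictScalars k))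

instance : IsScalarTower k R.carrier (Span S) :=
  inferInstanceAs (IsScalarTower k R.carrier (Finsupp.supported R.carrier R.carrier S))

variable (S) in
/-- The inclusion into the free module on all generators. -/
noncomputable def incl : Span S →ₗ[R.carrier] Free R :=
  (Finsupp.supported R.carrier R.carrier S).subtype

variable (S) in
/-- The grading of the module spanned by a set of generators. -/
noncomputable def gr (n : ℤ) : Submodule k (Span S) :=
  (grFree R n).comap ((incl S).restrictScalars k)

theorem incl_injective : Function.Injective (incl S) := Subtype.val_injective

theorem incl_mem (x : Span S) : incl S x ∈ Finsupp.supported R.carrier R.carrier S :=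
  Subtype.property (p := (· ∈ _)) x

theorem exists_incl_eq {x : Free R} (hx : x ∈ Finsupp.supported R.carrier R.carrier S) :
    ∃ y, incl S y = x := ⟨⟨x, hx⟩, rfl⟩

theorem mem_gr {n : ℤ} {x : Span S} : x ∈ gr S n ↔ ∀ g, incl S x g ∈ R.gr (n - g.deg) := Iff.rfl

theorem isInternal_gr : DirectSum.IsInternal (gr S) := by
  let π : ℤ → Gen R.carrier → Span S →ₗ[k] R.carrier := fun i g =>
    pr R.gr (i - g.deg) ∘ₗ Finsupp.lapply g ∘ₗ (incl S).restrictScalars k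
  have hπ : ∀ i g x, π i g x = pr R.gr (i - g.deg) (incl S x g) :=
    fun i g x => rfl
  refine isInternal_of_ker (gr S) (fun i => ⨅ g, LinearMap.ker (π i g)) ?_ ?_ ?_
  · intro i j hij x hx
    refine (Submodule.mem_iInf _).2 fun g => ?_
    rw [LinearMap.mem_ker, hπ]
    exact pr_ne R.gr (mem_gr.1 hx g) (by omega)
  · intro i x hx hx'
    refine incl_injective (Finsupp.ext fun g => ?_)
    have := (Submodule.mem_iInf _).1 hx' g
    rwa [LinearMap.mem_ker, hπ, pr_same R.gr (mem_gr.1 hx g)] at this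
  · rw [eq_top_iff]
    rintro x -
    have : incl S x ∈ (⨆ i, gr S i).map ((incl S).restrictScalars k) := by
      refine supported_induction (S := S) (fun g hg m a ha => ?_) (incl_mem x)
      obtain ⟨y, hy⟩ := exists_incl_eq (Finsupp.single_mem_supported R.carrier a hg)
      refine ⟨y, Submodule.mem_iSup_of_mem (m + g.deg) ?_, hy⟩
      rw [gr, Submodule.mem_comap, LinearMap.restrictScalars_apply, hy]
      exact single_mem_grFree ha g
    obtain ⟨y, hy, hyx⟩ := this
    exact incl_injective hyx ▸ hy

noncomputable instance : DirectSum.Decomposition (gr S) := isInternal_gr.chooseDecomposition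

/-- The differential of the module spanned by a good set of generators. -/
noncomputable def spanDiff (hS : Good R S) : Span S →ₗ[k] Span S where
  toFun x := ⟨diff R (incl S x), hS.diff_supported (incl_mem x)⟩
  map_add' x y := incl_injective (by
    change diff R (incl S (x + y)) = diff R (incl S x) + diff R (incl S y)
    rw [map_add, map_add])
  map_smul' c x := incl_injective (by
    change diff R ((incl S).restrictScalars k (c • x)) = c • diff R (incl S x)
    rw [map_smul, map_smul]
    rfl)

theorem incl_spanDiff (hS : Good R S) (x : Span S) : incl S (spanDiff hS x) = diff R (incl S x) :=
  rfl

/-- The complex spanned by a good set of generators. -/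
noncomputable def module (hS : Good R S) : DGModule.{u, v, v} R where
  carrier := Span S
  gr := gr S
  smul_mem {_ _ a x} ha hx := by
    change incl S (a • x) ∈ grFree R _
    rw [map_smul]
    exact smul_mem_grFree ha hx
  d := spanDiff hS
  d_mem {_ x} hx := hS.diff_mem (incl_mem x) hx
  d_d x := incl_injective (by
    rw [incl_spanDiff, incl_spanDiff, hS.diff_diff (incl_mem x), map_zero])
  leibniz {m a} ha x := incl_injective (by
    have h : incl S ((-1 : k) ^ m • a • spanDiff hS x) =
        (-1 : k) ^ m • incl S (a • spanDiff hS x) :=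
      map_smul ((incl S).restrictScalars k) _ _
    rw [incl_spanDiff, map_smul, diff_smul, map_add, h, map_smul, map_smul, incl_spanDiff,
      invol_of_mem R.gr ha, smul_assoc])

/-- The inclusion of the complex into the free module on all generators. -/
noncomputable def val (hS : Good R S) : (module hS).carrier →ₗ[R.carrier] Free R := incl S

theorem val_injective (hS : Good R S) : Function.Injective (val hS) := incl_injective

theorem val_mem (hS : Good R S) (x : (module hS).carrier) :
    val hS x ∈ Finsupp.supported R.carrier R.carrier S := incl_mem (S := S) x

theorem exists_val_eq (hS : Good R S) {x : Free R}
    (hx : x ∈ Finsupp.supported R.carrier R.carrier S) : ∃ y, val hS y = x := exists_incl_eq hx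

theorem val_d (hS : Good R S) (x : (module hS).carrier) :
    val hS ((module hS).d x) = diff R (val hS x) := rfl

theorem mem_module_gr (hS : Good R S) {n : ℤ} {x : (module hS).carrier} :
    x ∈ (module hS).gr n ↔ val hS x ∈ grFree R n := Iff.rfl

/-- The generators as a basis. -/
noncomputable def basis (hS : Good R S) : Module.Basis S R.carrier (module hS).carrier :=
  Module.Basis.ofRepr (M := Span S) (Finsupp.supportedEquivFinsupp S)

theorem val_basis (hS : Good R S) (g : S) : val hS (basis hS g) = Finsupp.single g.1 1 := by
  classical
  exact Finsupp.supportedEquivFinsupp_symm_single (R := R.carrier) S g (1 : R.carrier)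

theorem repr_apply (hS : Good R S) (x : (module hS).carrier) (g : S) :
    (basis hS).repr x g = val hS x g.1 := rfl

theorem basis_mem (hS : Good R S) (g : S) : basis hS g ∈ (module hS).gr g.1.deg := by
  rw [mem_module_gr, val_basis]
  simpa using single_mem_grFree R.one_mem g.1

theorem val_d_basis (hS : Good R S) (g : S) :
    val hS ((module hS).d (basis hS g)) = g.1.boundary := by
  rw [val_d, val_basis, diff_single_one]

theorem d_basis_mem (hS : Good R S) (g : S) : (module hS).d (basis hS g) ∈
    Submodule.span R.carrier (basis hS '' {h | h.1.level < g.1.level}) := by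
  refine (basis hS).mem_span_image.2 fun h hh => ?_
  rw [Finset.mem_coe, Finsupp.mem_support_iff, repr_apply, val_d_basis] at hh
  exact Gen.level_lt_of_boundary_ne_zero hh

theorem aug_boundary (hS : Good R S) {g : Gen R.carrier} (hg : g ∈ S) :
    R.aug (g.boundary Gen.one) = 0 := by
  have h := hS.boundary_mem g hg Gen.one
  have h' := hS.deg_nonneg g hg
  exact R.aug_of_mem h (by change g.deg + 1 - 0 ≠ 0; omega)

theorem aug_diff (hS : Good R S) {x : Free R}
    (hx : x ∈ Finsupp.supported R.carrier R.carrier S) : R.aug (diff R x Gen.one) = 0 := by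
  refine supported_induction (T := LinearMap.ker (R.aug.toLinearMap ∘ₗ
    Finsupp.lapply Gen.one ∘ₗ diff R)) (fun g hg m a _ => ?_) hx
  change R.aug (diff R (Finsupp.single g a) Gen.one) = 0
  rw [diff_single, Finsupp.add_apply, map_add, Finsupp.smul_apply, smul_eq_mul, map_mul,
    aug_boundary hS hg, mul_zero, add_zero]
  by_cases h : g = Gen.one
  · subst h; rw [Finsupp.single_eq_same, R.aug_d]
  · rw [Finsupp.single_eq_of_ne (Ne.symm h), map_zero]

/-- The augmentation of the complex spanned by a good set: the coefficient of `one`. -/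
noncomputable def augmentation (hS : Good R S) : (module hS).Hom (base R) where
  toFun :=
    { toFun := fun x => (R.aug (val hS x Gen.one) : k)
      map_add' := fun x y => map_add R.aug (val hS x Gen.one) (val hS y Gen.one)
      map_smul' := fun a x => map_mul R.aug a (val hS x Gen.one) }
  map_mem := by
    intro n x hx
    have h : val hS x Gen.one ∈ R.gr (n - 0) := hx Gen.one
    change R.aug (val hS x Gen.one) ∈ grBase k n
    rw [grBase]
    split_ifs with hn
    · trivial
    · exact R.aug_of_mem h (by omega)
  map_d x := aug_diff hS (val_mem hS x)

theorem augmentation_pr_zero (hS : Good R S) (x : (module hS).carrier) :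
    R.aug (val hS (pr (module hS).gr 0 x) Gen.one) = R.aug (val hS x Gen.one) :=
  (augmentation hS).map_pr_zero x

theorem augmentation_isQuasiIso (hS : Good R S)
    (hac : ∀ n ≠ 0, ∀ x ∈ Finsupp.supported R.carrier R.carrier S, x ∈ grFree R n →
      diff R x = 0 → ∃ y ∈ Finsupp.supported R.carrier R.carrier S, diff R y = x) :
    (augmentation hS).IsQuasiIso := by
  refine ⟨fun x hx => ?_, fun (y : k) _ => ?_⟩
  · rintro ⟨y, hy⟩
    have hx0 : R.aug (val hS x Gen.one) = 0 := hy.symm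
    refine mem_of_pr_mem (module hS).gr (S := LinearMap.range (module hS).d) fun n => ?_
    have hdn : diff R (val hS (pr (module hS).gr n x)) = 0 := by
      rw [← val_d, ← DGModule.pr_d, hx, map_zero, map_zero]
    have hn := pr_mem (module hS).gr n x
    by_cases h : n = 0
    · subst h
      obtain ⟨c, hc⟩ := hS.cocycle_zero _ (val_mem hS _) hn hdn
      have h1 := augmentation_pr_zero hS x
      rw [hx0, hc, Finsupp.single_eq_same, AlgHom.commutes, Algebra.algebraMap_self_apply] at h1
      refine ⟨0, val_injective hS ?_⟩
      rw [hc, h1, map_zero, map_zero, map_zero, Finsupp.single_zero]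
    · obtain ⟨y, hyS, hy⟩ := hac n h _ (val_mem hS _) hn hdn
      obtain ⟨y, rfl⟩ := exists_val_eq hS hyS
      exact ⟨y, val_injective hS hy⟩
  · obtain ⟨x, hx⟩ := exists_val_eq hS (Finsupp.single_mem_supported R.carrier
      (algebraMap k R.carrier y) hS.one_mem)
    refine ⟨x, val_injective hS ?_, 0, ?_⟩
    · rw [val_d, map_zero, hx, diff_single, boundary_one, smul_zero, add_zero,
        Algebra.algebraMap_eq_smul_one, map_smul, R.d_one, smul_zero, Finsupp.single_zero]
    · change (0 : k) = y - R.aug (val hS x Gen.one)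
      rw [hx, Finsupp.single_eq_same, AlgHom.commutes]
      exact (sub_self y).symm

end Resolution

/-- A connected augmented algebra in degrees `≥ 0` has a semifree resolution of the base field on
generators of degree `≥ 0`, one of which is a cocycle of degree `0` that maps to `1`. -/
theorem exists_nonneg_resolution {R : AugCDGA.{u, v} k} (hpos : R.IsNonneg)
    (h0 : ∀ x ∈ R.gr 0, R.d x = 0 → ∃ c : k, x = algebraMap k R.carrier c) :
    ∃ (P : SemifreeResolution.{u, v, v, u} (base R)) (ι : Type v)
      (b : Module.Basis ι R.carrier P.P.carrier) (deg : ι → ℤ) (level : ι → ℕ) (i₀ : ι),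
      (∀ i, b i ∈ P.P.gr (deg i)) ∧
      (∀ i, P.P.d (b i) ∈ Submodule.span R.carrier (b '' {j | level j < level i})) ∧
      (∀ i, 0 ≤ deg i) ∧ P.P.d (b i₀) = 0 ∧ deg i₀ = 0 ∧ P.map.toFun (b i₀) = (1 : k) := by
  obtain ⟨S, hS, hac⟩ := Resolution.exists_good hpos h0
  refine ⟨⟨Resolution.module hS, ⟨S, Resolution.basis hS, fun g => g.1.deg, fun g => g.1.level,
    Resolution.basis_mem hS, Resolution.d_basis_mem hS⟩, Resolution.augmentation hS,
    Resolution.augmentation_isQuasiIso hS hac⟩, S, Resolution.basis hS, fun g => g.1.deg,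
    fun g => g.1.level, ⟨Gen.one, hS.one_mem⟩, Resolution.basis_mem hS, Resolution.d_basis_mem hS,
    fun g => hS.deg_nonneg _ g.2, ?_, rfl, ?_⟩
  · refine Resolution.val_injective hS ?_
    rw [Resolution.val_d_basis, map_zero]
    rfl
  · change R.aug (Resolution.val hS (Resolution.basis hS _) Gen.one) = 1
    rw [Resolution.val_basis, Finsupp.single_eq_same, map_one]

end

section

variable {k : Type u} [Field k]

/-! ### One-dimensional cohomology -/

section Rank

variable {X : Type*} [AddCommGroup X] [Module k X] {d : X →ₗ[k] X}

theorem rank_homology_eq_one {v : X} (hv : d v = 0) (hne : ∀ s, d s ≠ v)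
    (hspan : ∀ t, d t = 0 → ∃ (c : k) (s : X), t = c • v + d s) :
    Module.rank k (Homology d) = 1 := by
  rw [rank_eq_one_iff]
  refine ⟨Submodule.Quotient.mk ⟨v, hv⟩, fun h => ?_, fun w => ?_⟩
  · obtain ⟨s, hs⟩ := (Submodule.Quotient.mk_eq_zero _).1 h
    exact hne s hs
  · obtain ⟨⟨t, ht⟩, rfl⟩ := Submodule.Quotient.mk_surjective _ w
    obtain ⟨c, s, hs⟩ := hspan t ht
    refine ⟨c, ?_⟩
    rw [← Submodule.Quotient.mk_smul]
    refine (Submodule.Quotient.eq _).2 ⟨-s, ?_⟩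
    change d (-s) = c • v - t
    rw [hs, map_neg]
    abel

theorem exists_eq_smul_add_of_rank_homology_eq_one (h : Module.rank k (Homology d) = 1) {v : X}
    (hv : d v = 0) (hne : ∀ s, d s ≠ v) (t : X) (ht : d t = 0) :
    ∃ (c : k) (s : X), t = c • v + d s := by
  have hv0 : (Submodule.Quotient.mk ⟨v, hv⟩ : Homology d) ≠ 0 := fun h => by
    obtain ⟨s, hs⟩ := (Submodule.Quotient.mk_eq_zero _).1 h
    exact hne s hs
  have hfin : Module.finrank k (Homology d) = 1 := by
    rw [Module.finrank, h, Cardinal.one_toNat]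
  obtain ⟨c, hc⟩ := (finrank_eq_one_iff_of_nonzero' _ hv0).1 hfin (Submodule.Quotient.mk ⟨t, ht⟩)
  rw [← Submodule.Quotient.mk_smul] at hc
  obtain ⟨s, hs⟩ := (Submodule.Quotient.eq _).1 hc
  refine ⟨c, -s, ?_⟩
  have hs' : d s = c • v - t := hs
  rw [map_neg, hs']
  abel

end Rank

variable {R : AugCDGA.{u, v} k}

/-- The cohomology of a resolution of `k` is spanned by the class of a cocycle of degree `0`. -/
theorem SemifreeResolution.exists_unit (P : SemifreeResolution.{u, v, w, u} (base R)) :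
    ∃ p ∈ P.P.gr 0, P.P.d p = 0 ∧ P.map.toFun p = (1 : k) := by
  obtain ⟨x, hx, z, hz⟩ := P.quasiIso.2 (1 : k) rfl
  refine ⟨pr P.P.gr 0 x, pr_mem _ _ _, ?_, ?_⟩
  · rw [← P.P.pr_d, hx, map_zero]
  · rw [P.map.map_pr_zero]
    exact (sub_eq_zero.1 hz.symm).symm

section Unit

variable (P : SemifreeResolution.{u, v, w, u} (base R)) {p : P.P.carrier}

theorem SemifreeResolution.d_ne_unit (hp : P.map.toFun p = (1 : k)) (y : P.P.carrier) :
    P.P.d y ≠ p := by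
  rintro rfl
  rw [P.map.map_d] at hp
  exact zero_ne_one (α := k) hp

theorem SemifreeResolution.exists_eq_smul_unit_add (hdp : P.P.d p = 0)
    (hp : P.map.toFun p = (1 : k)) (x : P.P.carrier) (hx : P.P.d x = 0) :
    ∃ (c : k) (y : P.P.carrier), x = c • p + P.P.d y := by
  let c : k := P.map.toFun x
  have hc : (P.map.toFun.restrictScalars k) (x - c • p) = (0 : k) := by
    rw [map_sub, map_smul]
    change @HSub.hSub k k k _ c (@HMul.hMul k k k _ c (P.map.toFun p)) = 0
    rw [hp, mul_one, sub_self]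
  obtain ⟨y, hy⟩ := P.quasiIso.1 (x - c • p) (by rw [map_sub, hx, map_smul, hdp]; simp)
    ⟨(0 : k), hc.symm⟩
  exact ⟨c, y, by rw [hy]; abel⟩

end Unit

/-! ### Cocycles of the graded dual -/

section DualCocycles

theorem AugCDGA.pr_inv (i : ℤ) (x : R.carrier) : pr R.gr i (R.inv x) = R.inv (pr R.gr i x) := by
  have := pr_map R.gr R.gr (e := 0) (f := R.inv) (fun i x hx => by
    rw [add_zero]; exact invol_mem R.gr hx) i x
  rwa [add_zero] at this

theorem Dual.totalDiff_apply (f : Dual.Total R) (x : R.carrier) :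
    (Dual.totalDiff f).val x = f.val (R.d (R.inv x)) := rfl

theorem Dual.apply_d {f : Dual.Total R} (hf : Dual.totalDiff f = 0) (x : R.carrier) :
    f.val (R.d x) = 0 := by
  have h := Dual.totalDiff_apply f (R.inv x)
  rw [hf, R.inv_inv, map_zero] at h
  exact h.symm

/-- The element of the graded dual given by a homogeneous functional. -/
theorem Dual.exists_val_eq {n : ℤ} {f : R.carrier →ₗ[k] k}
    (hf : ∀ m, m ≠ -n → ∀ x ∈ R.gr m, f x = 0) : ∃ F ∈ Dual.gr R n, F.val = f :=
  ⟨⟨f, Dual.deg_le_total n hf⟩, hf, rfl⟩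

/-- The part of a functional that lives in one degree, as an element of the graded dual. -/
theorem Dual.exists_val_eq_comp_pr (f : R.carrier →ₗ[k] k) (n : ℤ) :
    ∃ F ∈ Dual.gr R (-n), F.val = f ∘ₗ pr R.gr n :=
  Dual.exists_val_eq fun m hm x hx => by
    rw [LinearMap.comp_apply, pr_ne R.gr hx (by omega), map_zero]

theorem Dual.apply_pr {n : ℤ} {f : Dual.Total R} (hf : f ∈ Dual.gr R (-n)) (x : R.carrier) :
    f.val (pr R.gr n x) = f.val x := by
  have : f.val ∘ₗ pr R.gr n = f.val := eq_of_homogeneous R.gr fun j x hx => by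
    rw [LinearMap.comp_apply]
    by_cases h : j = n
    · subst h; rw [pr_same R.gr hx]
    · rw [pr_ne R.gr hx h, map_zero, hf j (by omega) x hx]
  exact LinearMap.congr_fun this x

/-- A homogeneous functional that vanishes on cocycles is a coboundary of the graded dual. -/
theorem Dual.exists_totalDiff_eq {n : ℤ} {f : Dual.Total R} (hf : f ∈ Dual.gr R (-n))
    (h : ∀ x ∈ R.gr n, R.d x = 0 → f.val x = 0) : ∃ g, Dual.totalDiff g = f := by
  obtain ⟨g, hg⟩ := exists_functional_comp_eq (R.d ∘ₗ R.inv) f.val (by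
    intro x hx
    rw [← Dual.apply_pr hf]
    refine h _ (pr_mem _ _ _) ?_
    rw [← R.pr_d]
    rw [LinearMap.comp_apply, R.d_inv, neg_eq_zero] at hx
    rw [← R.inv_inv (R.d x), hx, map_zero, map_zero])
  obtain ⟨G, -, hG⟩ := Dual.exists_val_eq_comp_pr g (n + 1)
  refine ⟨G, Dual.Total.hext fun x => ?_⟩
  rw [Dual.totalDiff_apply, hG, LinearMap.comp_apply, R.pr_d, R.pr_inv]
  rw [← Dual.apply_pr hf, ← hg]
  rfl

end DualCocycles

end

section

variable {k : Type u} [Field k] {R : AugCDGA.{u, v} k}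

/-! ### One-dimensional `Tor` and dualizing cocycles -/

variable (R) in
/-- Some cocycle `ω` of `Hom(R)` is dualizing: `a ↦ a ω` is a quasi-isomorphism `R → Hom(R)` up to
a shift, i.e. its mapping cone is acyclic. -/
def HasDualizingCocycle : Prop :=
  ∃ (e : ℤ) (ω : (dual R).carrier) (hω : ω ∈ (dual R).gr e) (hd : (dual R).d ω = 0),
    (adjoinCell (dual R) hω hd).Acyclic

/-- If `R` has a dualizing cocycle, then `Tor^R(k, Hom(R))` is the shifted `Tor^R(k, R) = k`. -/
theorem HasDualizingCocycle.dimTEq_one (hpos : R.IsNonneg)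
    (h0 : ∀ x ∈ R.gr 0, R.d x = 0 → ∃ c : k, x = algebraMap k R.carrier c)
    (h : HasDualizingCocycle R) : R.DimTEq 1 := by
  obtain ⟨e, ω, hω, hd, hK⟩ := h
  refine ⟨?_, fun P => ?_⟩
  · obtain ⟨P, -⟩ := exists_nonneg_resolution hpos h0
    exact ⟨P⟩
  · obtain ⟨p, hp, hdp, hp1⟩ := P.exists_unit
    obtain ⟨h1, h2⟩ := (tensor_adjoinCell_acyclic_iff (dual R) hω hd P.semifree hp hdp
      (P.exists_eq_smul_unit_add hdp hp1) (P.d_ne_unit hp1)).1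
      (tensor_acyclic _ P.semifree hK)
    have := rank_homology_eq_one (d := tensorDiff P.P (dual R)) (v := tmk P.P (dual R) p ω)
      (by rw [tensorDiff_tmk, hdp, hd]; simp) h1 h2
    simpa using this

/-- The top degree of the cohomology of `R`. -/
theorem exists_top_degree {N : ℤ} (hN : ∀ i > N, ∀ x ∈ R.gr i, R.d x = 0 → ∃ y, R.d y = x) :
    ∃ n, (∃ z ∈ R.gr n, R.d z = 0 ∧ ∀ y, R.d y ≠ z) ∧
      ∀ i > n, ∀ x ∈ R.gr i, R.d x = 0 → ∃ y, R.d y = x := by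
  obtain ⟨n, hn, hmax⟩ := Int.exists_greatest_of_bdd
    (P := fun n => ∃ z ∈ R.gr n, R.d z = 0 ∧ ∀ y, R.d y ≠ z)
    ⟨N, fun i ⟨z, hz, hdz, hne⟩ => by
      by_contra h
      obtain ⟨y, hy⟩ := hN i (by omega) z hz hdz
      exact hne y hy⟩
    ⟨0, 1, R.one_mem, R.d_one, fun y hy => by
      have := R.aug_d y
      rw [hy, map_one] at this
      exact one_ne_zero this⟩
  refine ⟨n, hn, fun i hi x hx hdx => ?_⟩
  by_contra hne
  push Not at hne
  have := hmax i ⟨x, hx, hdx, hne⟩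
  omega

/-- If `Tor^R(k, Hom(R))` is one-dimensional, then a cocycle `ω` of minimal degree of `Hom(R)` is
dualizing: its class spans the `Tor`, so that `P ⊗_R` the cone of `a ↦ a ω` is acyclic, and by
detection the cone has no cohomology in a minimal degree. -/
theorem hasDualizingCocycle_of_dimTEq_one (hpos : R.IsNonneg)
    (h0 : ∀ x ∈ R.gr 0, R.d x = 0 → ∃ c : k, x = algebraMap k R.carrier c) {N : ℤ}
    (hN : ∀ i > N, ∀ x ∈ R.gr i, R.d x = 0 → ∃ y, R.d y = x) (h : R.DimTEq 1) :
    HasDualizingCocycle R := by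
  obtain ⟨P, ι, b, deg, level, i₀, hb, hd, hdeg, hdi₀, hdeg₀, hi₀⟩ :=
    exists_nonneg_resolution hpos h0
  obtain ⟨n, ⟨z, hz, hdz, hzne⟩, hmax⟩ := exists_top_degree hN
  -- `-n` is the lowest degree in which `Hom(R)` has cohomology, and `ω` is a nonzero class there
  have hdual : ∀ j < -n, ∀ f ∈ (dual R).gr j, (dual R).d f = 0 → ∃ g, (dual R).d g = f := by
    intro j hj f hf hdf
    have hf' : f ∈ Dual.gr R (-(-j)) := by rwa [neg_neg]
    refine Dual.exists_totalDiff_eq hf' fun x hx hdx => ?_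
    obtain ⟨y, rfl⟩ := hmax (-j) (by omega) x hx hdx
    exact Dual.apply_d hdf y
  obtain ⟨ω, hω, hdω, hωne⟩ : ∃ ω ∈ (dual R).gr (-n), (dual R).d ω = 0 ∧
      ∀ g, (dual R).d g ≠ ω := by
    obtain ⟨f, hfz, hf⟩ := Submodule.exists_le_ker_of_notMem (p := LinearMap.range R.d) (v := z)
      (fun ⟨y, hy⟩ => hzne y hy)
    obtain ⟨ω, hω, hωf⟩ := Dual.exists_val_eq_comp_pr f n
    refine ⟨ω, hω, Dual.Total.hext fun x => ?_, fun g hg => hfz ?_⟩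
    · change (Dual.totalDiff ω).val x = 0
      rw [Dual.totalDiff_apply, hωf, LinearMap.comp_apply]
      have := R.pr_d (n - 1) (R.inv x)
      rw [sub_add_cancel] at this
      rw [this]
      exact hf ⟨_, rfl⟩
    · have h1 : ω.val z = Dual.Total.val (R := R) g (R.d (R.inv z)) := by rw [← hg]; rfl
      rw [R.d_inv, hdz, hωf, LinearMap.comp_apply, pr_same R.gr hz] at h1
      rw [h1]
      simp
  refine ⟨-n, ω, hω, hdω, ?_⟩
  have hspan := P.exists_eq_smul_unit_add hdi₀ hi₀
  -- by detection `b i₀ ⊗ ω` is not a coboundary, so that its class spans `Tor`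
  have hωT : ∀ s, tensorDiff P.P (dual R) s ≠ tmk P.P (dual R) (b i₀) ω := fun s hs => by
    obtain ⟨g, hg⟩ := exists_d_eq_of_basis_tmul b (dual R) hb hd hdeg hdi₀ hdeg₀ hdual hω hs
    exact hωne g hg
  have hrank : Module.rank k (Homology (tensorDiff P.P (dual R))) = 1 := by
    simpa using h.2 P
  have hac := (tensor_adjoinCell_acyclic_iff (dual R) hω hdω P.semifree (by
    have := hb i₀; rwa [hdeg₀] at this) hdi₀ hspan (P.d_ne_unit hi₀)).2
    ⟨hωT, exists_eq_smul_add_of_rank_homology_eq_one hrank (by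
      rw [tensorDiff_tmk, hdi₀, hdω]; simp) hωT⟩
  set K := adjoinCell (dual R) hω hdω with hK
  -- the cone has no cohomology below any degree `m`
  have key : ∀ m, -n - 1 ≤ m → ∀ j < m, ∀ x ∈ K.gr j, K.d x = 0 → ∃ y, K.d y = x := by
    intro m hm
    induction m, hm using Int.leInduction with
    | base =>
      -- in degrees below `-n - 1` the cone agrees with `Hom(R)`, as `R` starts in degree `0`
      rintro j hj ⟨c, r⟩ hx hdx
      obtain ⟨hc, hr⟩ := Cell.mem_gr.1 hx
      have hr0 : r = 0 := R.eq_zero_of_mem_neg hpos (by omega) hr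
      subst hr0
      have hdc : (dual R).d c = 0 := by
        have := congrArg Prod.fst hdx
        change (dual R).d c + R.inv 0 • ω = 0 at this
        simpa using this
      obtain ⟨g, hg⟩ := hdual j (by omega) c hc hdc
      exact ⟨cellInl (dual R) hω hdω g, (d_cellInl (dual R) hω hdω g).symm.trans
        (congrArg (cellInl (dual R) hω hdω) hg)⟩
    | succ m hm ih =>
      intro j hj x hx hdx
      rcases (Int.lt_add_one_iff.1 hj).lt_or_eq with hlt | rfl
      · exact ih j hlt x hx hdx
      · obtain ⟨s, hs⟩ := hac (tmk P.P K (b i₀) x) (by rw [tensorDiff_tmk, hdi₀, hdx]; simp)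
        exact exists_d_eq_of_basis_tmul b K hb hd hdeg hdi₀ hdeg₀ ih hx hs
  refine K.acyclic_of_homogeneous fun i x hx hdx => ?_
  exact key (max (i + 1) (-n - 1)) (le_max_right _ _) i (by
    have := le_max_left (i + 1) (-n - 1); omega) x hx hdx

/-! ### Duality in terms of a bilinear form -/

variable (R) in
/-- Duality on the level of cocycles: a functional `ω` of degree `-n` on `R` that vanishes on
coboundaries induces a perfect pairing `(z, y) ↦ ω (z y)` between the cohomology in degrees `i` and
`n - i`, for all `i`. -/
def HasPerfectPairing : Prop :=
  ∃ (n : ℤ) (ω : R.carrier →ₗ[k] k), (∀ m, m ≠ n → ∀ x ∈ R.gr m, ω x = 0) ∧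
    (∀ x, ω (R.d x) = 0) ∧
    (∀ i, ∀ z ∈ R.gr i, R.d z = 0 → (∀ y ∈ R.gr (n - i), R.d y = 0 → ω (z * y) = 0) →
      ∃ x, R.d x = z) ∧
    ∀ i, ∀ f : R.carrier →ₗ[k] k, (∀ x, f (R.d x) = 0) →
      ∃ z ∈ R.gr i, R.d z = 0 ∧ ∀ y ∈ R.gr (n - i), R.d y = 0 → ω (z * y) = f y

theorem Dual.totalDiff_smul (a : R.carrier) (f : Dual.Total R) :
    Dual.totalDiff (a • f) = R.d a • f + R.inv a • Dual.totalDiff f := (dual R).leibniz' a f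

theorem Dual.smul_mem_gr {m n : ℤ} {a : R.carrier} {f : Dual.Total R} (ha : a ∈ R.gr m)
    (hf : f ∈ Dual.gr R n) : a • f ∈ Dual.gr R (m + n) := (dual R).smul_mem ha hf

section DualCell

variable {e : ℤ} {ω : Dual.Total R} (hω : ω ∈ (dual R).gr e) (hd : (dual R).d ω = 0)

theorem exists_of_dualCell_acyclic (hK : (adjoinCell (dual R) hω hd).Acyclic) {c : Dual.Total R}
    {r : R.carrier} (hc : Dual.totalDiff c + R.inv r • ω = 0) (hr : R.d r = 0) :
    ∃ (c' : Dual.Total R) (r' : R.carrier),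
      Dual.totalDiff c' + R.inv r' • ω = c ∧ R.d r' = r := by
  obtain ⟨x, hx⟩ := hK ((c, r) : Dual.Total R × R.carrier) (Prod.ext hc hr)
  exact ⟨x.1, x.2, congrArg Prod.fst hx, congrArg Prod.snd hx⟩

theorem dualCell_acyclic (h : ∀ (i : ℤ) (c : Dual.Total R) (r : R.carrier), c ∈ Dual.gr R i →
    r ∈ R.gr (i + 1 - e) → Dual.totalDiff c + R.inv r • ω = 0 → R.d r = 0 →
    ∃ (c' : Dual.Total R) (r' : R.carrier), Dual.totalDiff c' + R.inv r' • ω = c ∧ R.d r' = r) :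
    (adjoinCell (dual R) hω hd).Acyclic := by
  refine DGModule.acyclic_of_homogeneous _ fun i x hx hdx => ?_
  obtain ⟨hc, hr⟩ := Cell.mem_gr.1 hx
  obtain ⟨c', r', h1, h2⟩ := h i x.1 x.2 hc hr (congrArg Prod.fst hdx) (congrArg Prod.snd hdx)
  exact ⟨((c', r') : Dual.Total R × R.carrier), Prod.ext h1 h2⟩

end DualCell

theorem Dual.inv_smul_apply (r : R.carrier) (f : Dual.Total R) (y : R.carrier) :
    (R.inv r • f).val y = f.val (y * r) := by
  rw [Dual.val_smul, Dual.act_apply, R.inv_inv]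

theorem apply_mul_comm (ω : R.carrier →ₗ[k] k) {i j : ℤ} {z y : R.carrier} (hz : z ∈ R.gr i)
    (hy : y ∈ R.gr j) : ω (z * y) = (-1 : k) ^ (i * j) * ω (y * z) := by
  rw [R.graded_comm hz hy, map_smul, smul_eq_mul]

/-- If `a ↦ a ω` is a quasi-isomorphism, then `z ω = (y ↦ ± ω (z y))` identifies `H(R)` with the dual
of `H(R)`. -/
theorem HasDualizingCocycle.hasPerfectPairing (h : HasDualizingCocycle R) :
    HasPerfectPairing R := by
  obtain ⟨e, (ω : Dual.Total R), hω, hdω, hK⟩ := h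
  obtain ⟨n, rfl⟩ : ∃ n, e = -n := ⟨-e, (neg_neg e).symm⟩
  have hω' : ω ∈ Dual.gr R (-n) := hω
  refine ⟨n, Dual.Total.val ω, fun m hm => hω m (by omega), Dual.apply_d hdω, ?_, ?_⟩
  · intro i z hz hdz h
    have hmem : R.inv z • ω ∈ Dual.gr R (-(n - i)) := by
      have := Dual.smul_mem_gr (invol_mem R.gr hz) hω'
      rwa [show i + -n = -(n - i) by ring] at this
    -- `z ω` vanishes on cocycles, so that `z` is the second component of a cocycle of the cone
    obtain ⟨c, hc⟩ := Dual.exists_totalDiff_eq hmem fun y hy hdy => by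
      rw [Dual.inv_smul_apply, apply_mul_comm _ hy hz, h y hy hdy, mul_zero]
    obtain ⟨c', r, -, hr⟩ := exists_of_dualCell_acyclic hω hdω hK (c := -c) (r := z)
      (by rw [map_neg, hc, neg_add_cancel]) hdz
    exact ⟨r, hr⟩
  · intro i f hf
    obtain ⟨F, hF, hFf⟩ := Dual.exists_val_eq_comp_pr f (n - i)
    have hFy : ∀ y ∈ R.gr (n - i), F.val y = f y := fun y hy => by
      rw [hFf, LinearMap.comp_apply, pr_same R.gr hy]
    have hdF : Dual.totalDiff F = 0 := Dual.Total.hext fun x => by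
      change _ = (0 : k)
      rw [Dual.totalDiff_apply, hFf, LinearMap.comp_apply]
      have := R.pr_d (n - i - 1) (R.inv x)
      rw [sub_add_cancel] at this
      rw [this, hf]
    -- the cocycle `F` of `Hom(R)` is cohomologous to a multiple `± r ω`
    obtain ⟨c, r, h1, h2⟩ := exists_of_dualCell_acyclic hω hdω hK (c := F) (r := 0)
      (by rw [hdF, map_zero, zero_smul, add_zero]) (map_zero _)
    refine ⟨(-1 : k) ^ (i * (n - i)) • pr R.gr i r, Submodule.smul_mem _ _ (pr_mem _ _ _), ?_,
      fun y hy hdy => ?_⟩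
    · rw [map_smul, ← R.pr_d, h2, map_zero, smul_zero]
    · rw [smul_mul_assoc, map_smul, apply_mul_comm _ (pr_mem _ _ _) hy, smul_eq_mul, ← mul_assoc,
        sgn_mul_self, one_mul]
      have h3 := congrArg (fun f : Dual.Total R => f.val y) h1
      beta_reduce at h3
      rw [map_add, LinearMap.add_apply, Dual.totalDiff_apply, Dual.inv_smul_apply, R.d_inv, hdy,
        map_zero, neg_zero, map_zero, zero_add, hFy y hy] at h3
      rw [← h3, ← Dual.apply_pr hω', ← Dual.apply_pr hω' (y * r)]
      have h4 := (regular R).smul_pr hy i r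
      have h5 : pr R.gr (i + (n - i)) (y * r) = y * pr R.gr i r := h4
      rw [add_sub_cancel] at h5
      rw [h5, pr_same R.gr]
      have := R.mul_mem hy (pr_mem R.gr i r)
      rwa [sub_add_cancel] at this

theorem HasPerfectPairing.hasDualizingCocycle (h : HasPerfectPairing R) :
    HasDualizingCocycle R := by
  obtain ⟨n, ω₀, hω₀, hdω₀, hinj, hsurj⟩ := h
  obtain ⟨ω, hω, rfl⟩ := Dual.exists_val_eq (R := R) (n := -n) (f := ω₀)
    (fun m hm => hω₀ m (by omega))
  have hdω : (dual R).d ω = 0 := Dual.Total.hext fun x => hdω₀ _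
  refine ⟨-n, ω, hω, hdω, dualCell_acyclic hω hdω fun j c r hc hr hc1 hdr => ?_⟩
  -- the component in `R` is a coboundary `d r'`
  obtain ⟨r', hr', hdr'⟩ : ∃ r' ∈ R.gr (j + n), R.d r' = r := by
    have := (regular R).exists_homogeneous_of_d_eq (x := r) hr (hinj _ r hr hdr fun y hy hdy => by
      have h3 : (Dual.totalDiff c + R.inv r • ω).val y = 0 := by rw [hc1]; rfl
      rw [map_add, LinearMap.add_apply, Dual.totalDiff_apply, Dual.inv_smul_apply, R.d_inv, hdy,
        map_zero, neg_zero, map_zero, zero_add] at h3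
      rw [apply_mul_comm _ hr hy, h3, mul_zero])
    rwa [show j + 1 - -n - 1 = j + n by ring] at this
  -- what remains is a cocycle `g` of the dual, which has to be a multiple of `ω`
  let g : Dual.Total R := c - R.inv r' • ω
  have hg : g ∈ Dual.gr R j := by
    refine Submodule.sub_mem _ hc ?_
    have := Dual.smul_mem_gr (invol_mem R.gr hr') hω
    rwa [show j + n + -n = j by ring] at this
  have hdω' : Dual.totalDiff ω = 0 := hdω
  have hdg : Dual.totalDiff g = 0 := by
    rw [map_sub, Dual.totalDiff_smul, hdω', R.d_inv, hdr', smul_zero, add_zero, neg_smul,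
      sub_neg_eq_add, hc1]
  obtain ⟨z, hz, hdz, hzg⟩ := hsurj (n + j) g.val (Dual.apply_d hdg)
  -- the sign comes from `z' ω` being `y ↦ ω (y z')`, with the factors in the other order
  let z' := (-1 : k) ^ ((n + j) * (-j)) • z
  have hz' : z' ∈ R.gr (n + j) := Submodule.smul_mem _ _ hz
  have hdz' : R.d z' = 0 := by rw [map_smul, hdz, smul_zero]
  have hmem : g - R.inv z' • ω ∈ Dual.gr R (- -j) := by
    rw [neg_neg]
    refine Submodule.sub_mem _ hg ?_
    have := Dual.smul_mem_gr (invol_mem R.gr hz') hω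
    rwa [show n + j + -n = j by ring] at this
  obtain ⟨c', hc'⟩ := Dual.exists_totalDiff_eq hmem fun y hy hdy => by
    rw [map_sub, LinearMap.sub_apply, Dual.inv_smul_apply, ← hzg y (by
      rwa [show n - (n + j) = -j by ring]) hdy, apply_mul_comm _ hz hy, mul_smul_comm, map_smul,
      smul_eq_mul, sub_self]
  refine ⟨c', z' + r', ?_, by rw [map_add, hdz', zero_add, hdr']⟩
  rw [hc', map_add, add_smul]
  change c - R.inv r' • ω - R.inv z' • ω + (R.inv z' • ω + R.inv r' • ω) = c
  abel

end

section

variable {k : Type u} [Field k]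

/-! ### Passage to the cohomology algebra -/

section Cohomology

variable (R : AugCDGA.{u, v} k)

/-- A functional on `R` that vanishes on coboundaries induces one on `H(R)`. -/
theorem exists_functional_cohomology (f : R.carrier →ₗ[k] k) (hf : ∀ x, f (R.d x) = 0) :
    ∃ g : R.H →ₗ[k] k, ∀ z : R.cocycles, g (R.toH z) = f z :=
  exists_functional_comp_eq R.toH.toLinearMap (f ∘ₗ R.cocycles.val.toLinearMap) fun z hz => by
    obtain ⟨x, hx⟩ := R.toH_eq_zero.1 hz
    change f z = 0
    rw [← hx, hf]

/-- A functional on `H(R)` is induced by one on `R`. -/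
theorem exists_functional_of_cohomology (g : R.H →ₗ[k] k) :
    ∃ f : R.carrier →ₗ[k] k, (∀ x, f (R.d x) = 0) ∧ ∀ z : R.cocycles, f z = g (R.toH z) := by
  obtain ⟨f, hf⟩ := exists_functional_comp_eq R.cocycles.val.toLinearMap
    (g ∘ₗ R.toH.toLinearMap) fun z hz => by
      have : z = 0 := Subtype.ext hz
      rw [this, map_zero]
  refine ⟨f, fun x => ?_, hf⟩
  have h1 := hf ⟨R.d x, R.d_d x⟩
  have h2 : R.toH ⟨R.d x, R.d_d x⟩ = 0 := R.toH_eq_zero.2 ⟨x, rfl⟩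
  change f (R.d x) = g (R.toH ⟨R.d x, R.d_d x⟩) at h1
  rw [h1, h2, map_zero]

/-- Duality for `R` and for `H(R)` mean the same. -/
theorem hasPerfectPairing_cohomology_iff :
    HasPerfectPairing R.cohomology ↔ HasPerfectPairing R := by
  constructor
  · rintro ⟨n, ω, -, -, hinj, hsurj⟩
    obtain ⟨ω₁, hω₁d, hω₁⟩ := exists_functional_of_cohomology R ω
    have hω₁n : ∀ {i}, ∀ z ∈ R.gr i, ∀ y ∈ R.gr (n - i), pr R.gr n (z * y) = z * y := by
      intro i z hz y hy
      refine pr_same R.gr ?_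
      have := R.mul_mem hz hy
      rwa [add_sub_cancel] at this
    refine ⟨n, ω₁ ∘ₗ pr R.gr n, fun m hm x hx => ?_, fun x => ?_, fun i z hz hdz h => ?_,
      fun i f hf => ?_⟩
    · rw [LinearMap.comp_apply, pr_ne R.gr hx hm, map_zero]
    · have := R.pr_d (n - 1) x
      rw [sub_add_cancel] at this
      rw [LinearMap.comp_apply, this, hω₁d]
    · obtain ⟨x, hx⟩ := hinj i (R.toH ⟨z, hdz⟩) ⟨⟨z, hdz⟩, hz, rfl⟩ rfl (by
        rintro _ ⟨y, hy, rfl⟩ -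
        have h1 : ω₁ (z * y) = ω (R.toH ⟨z, hdz⟩ * R.toH y) := hω₁ (⟨z, hdz⟩ * y)
        refine h1.symm.trans ?_
        rw [← h y hy y.2, LinearMap.comp_apply, hω₁n z hz y hy])
      exact (R.toH_eq_zero (z := ⟨z, hdz⟩)).1 hx.symm
    · obtain ⟨g, hg⟩ := exists_functional_cohomology R f hf
      obtain ⟨_, ⟨z, hz, rfl⟩, -, hzy⟩ := hsurj i g fun x => map_zero g
      refine ⟨z, hz, z.2, fun y hy hdy => ?_⟩
      have h1 : ω₁ (z * y) = ω (R.toH z * R.toH ⟨y, hdy⟩) := hω₁ (z * ⟨y, hdy⟩)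
      rw [LinearMap.comp_apply, hω₁n z.1 hz y hy, h1]
      exact (hzy _ ⟨⟨y, hdy⟩, hy, rfl⟩ rfl).trans (hg ⟨y, hdy⟩)
  · rintro ⟨n, ω, hω, hdω, hinj, hsurj⟩
    obtain ⟨ω₁, hω₁⟩ := exists_functional_cohomology R ω hdω
    refine ⟨n, ω₁, ?_, fun x => map_zero ω₁, ?_, fun i g _ => ?_⟩
    · rintro m hm _ ⟨z, hz, rfl⟩
      exact (hω₁ z).trans (hω m hm z hz)
    · rintro i _ ⟨z, hz, rfl⟩ - h
      refine ⟨0, (R.toH_eq_zero.2 (hinj i z hz z.2 fun y hy hdy => ?_)).symm⟩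
      have h1 : ω₁ (R.toH z * R.toH ⟨y, hdy⟩) = ω (z * y) := hω₁ (z * ⟨y, hdy⟩)
      rw [← h1]
      exact h _ ⟨⟨y, hdy⟩, hy, rfl⟩ rfl
    · obtain ⟨f, hf, hfg⟩ := exists_functional_of_cohomology R g
      obtain ⟨z, hz, hdz, hzy⟩ := hsurj i f hf
      refine ⟨R.toH ⟨z, hdz⟩, ⟨⟨z, hdz⟩, hz, rfl⟩, rfl, ?_⟩
      rintro _ ⟨y, hy, rfl⟩ -
      have h1 : ω₁ (R.toH ⟨z, hdz⟩ * R.toH y) = ω (z * y) := hω₁ (⟨z, hdz⟩ * y)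
      exact (h1.trans (hzy y hy y.2)).trans (hfg y)

variable {R}

theorem cocycle_zero_of_hZeroIsBase (hpos : R.IsNonneg) (hzero : R.HZeroIsBase) (x : R.carrier)
    (hx : x ∈ R.gr 0) (hdx : R.d x = 0) : ∃ c : k, x = algebraMap k R.carrier c := by
  obtain ⟨c, hc, -⟩ := hzero (R.toH ⟨x, hdx⟩) ⟨⟨x, hdx⟩, hx, rfl⟩
  have h1 : R.toH (algebraMap k R.cocycles c - ⟨x, hdx⟩) = 0 := by
    rw [map_sub, AlgHom.commutes, sub_eq_zero]
    exact hc
  obtain ⟨b, hb⟩ := R.toH_eq_zero.1 h1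
  have hb' : R.d b = algebraMap k R.carrier c - x := hb
  refine ⟨c, ?_⟩
  have h2 := R.pr_d (-1) b
  rw [R.eq_zero_of_mem_neg hpos (by norm_num) (pr_mem R.gr (-1) b), map_zero, hb',
    neg_add_cancel, pr_same R.gr (Submodule.sub_mem _ (R.algebraMap_mem c) hx)] at h2
  exact (sub_eq_zero.1 h2).symm

theorem isNonneg_cohomology (hpos : R.IsNonneg) : R.cohomology.IsNonneg := by
  intro i hi
  rw [eq_bot_iff]
  rintro _ ⟨z, hz, rfl⟩
  have : z = 0 := Subtype.ext (R.eq_zero_of_mem_neg hpos hi hz)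
  rw [this, map_zero]
  exact Submodule.zero_mem _

theorem exists_d_eq_of_hVanishesAbove {N : ℤ} (hN : R.HVanishesAbove N) (i : ℤ) (hi : i > N)
    (x : R.carrier) (hx : x ∈ R.gr i) (hdx : R.d x = 0) : ∃ y, R.d y = x := by
  have h1 : R.toH ⟨x, hdx⟩ ∈ R.cohomology.gr i := ⟨⟨x, hdx⟩, hx, rfl⟩
  rw [hN i hi] at h1
  exact R.toH_eq_zero.1 ((Submodule.mem_bot k).1 h1)

end Cohomology

/-! ### Poincaré duality algebras -/

/-- For an algebra with zero differential, duality in terms of a bilinear form is Poincaré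
duality. -/
theorem hasPerfectPairing_iff_isPoincareDuality {A : AugCDGA.{u, v} k} (hd : ∀ x, A.d x = 0)
    (hpos : A.IsNonneg) (h0 : ∀ x ∈ A.gr 0, ∃ c : k, x = algebraMap k A.carrier c) :
    HasPerfectPairing A ↔ A.IsPoincareDuality := by
  have hne : (1 : A.carrier) ≠ 0 := fun h => by
    have := map_one A.aug
    rw [h, map_zero] at this
    exact zero_ne_one this
  constructor
  · rintro ⟨n, ω, hω, -, hinj, hsurj⟩
    have hinj' : ∀ i, ∀ z ∈ A.gr i, (∀ y ∈ A.gr (n - i), ω (z * y) = 0) → z = 0 := by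
      intro i z hz h
      obtain ⟨x, hx⟩ := hinj i z hz (hd z) fun y hy _ => h y hy
      rw [← hx, hd]
    -- above degree `n` the pairing is with negative degrees, which vanish
    have htop : ∀ i, n < i → A.gr i = ⊥ := by
      intro i hi
      rw [eq_bot_iff]
      intro z hz
      refine (Submodule.mem_bot k).2 (hinj' i z hz fun y hy => ?_)
      rw [A.eq_zero_of_mem_neg hpos (by omega) hy, mul_zero, map_zero]
    have hn : 0 ≤ n := by
      by_contra hn
      have := A.one_mem
      rw [htop 0 (by omega)] at this
      exact hne ((Submodule.mem_bot k).1 this)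
    -- the fundamental class is dual to the augmentation
    obtain ⟨α, hα, -, hα1⟩ := hsurj n A.aug.toLinearMap fun x => A.aug_d x
    have hωα : ω α = 1 := by
      have := hα1 1 (by rw [sub_self]; exact A.one_mem) (hd 1)
      rw [mul_one] at this
      rw [this]
      exact map_one A.aug
    refine ⟨n, hn, ?_, α, ω, ?_, hωα, fun i _ _ => ⟨?_, ?_⟩⟩
    · rintro i (hi | hi)
      · exact hpos i hi
      · exact htop i hi
    · refine le_antisymm (fun z hz => ?_) ((Submodule.span_singleton_le_iff_mem _ _).2 hα)
      refine Submodule.mem_span_singleton.2 ⟨ω z, ?_⟩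
      rw [← sub_eq_zero]
      refine hinj' n _ (Submodule.sub_mem _ (Submodule.smul_mem _ _ hα) hz) fun y hy => ?_
      rw [sub_self] at hy
      obtain ⟨c, rfl⟩ := h0 y hy
      rw [Algebra.algebraMap_eq_smul_one, mul_smul_comm, mul_one, map_smul, map_sub, map_smul, hωα]
      simp
    · rw [← LinearMap.ker_eq_bot, eq_bot_iff]
      rintro ⟨z, hz⟩ h
      refine (Submodule.mem_bot k).2 (Subtype.ext (hinj' i z hz fun y hy => ?_))
      exact LinearMap.congr_fun h ⟨y, hy⟩
    · intro φ
      obtain ⟨f, hf⟩ := exists_functional_comp_eq (A.gr (n - i)).subtype φ fun y hy => by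
        rw [show y = 0 from Subtype.ext hy, map_zero]
      obtain ⟨z, hz, -, hzf⟩ := hsurj i f fun x => by rw [hd, map_zero]
      refine ⟨⟨z, hz⟩, LinearMap.ext fun y => ?_⟩
      exact (hzf y y.2 (hd _)).trans (hf y)
  · rintro ⟨n, hn, hout, α, ω, -, -, hbij⟩
    have hpr : ∀ {i}, ∀ z ∈ A.gr i, ∀ y ∈ A.gr (n - i), pr A.gr n (z * y) = z * y := by
      intro i z hz y hy
      refine pr_same A.gr ?_
      have := A.mul_mem hz hy
      rwa [add_sub_cancel] at this
    -- `ω` is only given on `Aⁿ`, so it is cut off in the other degrees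
    refine ⟨n, ω ∘ₗ pr A.gr n, fun m hm x hx => ?_, fun x => by rw [hd, map_zero],
      fun i z hz _ h => ⟨0, ?_⟩, fun i f _ => ?_⟩
    · rw [LinearMap.comp_apply, pr_ne A.gr hx hm, map_zero]
    · rw [map_zero]
      by_cases hi : 0 ≤ i ∧ i ≤ n
      · have := (hbij i hi.1 hi.2).1 (a₁ := ⟨z, hz⟩) (a₂ := 0) (by
          rw [map_zero]
          refine LinearMap.ext fun y => ?_
          have h1 := h y y.2 (hd _)
          rwa [LinearMap.comp_apply, hpr z hz y y.2] at h1)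
        exact (congrArg Subtype.val this).symm
      · rw [hout i (by omega)] at hz
        exact ((Submodule.mem_bot k).1 hz).symm
    · by_cases hi : 0 ≤ i ∧ i ≤ n
      · obtain ⟨z, hz⟩ := (hbij i hi.1 hi.2).2 (f ∘ₗ (A.gr (n - i)).subtype)
        refine ⟨z, z.2, hd _, fun y hy _ => ?_⟩
        rw [LinearMap.comp_apply, hpr z z.2 y hy]
        exact LinearMap.congr_fun hz ⟨y, hy⟩
      · refine ⟨0, Submodule.zero_mem _, hd _, fun y hy _ => ?_⟩
        rw [hout (n - i) (by omega)] at hy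
        rw [(Submodule.mem_bot k).1 hy, mul_zero, map_zero, map_zero]

end

section

variable {k : Type u} [Field k] {R : AugCDGA.{u, v} k}

/-! ### Homomorphisms from a semifree module to an acyclic module -/

section HomComplex

variable {P : DGModule.{u, v, w} R} {M : DGModule.{u, v, w'} R}

/-- The map `f` is of degree `e` and satisfies `f (a x) = (-1)^{n deg a} a f x`. The degree `e` is
kept apart from the sign `n`, since `a ↦ a ω` shifts degrees without introducing a sign. -/
def IsTwisted (n e : ℤ) (f : P.carrier →ₗ[k] M.carrier) : Prop :=
  (∀ i, ∀ x ∈ P.gr i, f x ∈ M.gr (i + e)) ∧ ∀ a x, f (a • x) = R.twist n a • f x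

theorem mem_homDeg_iff {n : ℤ} {f : P.carrier →ₗ[k] M.carrier} :
    f ∈ homDeg P M n ↔ IsTwisted n n f := by
  refine ⟨fun h => ⟨h.1, fun a x => ?_⟩, fun h => ⟨h.1, fun m a ha x => ?_⟩⟩
  · have : f ∘ₗ (LinearMap.toSpanSingleton R.carrier P.carrier x).restrictScalars k =
        (LinearMap.toSpanSingleton R.carrier M.carrier (f x)).restrictScalars k ∘ₗ R.twist n := by
      refine eq_of_homogeneous R.gr fun m a ha => ?_
      simp [h.2 m a ha x, R.twist_of_mem n ha]
    exact LinearMap.congr_fun this a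
  · rw [h.2, R.twist_of_mem n ha, smul_assoc]

theorem inv_twist (n : ℤ) (a : R.carrier) : R.twist n (R.inv a) = R.twist (n + 1) a := by
  rcases Int.even_or_odd n with h | h
  · simp [R.twist_even h, R.twist_odd h.add_one]
  · simp [R.twist_odd h, R.twist_even h.add_one, R.inv_inv]

theorem homDiff_smul {n : ℤ} {g : P.carrier →ₗ[k] M.carrier}
    (hg : ∀ a x, g (a • x) = R.twist n a • g x) (a : R.carrier) (x : P.carrier) :
    homDiff P M n g (a • x) = R.twist (n + 1) a • homDiff P M n g x := by
  rw [homDiff_apply, homDiff_apply, hg, P.leibniz', map_add, hg, hg, M.leibniz', R.d_twist,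
    ← R.twist_succ, inv_twist, smul_sub, smul_add, M.smul_comm_base, smul_assoc]
  abel

variable {ι : Type*} (b : Module.Basis ι R.carrier P.carrier) {deg : ι → ℤ} {level : ι → ℕ}

theorem twisted_ext {n : ℤ} {f g : P.carrier →ₗ[k] M.carrier}
    (hf : ∀ a x, f (a • x) = R.twist n a • f x) (hg : ∀ a x, g (a • x) = R.twist n a • g x)
    {s : Set P.carrier} (h : ∀ x ∈ s, f x = g x) {x : P.carrier}
    (hx : x ∈ Submodule.span R.carrier s) : f x = g x := by
  induction hx using Submodule.span_induction with
  | mem x hx => exact h x hx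
  | zero => rw [map_zero, map_zero]
  | add x y _ _ hx hy => rw [map_add, map_add, hx, hy]
  | smul a x _ hx => rw [hf, hg, hx]

/-- The map with given values on a basis that satisfies `f (a x) = (-1)^{n deg a} a f x`. -/
noncomputable def twistedHom (n : ℤ) (γ : ι → M.carrier) : P.carrier →ₗ[k] M.carrier :=
  (Finsupp.lsum k fun i =>
    (LinearMap.toSpanSingleton R.carrier M.carrier (γ i)).restrictScalars k ∘ₗ R.twist n) ∘ₗ
      (b.repr.toLinearMap.restrictScalars k)

theorem twistedHom_apply (n : ℤ) (γ : ι → M.carrier) (x : P.carrier) :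
    twistedHom b n γ x = ∑ i ∈ (b.repr x).support, R.twist n (b.repr x i) • γ i := rfl

theorem twistedHom_smul (n : ℤ) (γ : ι → M.carrier) (a : R.carrier) (x : P.carrier) :
    twistedHom b n γ (a • x) = R.twist n a • twistedHom b n γ x := by
  simp only [twistedHom, LinearMap.comp_apply, LinearMap.coe_restrictScalars, LinearEquiv.coe_coe,
    map_smul]
  induction b.repr x using Finsupp.induction_linear with
  | zero => simp
  | add f g hf hg => rw [smul_add, map_add, map_add, hf, hg, smul_add]
  | single j r =>
    rw [Finsupp.smul_single, smul_eq_mul, Finsupp.lsum_single, Finsupp.lsum_single]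
    change R.twist n (a * r) • γ j = R.twist n a • R.twist n r • γ j
    rw [R.twist_mul, mul_smul]

theorem twistedHom_basis (n : ℤ) (γ : ι → M.carrier) (i : ι) :
    twistedHom b n γ (b i) = γ i := by
  simp [twistedHom, R.twist_one]

theorem twistedHom_congr (n : ℤ) {γ γ' : ι → M.carrier} {x : P.carrier}
    (h : ∀ i, b.repr x i ≠ 0 → γ i = γ' i) : twistedHom b n γ x = twistedHom b n γ' x := by
  rw [twistedHom_apply, twistedHom_apply]
  exact Finset.sum_congr rfl fun i hi => by rw [h i (Finsupp.mem_support_iff.1 hi)]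

theorem twistedHom_mem (hb : ∀ i, b i ∈ P.gr (deg i)) (n : ℤ) {e : ℤ} {γ : ι → M.carrier} {j : ℤ}
    {x : P.carrier} (hx : x ∈ P.gr j) (h : ∀ i, b.repr x i ≠ 0 → γ i ∈ M.gr (deg i + e)) :
    twistedHom b n γ x ∈ M.gr (j + e) := by
  rw [twistedHom_apply]
  refine Submodule.sum_mem _ fun i hi => ?_
  have := M.smul_mem (R.twist_mem n (repr_mem b hb hx i)) (h i (Finsupp.mem_support_iff.1 hi))
  rwa [show j - deg i + (deg i + e) = j + e by ring] at this

/-- `Hom_R(P, M)` is acyclic if `P` is semifree and `M` is acyclic: a primitive is constructed on the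
basis elements by recursion on their level. -/
theorem hom_acyclic (hP : P.IsSemifree) (hM : M.Acyclic) {n e : ℤ}
    {f : P.carrier →ₗ[k] M.carrier} (hf : IsTwisted n e f) (hdf : homDiff P M n f = 0) :
    ∃ g, IsTwisted (n - 1) (e - 1) g ∧ homDiff P M (n - 1) g = f := by
  classical
  obtain ⟨ι, b, deg, level, hb, hd⟩ := hP
  -- on `b i`, the map with values `γ` is a primitive of `f` of the right degree
  let Q : ι → (ι → M.carrier) → Prop := fun i γ => γ i ∈ M.gr (deg i + (e - 1)) ∧
    M.d (γ i) - (-1 : k) ^ (n - 1) • twistedHom b (n - 1) γ (P.d (b i)) = f (b i)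
  have htw : ∀ γ a x, homDiff P M (n - 1) (twistedHom b (n - 1) γ) (a • x) =
      R.twist n a • homDiff P M (n - 1) (twistedHom b (n - 1) γ) x := fun γ a x => by
    have := homDiff_smul (twistedHom_smul b (n - 1) γ) a x
    rwa [sub_add_cancel] at this
  have hQ : ∀ γ i, Q i γ → homDiff P M (n - 1) (twistedHom b (n - 1) γ) (b i) = f (b i) := by
    intro γ i h
    rw [homDiff_apply, twistedHom_basis, h.2]
  obtain ⟨γ, hγ⟩ : ∃ γ, ∀ i, Q i γ := by
    refine exists_forall_of_rank level Q ?_ ?_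
    · rintro i γ γ' h ⟨h1, h2⟩
      have hi : γ i = γ' i := h i (Or.inr rfl)
      refine ⟨hi ▸ h1, ?_⟩
      rw [← hi, ← twistedHom_congr b (n - 1) (γ := γ)
        fun j hj => h j (Or.inl (level_lt_of_repr_ne_zero b hd hj)), h2]
    · intro i γ h
      have hlow : homDiff P M (n - 1) (twistedHom b (n - 1) γ) (P.d (b i)) = f (P.d (b i)) := by
        refine twisted_ext (htw γ) hf.2 ?_ (hd i)
        rintro _ ⟨j, hj, rfl⟩
        exact hQ γ j (h j hj)
      rw [homDiff_apply, P.d_d, map_zero, smul_zero, sub_zero] at hlow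
      have hsgn : (-1 : k) ^ n = -(-1 : k) ^ (n - 1) := by
        rw [← sgn_succ, sub_add_cancel]
      have hdfi : M.d (f (b i)) = (-1 : k) ^ n • f (P.d (b i)) := by
        have := LinearMap.congr_fun hdf (b i)
        rw [homDiff_apply] at this
        exact sub_eq_zero.1 this
      obtain ⟨y, hy, hdy⟩ := M.exists_homogeneous_of_d_eq (i := deg i + e)
        (x := f (b i) + (-1 : k) ^ (n - 1) • twistedHom b (n - 1) γ (P.d (b i)))
        (by
          refine Submodule.add_mem _ (hf.1 _ _ (hb i)) (Submodule.smul_mem _ _ ?_)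
          have := twistedHom_mem b hb (n - 1) (e := e - 1) (γ := γ) (P.d_mem (hb i))
            fun j hj => (h j (level_lt_of_repr_ne_zero b hd hj)).1
          rwa [show deg i + 1 + (e - 1) = deg i + e by ring] at this)
        (hM _ (by rw [map_add, map_smul, hlow, hdfi, hsgn, neg_smul, neg_add_cancel]))
      have hne : ∀ j, level j < level i → Function.update γ i y j = γ j := fun j hj => by
        rw [Function.update_of_ne]
        rintro rfl
        omega
      refine ⟨Function.update γ i y, ⟨?_, ?_⟩, hne⟩
      · rw [Function.update_self, ← add_sub_assoc]
        exact hy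
      · rw [Function.update_self, twistedHom_congr b (n - 1) (γ' := γ)
          fun j hj => hne j (level_lt_of_repr_ne_zero b hd hj), hdy, add_sub_cancel_right]
  refine ⟨twistedHom b (n - 1) γ, ⟨fun i x hx => twistedHom_mem b hb _ hx fun j _ => (hγ j).1,
    twistedHom_smul b _ γ⟩, LinearMap.ext fun x => ?_⟩
  refine twisted_ext (htw γ) hf.2 (s := Set.range b) ?_ (b.mem_span x)
  rintro _ ⟨i, rfl⟩
  exact hQ γ i (hγ i)

end HomComplex

end

section

variable {k : Type u} [Field k] {R : AugCDGA.{u, v} k}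

/-! ### `Ext` into an algebra with a dualizing cocycle -/

section DualHom

variable {P : DGModule.{u, v, w} R}

/-- A homogeneous functional `γ` on `P` defines the map `x ↦ (y ↦ ± γ (y x))` from `P` to the graded
dual of `R`; this is the adjunction between `Hom_R(P, Hom(R))` and `Hom(P, k)`. -/
theorem exists_dualHom (m q : ℤ) (γ : P.carrier →ₗ[k] k)
    (hγ : ∀ j, j ≠ q → ∀ x ∈ P.gr j, γ x = 0) :
    ∃ G : P.carrier →ₗ[k] Dual.Total R, IsTwisted (M := dual R) m (-q) G ∧
      ∀ x, (G x).val 1 = γ x := by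
  let φ : P.carrier →ₗ[k] R.carrier →ₗ[k] k := LinearMap.mk₂ k
    (fun x y => γ (R.twist (m + 1) y • x))
    (fun x x' y => by rw [smul_add, map_add])
    (fun c x y => by rw [P.smul_comm_base, map_smul])
    (fun x y y' => by rw [map_add, add_smul, map_add])
    (fun c x y => by rw [LinearMap.map_smul, smul_assoc, LinearMap.map_smul])
  have hφ : ∀ x y, φ x y = γ (R.twist (m + 1) y • x) := fun x y => rfl
  have hdeg : ∀ i, ∀ x ∈ P.gr i, φ x ∈ Dual.deg R (i + -q) := by
    intro i x hx j hj y hy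
    rw [hφ]
    exact hγ (j + i) (by omega) _ (P.smul_mem (R.twist_mem _ hy) hx)
  have htot : ∀ x, φ x ∈ Dual.total R := fun x =>
    mem_of_pr_mem P.gr (S := (Dual.total R).comap φ) fun i =>
      Dual.deg_le_total _ (hdeg i _ (pr_mem _ _ _))
  refine ⟨LinearMap.codRestrict (Dual.total R) φ htot, ⟨fun i x hx => hdeg i x hx, fun a x => ?_⟩,
    fun x => ?_⟩
  · refine Dual.Total.hext fun y => ?_
    change γ (R.twist (m + 1) y • a • x) =
      γ (R.twist (m + 1) (y * R.inv (R.twist m a)) • x)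
    rw [← R.twist_succ, R.twist_mul, R.twist_twist, mul_smul]
  · change γ (R.twist (m + 1) 1 • x) = γ x
    rw [R.twist_one, one_smul]

/-- A map to the graded dual of `R` that is linear up to sign is determined by its values at
`1`. -/
theorem dualHom_ext {n : ℤ} {F G : P.carrier →ₗ[k] Dual.Total R}
    (hF : ∀ a x, F (a • x) = R.twist n a • F x) (hG : ∀ a x, G (a • x) = R.twist n a • G x)
    (h : ∀ x, (F x).val 1 = (G x).val 1) : F = G := by
  have key : ∀ {F : P.carrier →ₗ[k] Dual.Total R}, (∀ a x, F (a • x) = R.twist n a • F x) →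
      ∀ x y, (F x).val y = (F (R.twist (n + 1) y • x)).val 1 := by
    intro F hF x y
    rw [hF, Dual.val_smul, Dual.act_apply, one_mul, ← R.twist_succ, R.twist_twist]
  refine LinearMap.ext fun x => Dual.Total.hext fun y => ?_
  rw [key hF, key hG, h]

theorem homDiff_dual_apply_one (m : ℤ) (G : P.carrier →ₗ[k] Dual.Total R) (x : P.carrier) :
    Dual.Total.val (R := R) (homDiff P (dual R) m G x) 1 = -((-1 : k) ^ m * (G (P.d x)).val 1) := by
  have h1 : homDiff P (dual R) m G x = Dual.totalDiff (G x) - (-1 : k) ^ m • G (P.d x) := rfl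
  have h2 : (Dual.totalDiff (G x)).val 1 = 0 := by
    rw [Dual.totalDiff_apply, R.inv_one, R.d_one, map_zero]
  rw [h1]
  change Dual.Total.val (Dual.totalDiff (G x) - (-1 : k) ^ m • G (P.d x)) 1 = _
  rw [map_sub, LinearMap.sub_apply, h2, map_smul, LinearMap.smul_apply, smul_eq_mul, zero_sub]

end DualHom

section CellHom

variable {P : DGModule.{u, v, w} R} {e : ℤ} {ω : Dual.Total R} (hω : ω ∈ (dual R).gr e)
  (hd : (dual R).d ω = 0)

/-- Acyclicity of `Hom_R(P, Hom(R) ⊕ R σ)` in terms of components. -/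
theorem exists_cellHom (hP : P.IsSemifree) (hK : (adjoinCell (dual R) hω hd).Acyclic) {n e' : ℤ}
    {c : P.carrier →ₗ[k] Dual.Total R} {r : P.carrier →ₗ[k] R.carrier}
    (hc : IsTwisted (M := dual R) n e' c) (hr : IsTwisted (M := regular R) n (e' + 1 - e) r)
    (hdc : ∀ x, Dual.totalDiff (c x) + R.inv (r x) • ω = (-1 : k) ^ n • c (P.d x))
    (hdr : homDiff P (regular R) n r = 0) :
    ∃ (c' : P.carrier →ₗ[k] Dual.Total R) (r' : P.carrier →ₗ[k] R.carrier),
      IsTwisted (M := regular R) (n - 1) (e' - e) r' ∧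
      (∀ x, Dual.totalDiff (c' x) + R.inv (r' x) • ω =
        c x + (-1 : k) ^ (n - 1) • c' (P.d x)) ∧
      homDiff P (regular R) (n - 1) r' = r := by
  let h : P.carrier →ₗ[k] (adjoinCell (dual R) hω hd).carrier :=
    (LinearMap.prod c r : P.carrier →ₗ[k] Dual.Total R × R.carrier)
  obtain ⟨g, ⟨hg1, hg2⟩, hg⟩ := hom_acyclic (n := n) (e := e') (f := h) hP hK
    ⟨fun i x hx => Cell.mem_gr.2 ⟨hc.1 i x hx, by
      have := hr.1 i x hx
      rwa [show i + (e' + 1 - e) = i + e' + 1 - e by ring] at this⟩,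
      fun a x => Prod.ext (hc.2 a x) (hr.2 a x)⟩
    (LinearMap.ext fun x => Prod.ext (sub_eq_zero.2 (hdc x)) (LinearMap.congr_fun hdr x))
  refine ⟨(LinearMap.fst k (Dual.Total R) R.carrier) ∘ₗ g,
    (LinearMap.snd k (Dual.Total R) R.carrier) ∘ₗ g, ⟨fun i x hx => ?_, fun a x => ?_⟩,
    fun x => ?_, LinearMap.ext fun x => ?_⟩
  · have := (Cell.mem_gr.1 (hg1 i x hx)).2
    rwa [show i + (e' - 1) + 1 - e = i + (e' - e) by ring] at this
  · exact congrArg Prod.snd (hg2 a x)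
  · exact sub_eq_iff_eq_add.1 (congrArg Prod.fst (LinearMap.congr_fun hg x))
  · exact congrArg Prod.snd (LinearMap.congr_fun hg x)

end CellHom

theorem IsTwisted.inv_comp {P : DGModule.{u, v, w} R} {n e : ℤ} {f : P.carrier →ₗ[k] R.carrier}
    (hf : IsTwisted (M := regular R) n e f) :
    IsTwisted (M := regular R) (n + 1) e (R.inv ∘ₗ f) := by
  refine ⟨fun i x hx => invol_mem R.gr (hf.1 i x hx), fun a x => ?_⟩
  have : f (a • x) = R.twist n a * f x := hf.2 a x
  change R.inv (f (a • x)) = R.twist (n + 1) a * R.inv (f x)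
  rw [this, R.inv_mul, R.twist_succ]

theorem homDiff_inv_comp {P : DGModule.{u, v, w} R} (n : ℤ) (f : P.carrier →ₗ[k] R.carrier) :
    homDiff P (regular R) (n + 1) (R.inv ∘ₗ f) = -(R.inv ∘ₗ homDiff P (regular R) n f) := by
  refine LinearMap.ext fun x => ?_
  change R.d (R.inv (f x)) - (-1 : k) ^ (n + 1) • R.inv (f (P.d x)) =
    -R.inv (R.d (f x) - (-1 : k) ^ n • f (P.d x))
  rw [R.d_inv, map_sub, map_smul, sgn_succ, neg_smul]
  abel

section Gorenstein

variable {n₀ : ℤ} {ω : Dual.Total R} (P : SemifreeResolution.{u, v, w, u} (base R))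
  {p : P.P.carrier}

/-- A cocycle `f` of `Hom_R(P, R)` is a coboundary if `ω (± f p)` vanishes: `f` composed with
`a ↦ a ω` is then a coboundary by adjunction, and the cone of `a ↦ a ω` is acyclic. -/
theorem exists_homDiff_eq (hω : ω ∈ (dual R).gr (-n₀)) (hd : (dual R).d ω = 0)
    (hK : (adjoinCell (dual R) hω hd).Acyclic)
    (hdp : P.P.d p = 0) (hp1 : P.map.toFun p = (1 : k)) {n : ℤ} {f : P.P.carrier →ₗ[k] R.carrier}
    (hf : f ∈ homDeg P.P (regular R) n) (hdf : homDiff P.P (regular R) n f = 0)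
    (h : ω.val (R.inv (f p)) = 0) :
    ∃ g ∈ homDeg P.P (regular R) (n - 1), homDiff P.P (regular R) (n - 1) g = f := by
  have hft := mem_homDeg_iff.1 hf
  have hdω : ∀ x, ω.val (R.d x) = 0 := Dual.apply_d hd
  have hdf' : ∀ x, R.d (f x) = (-1 : k) ^ n • f (P.P.d x) := fun x =>
    sub_eq_zero.1 (LinearMap.congr_fun hdf x)
  have hfd : ∀ x, f (P.P.d x) = (-1 : k) ^ n • R.d (f x) := fun x => by
    rw [hdf', sgn_sq_smul]
  have hfa : ∀ a x, f (a • x) = R.twist n a * f x := hft.2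
  have hfm : ∀ i, ∀ x ∈ P.P.gr i, f x ∈ R.gr (i + n) := hft.1
  -- under the adjunction, `x ↦ f x ω` corresponds to the functional `± ν`
  let ν : P.P.carrier →ₗ[k] k := ω.val ∘ₗ R.inv ∘ₗ f
  have hνd : ∀ x, ν (P.P.d x) = 0 := fun x => by
    change ω.val (R.inv (f (P.P.d x))) = 0
    rw [hfd, map_smul, map_smul, ← neg_eq_iff_eq_neg.2 (R.d_inv (f x)), map_neg, hdω, neg_zero,
      smul_zero]
  have hνpr : ∀ x, ν (pr P.P.gr (n₀ - n) x) = ν x := fun x => by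
    have : ν ∘ₗ pr P.P.gr (n₀ - n) = ν := eq_of_homogeneous P.P.gr fun i x hx => by
      rw [LinearMap.comp_apply]
      by_cases hi : i = n₀ - n
      · subst hi; rw [pr_same _ hx]
      · rw [pr_ne _ hx hi, map_zero]
        exact (hω (i + n) (by omega) _ (invol_mem R.gr (hfm i x hx))).symm
    exact LinearMap.congr_fun this x
  -- `ν` kills all cocycles, because these are spanned by `p` and the coboundaries
  obtain ⟨γ₀, hγ₀⟩ := exists_functional_comp_eq P.P.d ((-1 : k) ^ n • ν) fun x hx => by
    obtain ⟨c, y, rfl⟩ := P.exists_eq_smul_unit_add hdp hp1 x hx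
    rw [map_add, LinearMap.smul_apply, LinearMap.smul_apply, hνd, map_smul]
    change (-1 : k) ^ n • c • ω.val (R.inv (f p)) + _ = 0
    rw [h]
    simp
  obtain ⟨G, hG, hG1⟩ := exists_dualHom (R := R) (P := P.P) (n - 1) (n₀ - n + 1)
    (γ₀ ∘ₗ pr P.P.gr (n₀ - n + 1)) fun j hj x hx => by
      rw [LinearMap.comp_apply, pr_ne _ hx hj, map_zero]
  let F : P.P.carrier →ₗ[k] Dual.Total R :=
    (LinearMap.toSpanSingleton R.carrier (Dual.Total R) ω).restrictScalars k ∘ₗ f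
  have hFapp : ∀ x, F x = f x • ω := fun x => rfl
  have hsgn : (-1 : k) ^ n = -(-1 : k) ^ (n - 1) := by rw [← sgn_succ, sub_add_cancel]
  have hGF : homDiff P.P (dual R) (n - 1) G = F := by
    refine dualHom_ext (n := n) (fun a x => ?_) (fun a x => ?_) fun x => ?_
    · have := homDiff_smul (M := dual R) hG.2 a x
      rwa [sub_add_cancel] at this
    · rw [hFapp, hFapp, hfa, mul_smul]
    · refine (homDiff_dual_apply_one (n - 1) G x).trans ?_
      rw [hG1, LinearMap.comp_apply, P.P.pr_d, hγ₀, LinearMap.smul_apply, hνpr, smul_eq_mul, hsgn,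
        neg_mul, mul_neg, neg_neg, ← mul_assoc, sgn_mul_self, one_mul, hFapp, Dual.val_smul,
        Dual.act_apply, one_mul]
      rfl
  -- hence `(-G, ± f)` is a cocycle of `Hom_R(P, Hom(R) ⊕ R σ)`, which is acyclic; the involution of
  -- `R` converts between the signs of `f` and those of a component of the cone
  have hfinv := hft.inv_comp
  have hdfinv : homDiff P.P (regular R) (n + 1) (R.inv ∘ₗ f) = 0 :=
    (homDiff_inv_comp n f).trans (by rw [hdf]; exact neg_eq_zero.2 (LinearMap.comp_zero _))
  have htw : R.twist (n + 1) = R.twist (n - 1) := LinearMap.ext fun a => by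
    have h1 := R.twist_succ n a
    have h2 := R.twist_succ (n - 1) a
    rw [sub_add_cancel] at h2
    rw [h1, h2, R.inv_inv]
  have hsgn' : (-1 : k) ^ (n + 1) = (-1 : k) ^ (n - 1) := by rw [sgn_succ, hsgn, neg_neg]
  obtain ⟨c', r', hr', -, hrd⟩ := exists_cellHom (P := P.P) hω hd P.semifree hK (n := n - 1)
    (e' := -(n₀ - n + 1)) (c := -G) (r := R.inv ∘ₗ f)
    ⟨fun i x hx => Submodule.neg_mem _ (hG.1 i x hx), fun a x => by
      have : G (a • x) = R.twist (n - 1) a • G x := hG.2 a x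
      change -G (a • x) = R.twist (n - 1) a • (-G x : Dual.Total R)
      rw [this, smul_neg]⟩
    ⟨fun i x hx => by
      have := hfinv.1 i x hx
      rwa [show i + (-(n₀ - n + 1) + 1 - -n₀) = i + n by ring],
      fun a x => by
        have := hfinv.2 a x
        rwa [htw] at this⟩
    (fun x => by
      have h1 : Dual.totalDiff (G x) - (-1 : k) ^ (n - 1) • G (P.P.d x) = f x • ω :=
        LinearMap.congr_fun hGF x
      rw [LinearMap.comp_apply, R.inv_inv, ← h1, LinearMap.neg_apply, LinearMap.neg_apply, map_neg,
        smul_neg]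
      abel)
    (LinearMap.ext fun x => by
      have h1 := LinearMap.congr_fun hdfinv x
      rw [homDiff_apply, hsgn'] at h1
      exact h1)
  have hr1 := hr'.inv_comp
  have hr2 := homDiff_inv_comp (P := P.P) (n - 1 - 1) r'
  rw [sub_add_cancel] at hr1 hr2
  refine ⟨-(R.inv ∘ₗ r'), Submodule.neg_mem _ (mem_homDeg_iff.2 ?_), ?_⟩
  · rwa [show -(n₀ - n + 1) - -n₀ = n - 1 by ring] at hr1
  · refine ((homDiff P.P (regular R) (n - 1)).map_neg _).trans ((congrArg Neg.neg hr2).trans ?_)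
    refine (neg_neg _).trans (LinearMap.ext fun x => ?_)
    rw [hrd]
    exact R.inv_inv (f x)

/-- There is a cocycle `f` of `Hom_R(P, R)` with `ω (± f p) = 1`: it is obtained from the
augmentation of `P`, viewed as a cocycle of `Hom_R(P, Hom(R))`. -/
theorem exists_cocycle_hom (hω : ω ∈ (dual R).gr (-n₀)) (hd : (dual R).d ω = 0)
    (hK : (adjoinCell (dual R) hω hd).Acyclic)
    (hdp : P.P.d p = 0) (hp1 : P.map.toFun p = (1 : k)) :
    ∃ f : P.P.carrier →ₗ[k] R.carrier, f ∈ homDeg P.P (regular R) n₀ ∧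
      homDiff P.P (regular R) n₀ f = 0 ∧ ω.val (R.inv (f p)) = 1 := by
  let ε : P.P.carrier →ₗ[k] k := P.map.toFun.restrictScalars k
  have hεd : ∀ x, ε (P.P.d x) = 0 := fun x => P.map.map_d x
  obtain ⟨G, hG, hG1⟩ := exists_dualHom (R := R) (P := P.P) n₀ 0 ε fun j hj x hx => by
    have : P.map.toFun x ∈ grBase k j := P.map.map_mem hx
    rw [grBase, if_neg hj] at this
    exact this
  -- `(G, 0)` is a coboundary of `Hom_R(P, Hom(R) ⊕ R σ)`, and `f` is the second component of a
  -- primitive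
  have hdG : homDiff P.P (dual R) n₀ G = 0 := by
    refine dualHom_ext (n := n₀ + 1) (homDiff_smul (M := dual R) hG.2)
      (fun a x => (smul_zero (A := Dual.Total R) (R.twist (n₀ + 1) a)).symm) fun x => ?_
    refine (homDiff_dual_apply_one n₀ G x).trans ?_
    rw [hG1, hεd, mul_zero, neg_zero]
    rfl
  obtain ⟨c', r', hr', hc'd, hr'd⟩ := exists_cellHom (P := P.P) hω hd P.semifree hK (n := n₀)
    (e' := -0) (c := G) (r := 0) hG
    ⟨fun i x _ => Submodule.zero_mem _, fun a x => (smul_zero (A := R.carrier) (R.twist n₀ a)).symm⟩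
    (fun x => by
      have h1 : Dual.totalDiff (G x) - (-1 : k) ^ n₀ • G (P.P.d x) = 0 :=
        LinearMap.congr_fun hdG x
      rw [LinearMap.zero_apply, map_zero, zero_smul, add_zero]
      exact sub_eq_zero.1 h1)
    (map_zero _)
  have hr1 := hr'.inv_comp
  have hr2 := homDiff_inv_comp (P := P.P) (n₀ - 1) r'
  rw [sub_add_cancel] at hr1 hr2
  refine ⟨R.inv ∘ₗ r', mem_homDeg_iff.2 ?_, ?_, ?_⟩
  · rwa [show (-0 : ℤ) - -n₀ = n₀ by ring] at hr1
  · refine hr2.trans ?_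
    rw [hr'd]
    exact neg_eq_zero.2 (LinearMap.comp_zero _)
  · have h1 := congrArg (fun F : Dual.Total R => F.val 1) (hc'd p)
    beta_reduce at h1
    rw [hdp, map_zero, smul_zero, add_zero, hG1, map_add, LinearMap.add_apply,
      Dual.totalDiff_apply, R.inv_one, R.d_one, map_zero, zero_add, Dual.val_smul, Dual.act_apply,
      one_mul] at h1
    exact h1.trans hp1

end Gorenstein

/-- A graded vector space concentrated in one degree and spanned there by a nonzero vector has
total dimension one. -/
theorem rank_directSum_eq_one {k : Type*} [Field k] {V : ℤ → Type*} [∀ i, AddCommGroup (V i)]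
    [∀ i, Module k (V i)] {n₀ : ℤ} {v : V n₀} (hv : v ≠ 0) (hspan : ∀ x, ∃ c : k, c • v = x)
    (hzero : ∀ n ≠ n₀, ∀ x : V n, x = 0) : Module.rank k (⨁ n, V n) = 1 := by
  rw [rank_eq_one_iff]
  refine ⟨DirectSum.lof k ℤ V n₀ v, fun h0 => hv ?_, fun x => ?_⟩
  · have := congrArg (DirectSum.component k ℤ V n₀) h0
    rwa [DirectSum.component.lof_self, map_zero] at this
  · induction x using DirectSum.induction_on with
    | zero => exact ⟨0, zero_smul _ _⟩
    | of i y =>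
      by_cases hi : i = n₀
      · subst hi
        obtain ⟨c, rfl⟩ := hspan y
        exact ⟨c, (map_smul (DirectSum.lof k ℤ V i) c v).symm⟩
      · exact ⟨0, by rw [hzero i hi y, map_zero, zero_smul]⟩
    | add x y hx hy =>
      obtain ⟨a, rfl⟩ := hx
      obtain ⟨b, rfl⟩ := hy
      exact ⟨a + b, add_smul _ _ _⟩

/-- If `R` has a dualizing cocycle, then `Ext_R(k, R)` is the shifted
`Ext_R(k, Hom(R)) = Hom(k, k)`. -/
theorem HasDualizingCocycle.isGorenstein (hpos : R.IsNonneg)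
    (h0 : ∀ x ∈ R.gr 0, R.d x = 0 → ∃ c : k, x = algebraMap k R.carrier c)
    (h : HasDualizingCocycle R) : R.IsGorenstein := by
  obtain ⟨e, (ω : Dual.Total R), hω, hd, hK⟩ := h
  obtain ⟨n₀, rfl⟩ : ∃ n, e = -n := ⟨-e, (neg_neg e).symm⟩
  refine ⟨?_, fun P => ?_⟩
  · obtain ⟨P, -⟩ := exists_nonneg_resolution hpos h0
    exact ⟨P⟩
  obtain ⟨p, hp, hdp, hp1⟩ := P.exists_unit
  have hdω : ∀ x, ω.val (R.d x) = 0 := Dual.apply_d hd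
  obtain ⟨f₀, hf₀, hdf₀, hf₀1⟩ := exists_cocycle_hom P hω hd hK hdp hp1
  let v : HomCohomology P.P (regular R) n₀ := Submodule.Quotient.mk ⟨f₀, hf₀, hdf₀⟩
  have hv : v ≠ 0 := by
    intro h0
    obtain ⟨g, hg, hgf⟩ := (Submodule.Quotient.mk_eq_zero _).1 h0
    have hgf' : homDiff P.P (regular R) (n₀ - 1) g = f₀ := hgf
    have h1 : f₀ p = R.d (g p) := by
      refine (LinearMap.congr_fun hgf' p).symm.trans ((homDiff_apply _ _ _ _ _).trans ?_)
      rw [hdp, map_zero, smul_zero, sub_zero]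
      rfl
    rw [h1, ← neg_eq_iff_eq_neg.2 (R.d_inv (g p)), map_neg, hdω, neg_zero] at hf₀1
    exact zero_ne_one hf₀1
  have hspan : ∀ x : HomCohomology P.P (regular R) n₀, ∃ c : k, c • v = x := by
    intro x
    obtain ⟨⟨f, hf, hdf⟩, rfl⟩ := Submodule.Quotient.mk_surjective _ x
    let f' : P.P.carrier →ₗ[k] R.carrier := f
    obtain ⟨g, hg, hgf⟩ := exists_homDiff_eq P hω hd hK hdp hp1
      (f := ω.val (R.inv (f' p)) • f₀ - f')
      (Submodule.sub_mem _ (Submodule.smul_mem _ _ hf₀) hf)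
      (LinearMap.mem_ker.1 (Submodule.sub_mem _ (Submodule.smul_mem _ _ hdf₀) hdf))
      (by
        rw [LinearMap.sub_apply, map_sub, map_sub, LinearMap.smul_apply, map_smul, map_smul, hf₀1,
          smul_eq_mul, mul_one, sub_self])
    refine ⟨ω.val (R.inv (f' p)), ?_⟩
    rw [← Submodule.Quotient.mk_smul]
    exact (Submodule.Quotient.eq _).2 ⟨g, hg, hgf⟩
  have hzero : ∀ n ≠ n₀, ∀ x : HomCohomology P.P (regular R) n, x = 0 := by
    intro n hn x
    obtain ⟨⟨f, hf, hdf⟩, rfl⟩ := Submodule.Quotient.mk_surjective _ x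
    obtain ⟨g, hg, hgf⟩ := exists_homDiff_eq P hω hd hK hdp hp1 hf hdf
      (hω (0 + n) (by omega) _ (invol_mem R.gr (hf.1 0 p hp)))
    exact (Submodule.Quotient.mk_eq_zero _).2 ⟨g, hg, hgf⟩
  exact rank_directSum_eq_one (k := k) (V := fun n => HomCohomology P.P (regular R) n) hv hspan
    hzero

end

end DGA

theorem theorem2 {k : Type u} [Field k] (R : DGA.AugCDGA.{u, v} k) (N : ℤ)
    (hpos : R.IsNonneg) (hzero : R.HZeroIsBase) (hN : R.HVanishesAbove N) :
    List.TFAE [R.DimTEq 1, R.cohomology.DimTEq 1, R.cohomology.IsPoincareDuality] ∧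
      (R.DimTEq 1 → R.IsGorenstein) := by
  have h0 := DGA.cocycle_zero_of_hZeroIsBase hpos hzero
  have hN' := DGA.exists_d_eq_of_hVanishesAbove hN
  have hposH := DGA.isNonneg_cohomology hpos
  have h0H : ∀ x ∈ R.cohomology.gr 0, ∃ c : k, x = algebraMap k R.cohomology.carrier c := by
    intro x hx
    obtain ⟨c, hc, -⟩ := hzero x hx
    exact ⟨c, hc.symm⟩
  have hNH : ∀ i > N, ∀ x ∈ R.cohomology.gr i, R.cohomology.d x = 0 →
      ∃ y, R.cohomology.d y = x := by
    intro i hi x hx _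
    rw [hN i hi] at hx
    exact ⟨0, ((Submodule.mem_bot k).1 hx).symm⟩
  have hR : R.DimTEq 1 → DGA.HasDualizingCocycle R :=
    DGA.hasDualizingCocycle_of_dimTEq_one hpos h0 hN'
  refine ⟨?_, fun h => (hR h).isGorenstein hpos h0⟩
  tfae_have 1 → 3 := fun h =>
    (DGA.hasPerfectPairing_iff_isPoincareDuality (fun _ => rfl) hposH h0H).1
      ((DGA.hasPerfectPairing_cohomology_iff R).2 (hR h).hasPerfectPairing)
  tfae_have 3 → 1 := fun h => DGA.HasDualizingCocycle.dimTEq_one hpos h0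
    ((DGA.hasPerfectPairing_cohomology_iff R).1
      ((DGA.hasPerfectPairing_iff_isPoincareDuality (fun _ => rfl) hposH h0H).2
        h)).hasDualizingCocycle
  tfae_have 2 → 3 := fun h =>
    (DGA.hasPerfectPairing_iff_isPoincareDuality (fun _ => rfl) hposH h0H).1
      (DGA.hasDualizingCocycle_of_dimTEq_one hposH (fun x hx _ => h0H x hx) hNH
        h).hasPerfectPairing
  tfae_have 3 → 2 := fun h => DGA.HasDualizingCocycle.dimTEq_one hposH (fun x hx _ => h0H x hx)
    ((DGA.hasPerfectPairing_iff_isPoincareDuality (fun _ => rfl) hposH h0H).2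
      h).hasDualizingCocycle
  tfae_finish
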